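/- Let $\hbar,m,\omega_x,\omega_y,\omega_z,b,c,R>0$, let $A\ge 1$, let $\omega,\lambda\in\mathbb R$ satisfy $|\omega-\tfrac cb\lambda|<\omega_y$ and $|\omega-\tfrac bc\lambda|<\omega_z$, and let $S$ be a finite non-empty set of internal states (spin, isospin, ...) of a particle. On the $A$-particle space $L^2(\mathbb R^{3A})\otimes(\mathbb C^S)^{\otimes A}$, with Schwartz wave functions as regular domain, consider the Routhian of the cranked anisotropic oscillator $$H=-\frac{\hbar^2}{2m}\Delta+\frac m2\sum_{\alpha=1}^A(\omega_x^2x_\alpha^2+\omega_y^2y_\alpha^2+\omega_z^2z_\alpha^2)-(\omega L_x-\lambda C_x),$$ $$L_x=-i\hbar\sum_\alpha\Big(y_\alpha\frac{\partial}{\partial z_\alpha}-z_\alpha\frac{\partial}{\partial y_\alpha}\Big),\qquad C_x=-i\hbar\sum_\alpha\Big(\frac cb\,y_\alpha\frac{\partial}{\partial z_\alpha}-\frac bc\,z_\alpha\frac{\partial}{\partial y_\alpha}\Big).$$ Put $$q^2=\tfrac14(\omega_y^2-\omega_z^2)^2+(\omega_y^2+\omega_z^2)(2\omega^2+\lambda^2)+\Big(\tfrac{b^2}{c^2}\omega_y^2+\tfrac{c^2}{b^2}\omega_z^2\Big)\lambda^2-\Big(\big(\tfrac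 cb+3\tfrac bc\big)\omega_y^2+\big(\tfrac bc+3\tfrac cb\big)\omega_z^2\Big)\omega\lambda,$$ $$\Omega_\pm^2=\tfrac12(\omega_y^2+\omega_z^2)+\omega^2+\lambda^2-\big(\tfrac cb+\tfrac bc\big)\omega\lambda\pm q,\qquad \tilde E(N)=\hbar\omega_xN_x+\hbar\Omega_+N_y+\hbar\Omega_-N_z,$$ where $q=\sigma\sqrt{q^2}$ is the root with a fixed sign $\sigma\in\{1,-1\}$ and $\Omega_\pm$ are the non-negative square roots. Then the following hold. 1. Let $c_{\alpha k}$, $c_{\alpha k}^\dagger$ be the oscillator bosons of particle $\alpha$ in direction $k\in\{x,y,z\}$, i.e. $c_{\alpha x}=(m\omega_xx_\alpha+\hbar\,\partial/\partial x_\alpha)/\sqrt{2\hbar m\omega_x}$, and similarly for $y,z$. The Routhian is a quadratic form in them: $$H=\sum_{\alpha}\sum_k\hbar\omega_k\big(c_{\alpha k}^\dagger c_{\alpha k}+\tfrac12\big)-(\omega L_x-\lambda C_x),$$ $$C_x=\frac{-i\hbar}{2\sqrt{\omega_y\omega_z}}\sum_\alpha\Big\{\big(\tfrac cb\omega_z+\tfrac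 bc\omega_y\big)\big(c_{\alpha y}^\dagger c_{\alpha z}-c_{\alpha z}^\dagger c_{\alpha y}\big)+\big(\tfrac bc\omega_y-\tfrac cb\omega_z\big)\big(c_{\alpha y}^\dagger c_{\alpha z}^\dagger-c_{\alpha z}c_{\alpha y}\big)\Big\},$$ and $L_x$ is given by the same expression with $c/b$ and $b/c$ replaced by $1$. 2. The expression for $q^2$ is non-negative, the expressions for $\Omega_\pm^2$ are positive, and $\Omega_\pm>0$. 3. The eigenvalues of $H$ are exactly the numbers $\tilde E(N)$ with $N_k=\sum_{\alpha=1}^A(n_{\alpha k}+\tfrac12)$, $n_{\alpha k}\in\{0,1,2,\dots\}$. On the antisymmetric (fermion) states they are exactly those $\tilde E(N)$ for which, with suitable $s_\alpha\in S$, the pairs $\big((n_{\alpha x},n_{\alpha y},n_{\alpha z}),s_\alpha\big)$, $\alpha=1,\dots,A$, are distinct. Both hold for eigenvectors in $L^2$ (eigenvalue equation in the weak sense, against all Schwartz functions) and for Schwartz eigenfunctions. 4. There is a canonical (Bogoliubov) transformation $d_{\alpha j}=\sum_k(U_{jk}c_{\alpha k}+V_{jk}c_{\alpha k}^\dagger)$,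 the same for all particles and with $d_{\alpha x}=c_{\alpha x}$, such that the $d_{\alpha j},d_{\alpha j}^\dagger$ satisfy the boson commutation relations and $$H=\hbar\omega_x\hat N_x+\hbar\Omega_+\hat N_y+\hbar\Omega_-\hat N_z,\qquad \hat N_j=\sum_\alpha\big(d_{\alpha j}^\dagger d_{\alpha j}+\tfrac12\big).$$ The Hilbert space has an orthonormal basis, indexed by $(n_{\alpha j})$ and $(s_\alpha)\in S^A$, of Schwartz functions that are joint eigenfunctions of all $d_{\alpha j}^\dagger d_{\alpha j}$, with eigenvalues $n_{\alpha j}$, and of $H$, with eigenvalue $\tilde E(N)$. 5. Let $\Psi$ be a normalized Schwartz state with $\hat N_j\Psi=N_j\Psi$ for $j=x,y,z$. Then $H\Psi=\tilde E(N)\Psi$. Write $\langle\cdot\rangle$ for the expectation in $\Psi$, $I_0=\tfrac25AmR^2$, and define the axes lengths $\bar a,\bar b,\bar c$ in units of $R$ by $\tfrac15\bar a^2R^2=\tfrac1A\langle\sum_\alpha x_\alpha^2\rangle$ and similarly for $y$, $z$. (Self-consistency, $\bar b=b$ and $\bar c=c$, is not required.) The Hellmann–Feynman identity $\langle\partial H/\partial\omega_x\rangle=\partial\tilde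 E/\partial\omega_x$ holds, and $$\frac{I_0}{2\hbar}\bar a^2=\frac{N_x}{\omega_x}.$$ If moreover $q\ne0$, then the Hellmann–Feynman identity holds for the derivatives with respect to $\omega_y,\omega_z,\omega,\lambda$ too ($N$, $\sigma$ and the other parameters fixed), and with $s=\frac{N_y}{\Omega_+}+\frac{N_z}{\Omega_-}$, $t=\frac{N_y}{\Omega_+}-\frac{N_z}{\Omega_-}$, $$\frac{I_0}{2\hbar}\bar b^2=\frac s2+\frac t{2q}\Big[\tfrac12(\omega_y^2-\omega_z^2)+2\omega^2+\big(1+\tfrac{b^2}{c^2}\big)\lambda^2-\big(\tfrac cb+3\tfrac bc\big)\omega\lambda\Big],$$ $$\frac{I_0}{2\hbar}\bar c^2=\frac s2-\frac t{2q}\Big[\tfrac12(\omega_y^2-\omega_z^2)-2\omega^2-\big(1+\tfrac{c^2}{b^2}\big)\lambda^2+\big(\tfrac bc+3\tfrac cb\big)\omega\lambda\Big],$$ $$\langle L_x\rangle=-\hbar s\Big(\omega-\tfrac12\big(\tfrac cb+\tfrac bc\big)\lambda\Big)-\frac{\hbar t}{2q}\Big[2(\omega_y^2+\omega_z^2)\omega-\tfrac12\Big(\big(\tfrac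 bc+3\tfrac cb\big)\omega_z^2+\big(\tfrac cb+3\tfrac bc\big)\omega_y^2\Big)\lambda\Big],$$ $$\langle C_x\rangle=\hbar s\Big(\lambda-\tfrac12\big(\tfrac cb+\tfrac bc\big)\omega\Big)+\frac{\hbar t}{2q}\Big[(b^2+c^2)\Big(\tfrac{\omega_y^2}{c^2}+\tfrac{\omega_z^2}{b^2}\Big)\lambda-\tfrac12\Big(\big(\tfrac cb+3\tfrac bc\big)\omega_y^2+\big(\tfrac bc+3\tfrac cb\big)\omega_z^2\Big)\omega\Big].$$ 6. If $\sigma(\omega_y-\omega_z)\ge0$, then $\Omega_+\to\omega_y$ and $\Omega_-\to\omega_z$ as $(\omega,\lambda)\to(0,0)$, the other parameters being fixed. -/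

import Mathlib

open scoped SchwartzMap ComplexConjugate
open MeasureTheory Filter Topology

noncomputable section

namespace CrankedOscillator

/-! ### The quantum mechanics of `A` particles in space, with a finite set `S` of internal states -/

/-- Configurations `(x_{α k})` of `A` particles in space; `k = 0, 1, 2` stands for `x, y, z`. -/
abbrev Config (A : ℕ) : Type := EuclideanSpace ℝ (Fin A × Fin 3)

/-- Regular (Schwartz) wave functions of `A` particles with internal states in `S`
(for instance spin and isospin; `S = Unit` if there are none). -/
abbrev State (A : ℕ) (S : Type*) : Type _ := (Fin A → S) → 𝓢(Config A, ℂ)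

/-- The Hilbert space `L²` of `A` particles with internal states in `S`. -/
abbrev Hilb (A : ℕ) (S : Type*) [Fintype S] : Type _ :=
  PiLp 2 (fun _ : Fin A → S => Lp ℂ 2 (volume : Measure (Config A)))

variable {A : ℕ} {S : Type*}

/-- A regular wave function as an element of the Hilbert space. -/
def embed [Fintype S] (Ψ : State A S) : Hilb A S :=
  WithLp.toLp 2 (fun s => (Ψ s).toLp 2 volume)

/-- The expectation `⟨Ψ, T Ψ⟩` (for normalized `Ψ`). -/
def expect [Fintype S] (T : Module.End ℂ (State A S)) (Ψ : State A S) : ℂ :=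
  inner ℂ (embed Ψ) (embed (T Ψ))

variable (A S) in
/-- The position operator: multiplication by `x_{α k}`. -/
def pos (α : Fin A) (k : Fin 3) : Module.End ℂ (State A S) :=
  LinearMap.compLeft
    (SchwartzMap.smulLeftCLM ℂ (fun x : Config A => ((x (α, k) : ℝ) : ℂ))).toLinearMap (Fin A → S)

variable (A S) in
/-- The partial derivative `∂ / ∂x_{α k}`. -/
def partialD (α : Fin A) (k : Fin 3) : Module.End ℂ (State A S) :=
  LinearMap.compLeft
    (LineDeriv.lineDerivOpCLM ℂ 𝓢(Config A, ℂ)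
      (EuclideanSpace.single (α, k) (1 : ℝ))).toLinearMap (Fin A → S)

lemma hasTemperateGrowth_coord (i : Fin A × Fin 3) :
    (fun x : Config A => ((x i : ℝ) : ℂ)).HasTemperateGrowth := by
  exact (Complex.ofRealCLM.comp (EuclideanSpace.proj (𝕜 := ℝ) i)).hasTemperateGrowth

lemma pos_apply (α : Fin A) (k : Fin 3) (Ψ : State A S) (s : Fin A → S) (x : Config A) :
    pos A S α k Ψ s x = (x (α, k) : ℂ) * Ψ s x := by
  simp [pos, SchwartzMap.smulLeftCLM_apply_apply (hasTemperateGrowth_coord (α, k))]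

lemma partialD_apply (α : Fin A) (k : Fin 3) (Ψ : State A S) (s : Fin A → S) (x : Config A) :
    partialD A S α k Ψ s x
      = lineDeriv ℝ (Ψ s) x (EuclideanSpace.single (α, k) (1 : ℝ)) := by
  simp [partialD, SchwartzMap.lineDerivOp_apply]

/-- Exchange of the particles: `x_{α k}` becomes `x_{π(α) k}`. -/
def permConfig (π : Equiv.Perm (Fin A)) (x : Config A) : Config A :=
  WithLp.toLp 2 (fun i => x (π i.1, i.2))

/-- Antisymmetry (Pauli principle) under exchange of positions and internal states. -/
def IsAntisymmetric [Fintype S] (Ψ : Hilb A S) : Prop :=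
  ∀ (π : Equiv.Perm (Fin A)) (s : Fin A → S), ∀ᵐ x : Config A,
    Ψ (s ∘ π) (permConfig π x) = ((Equiv.Perm.sign π : ℤ) : ℂ) * Ψ s x

/-- `E` is an eigenvalue, with an eigenvector in the Hilbert space that satisfies the
condition `K`, of the maximal realization of the symmetric operator `T`: the eigenvalue equation
holds weakly, against all regular wave functions. -/
def HasL2Eigenvalue [Fintype S] (T : Module.End ℂ (State A S)) (K : Hilb A S → Prop) (E : ℂ) :
    Prop :=
  ∃ Ψ : Hilb A S, K Ψ ∧ Ψ ≠ 0 ∧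
    ∀ Φ : State A S, inner ℂ (embed (T Φ)) Ψ = E * inner ℂ (embed Φ) Ψ

/-- `E` is an eigenvalue of `T` with a regular eigenfunction that satisfies the condition `K`. -/
def HasRegularEigenvalue [Fintype S] (T : Module.End ℂ (State A S)) (K : Hilb A S → Prop)
    (E : ℂ) : Prop :=
  ∃ Φ : State A S, K (embed Φ) ∧ Module.End.HasEigenvector T E Φ

/-- The Hellmann-Feynman identity at the parameter value `t`, for a Hamiltonian `H` and an energy
`E` that depend on a real parameter and the state `Ψ`: `⟨∂H/∂t⟩ = ∂E/∂t`. -/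
def HellmannFeynman [Fintype S] (H : ℝ → Module.End ℂ (State A S)) (E : ℝ → ℝ) (Ψ : State A S)
    (t : ℝ) : Prop :=
  ∃ D : ℝ, HasDerivAt (fun u => expect (H u) Ψ) (D : ℂ) t ∧ HasDerivAt E D t

/-! ### The cranked anisotropic oscillator -/

/-- The parameters: `ħ`, the particle mass, the oscillator frequencies, the axes lengths `b, c`
that enter the circulation, the angular velocity `ω` and the vortex velocity `λ` (`lam`). -/
structure Params where
  hbar : ℝ
  m : ℝ
  ωx : ℝ
  ωy : ℝ
  ωz : ℝ
  b : ℝ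
  c : ℝ
  ω : ℝ
  lam : ℝ

/-- The sum over the particles of the squared `k`-th coordinate. -/
def sumSq (A : ℕ) (S : Type*) (k : Fin 3) : Module.End ℂ (State A S) :=
  ∑ α, pos A S α k * pos A S α k

namespace Params

variable (P : Params)

/-- The oscillator frequencies. -/
def freq : Fin 3 → ℝ := ![P.ωx, P.ωy, P.ωz]

/-- Angular momentum `L_x = -iħ ∑_α (y ∂_z - z ∂_y)`. -/
def angMom (A : ℕ) (S : Type*) : Module.End ℂ (State A S) :=
  (-Complex.I * P.hbar) •
    ∑ α, (pos A S α 1 * partialD A S α 2 - pos A S α 2 * partialD A S α 1)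

/-- Kelvin circulation `C_x = -iħ ∑_α ((c/b) y ∂_z - (b/c) z ∂_y)`. -/
def circ (A : ℕ) (S : Type*) : Module.End ℂ (State A S) :=
  (-Complex.I * P.hbar) •
    ∑ α, (((P.c / P.b : ℝ) : ℂ) • (pos A S α 1 * partialD A S α 2)
      - ((P.b / P.c : ℝ) : ℂ) • (pos A S α 2 * partialD A S α 1))

/-- The `A`-particle Routhian
`-ħ²/(2m) Δ + ½ m ∑_α (ω_x² x² + ω_y² y² + ω_z² z²) - (ω L_x - λ C_x)`. -/
def routhian (A : ℕ) (S : Type*) : Module.End ℂ (State A S) :=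
  ((-(P.hbar ^ 2 / (2 * P.m)) : ℝ) : ℂ) • (∑ α, ∑ k, partialD A S α k * partialD A S α k)
    + ∑ k, ((1 / 2 * P.m * P.freq k ^ 2 : ℝ) : ℂ) • sumSq A S k
    - ((P.ω : ℂ) • P.angMom A S - (P.lam : ℂ) • P.circ A S)

/-- Oscillator annihilation boson `c_{α k} = (m ω_k x + ħ ∂) / √(2 ħ m ω_k)`. -/
def ann (A : ℕ) (S : Type*) (α : Fin A) (k : Fin 3) : Module.End ℂ (State A S) :=
  (((√(2 * P.hbar * P.m * P.freq k))⁻¹ : ℝ) : ℂ) •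
    (((P.m * P.freq k : ℝ) : ℂ) • pos A S α k + (P.hbar : ℂ) • partialD A S α k)

/-- Oscillator creation boson `c†_{α k} = (m ω_k x - ħ ∂) / √(2 ħ m ω_k)`. -/
def cre (A : ℕ) (S : Type*) (α : Fin A) (k : Fin 3) : Module.End ℂ (State A S) :=
  (((√(2 * P.hbar * P.m * P.freq k))⁻¹ : ℝ) : ℂ) •
    (((P.m * P.freq k : ℝ) : ℂ) • pos A S α k - (P.hbar : ℂ) • partialD A S α k)

/-- The quadratic form in the bosons
`-iħ/(2√(ω_y ω_z)) {(r ω_z + s ω_y)(c_y† c_z - c_z† c_y) + (s ω_y - r ω_z)(c_y† c_z† - c_z c_y)}`,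
summed over the particles; it represents the circulation for `r = c/b`, `s = b/c` and the angular
momentum for `r = s = 1`. -/
def bosonCirc (A : ℕ) (S : Type*) (r s : ℝ) : Module.End ℂ (State A S) :=
  (-Complex.I * P.hbar / ((2 * √(P.ωy * P.ωz) : ℝ) : ℂ)) • ∑ α,
    (((r * P.ωz + s * P.ωy : ℝ) : ℂ) •
        (P.cre A S α 1 * P.ann A S α 2 - P.cre A S α 2 * P.ann A S α 1)
      + ((s * P.ωy - r * P.ωz : ℝ) : ℂ) •
        (P.cre A S α 1 * P.cre A S α 2 - P.ann A S α 2 * P.ann A S α 1))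

/-- New annihilation bosons `d_{α j} = ∑_k (U_{jk} c_{α k} + V_{jk} c†_{α k})`. -/
def newAnn (A : ℕ) (S : Type*) (U V : Matrix (Fin 3) (Fin 3) ℂ) (α : Fin A) (j : Fin 3) :
    Module.End ℂ (State A S) :=
  ∑ k, (U j k • P.ann A S α k + V j k • P.cre A S α k)

/-- The Hermitian conjugates `d†_{α j} = ∑_k (conj U_{jk} c†_{α k} + conj V_{jk} c_{α k})`. -/
def newCre (A : ℕ) (S : Type*) (U V : Matrix (Fin 3) (Fin 3) ℂ) (α : Fin A) (j : Fin 3) :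
    Module.End ℂ (State A S) :=
  ∑ k, (conj (U j k) • P.cre A S α k + conj (V j k) • P.ann A S α k)

/-- The transformation `(c, c†) ↦ (d, d†)` is canonical: the new operators are bosons. -/
def IsCanonical (A : ℕ) (S : Type*) (U V : Matrix (Fin 3) (Fin 3) ℂ) : Prop :=
  ∀ (α β : Fin A) (j k : Fin 3),
    P.newAnn A S U V α j * P.newCre A S U V β k - P.newCre A S U V β k * P.newAnn A S U V α j
        = (if α = β ∧ j = k then 1 else 0)
    ∧ P.newAnn A S U V α j * P.newAnn A S U V β k = P.newAnn A S U V β k * P.newAnn A S U V α j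
    ∧ P.newCre A S U V α j * P.newCre A S U V β k = P.newCre A S U V β k * P.newCre A S U V α j

/-- The number `d†_{α j} d_{α j}` of new bosons of particle `α` in the mode `j`. -/
def number (A : ℕ) (S : Type*) (U V : Matrix (Fin 3) (Fin 3) ℂ) (α : Fin A) (j : Fin 3) :
    Module.End ℂ (State A S) :=
  P.newCre A S U V α j * P.newAnn A S U V α j

/-- The total number of quanta `∑_α (d†_{α j} d_{α j} + ½)` in the mode `j`. -/
def quanta (A : ℕ) (S : Type*) (U V : Matrix (Fin 3) (Fin 3) ℂ) (j : Fin 3) :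
    Module.End ℂ (State A S) :=
  ∑ α, (P.number A S U V α j + (1 / 2 : ℂ) • 1)

/-! ### Frequencies and energies -/

/-- `½(ω_y² + ω_z²) + ω² + λ² - (c/b + b/c) ω λ`. -/
def meanSq : ℝ :=
  1 / 2 * (P.ωy ^ 2 + P.ωz ^ 2) + P.ω ^ 2 + P.lam ^ 2 - (P.c / P.b + P.b / P.c) * P.ω * P.lam

/-- The explicit expression for `q²`. -/
def qSq : ℝ :=
  1 / 4 * (P.ωy ^ 2 - P.ωz ^ 2) ^ 2
    + (P.ωy ^ 2 + P.ωz ^ 2) * (2 * P.ω ^ 2 + P.lam ^ 2)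
    + (P.b ^ 2 / P.c ^ 2 * P.ωy ^ 2 + P.c ^ 2 / P.b ^ 2 * P.ωz ^ 2) * P.lam ^ 2
    - ((P.c / P.b + 3 * (P.b / P.c)) * P.ωy ^ 2 + (P.b / P.c + 3 * (P.c / P.b)) * P.ωz ^ 2)
      * P.ω * P.lam

/-- The root `q` of `q²` with the sign `σ = ±1`. -/
def q (σ : ℝ) : ℝ := σ * √P.qSq

/-- `Ω₊`. -/
def Ωp (σ : ℝ) : ℝ := √(P.meanSq + P.q σ)

/-- `Ω₋`. -/
def Ωm (σ : ℝ) : ℝ := √(P.meanSq - P.q σ)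

/-- `Ẽ = ħ ω_x N_x + ħ Ω₊ N_y + ħ Ω₋ N_z`. -/
def energy (σ : ℝ) (N : Fin 3 → ℝ) : ℝ :=
  P.hbar * P.ωx * N 0 + P.hbar * P.Ωp σ * N 1 + P.hbar * P.Ωm σ * N 2

/-- `N_y / Ω₊ + N_z / Ω₋`. -/
def ratioSum (σ : ℝ) (N : Fin 3 → ℝ) : ℝ := N 1 / P.Ωp σ + N 2 / P.Ωm σ

/-- `N_y / Ω₊ - N_z / Ω₋`. -/
def ratioDiff (σ : ℝ) (N : Fin 3 → ℝ) : ℝ := N 1 / P.Ωp σ - N 2 / P.Ωm σ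

/-- The moment of inertia `I₀ = (2/5) M R²` of a sphere of radius `R`, with `M = A m`. -/
def I₀ (A : ℕ) (R : ℝ) : ℝ := 2 / 5 * (A * P.m) * R ^ 2

end Params

/-- The squared `k`-th axis length, in units of `R`, of the inertia ellipsoid in the state `Ψ`:
`(a_k²/5) R² = (1/A) ⟨∑_α x_{α k}²⟩`. -/
def axisSq [Fintype S] (R : ℝ) (Ψ : State A S) (k : Fin 3) : ℂ :=
  ((5 / (A * R ^ 2) : ℝ) : ℂ) * expect (sumSq A S k) Ψ

/-- The total numbers of quanta `N_k = ∑_α (n_{α k} + ½)`. -/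
def totalQuanta (n : Fin A → Fin 3 → ℕ) (k : Fin 3) : ℝ := ∑ α, ((n α k : ℝ) + 1 / 2)

end CrankedOscillator

end

/-!
Why the Routhian is a sum of independent oscillators. Put `u = ω - (c/b) λ` and `v = ω - (b/c) λ`.
In the operators `Q = (x, y, i∂_z)` and `D = (∂_x, ∂_y, iz)` the one-particle Routhian is `ħ` times
a quadratic form in the commuting `Q` minus a quadratic form in the commuting `D`, and both forms
have real coefficients (`Params.Stable.routhian_eq_forms`). They are positive definite exactly when
`|u| < ω_y` and `|v| < ω_z`. As `[D_k, Q_l] = δ_{kl}`, a simultaneous symplectic diagonalization by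
real matrices `F`, `G` (`Params.Modes`, `Params.Stable.exists_modes`) gives bosons
`d_j = ∑_k (F_{jk} Q_k + G_{jk} D_k)`. Their frequencies are those of a charged particle in the plane
with potential constants `ω_y² - u²`, `ω_z² - v²` and cyclotron frequency `u + v`: the product
`Ω₊² Ω₋²` equals `(ω_y² - u²)(ω_z² - v²)`, and `4q²` is a sum of non-negative terms in these
quantities, which gives the positivity. The amplitudes come from `exists_mode_moments`.

The `d_j` annihilate a Gaussian `g` with complex exponent, whose real part is negative definite
(`Params.Modes.exists_isVacuum`). The states obtained from it by creation operators are orthogonal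
by boson algebra alone (`IsBosonFamily`). They are complete because their span is invariant under
the positions, hence contains `g` times all powers of linear forms, and because a function `h` in
`L²` that is orthogonal to all of these has `conj g * h` with vanishing moments; this product decays
faster than any exponential, so its Fourier transform is the sum of a power series in the moments
and vanishes (`ae_eq_zero_of_gaussian_moments`).

The basis determines the spectrum: if a weak eigenvector has a component along a basis state, the
eigenvalue is the energy of that state. An exchange of particles permutes the basis states, since it
fixes `g` and permutes the creation operators. So an antisymmetric state has no component in which
two particles occupy the same one-particle state, and for distinct one-particle states the Slater
determinant is non-zero (`Params.Modes.IsVacuum.spectrum`).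

In a state with definite total numbers of quanta `N_j`, only the diagonal terms of `∑ Q_k Q_l` and
`∑ D_k D_l` have an expectation, namely `2 ∑_j G_{jk} G_{jl} N_j` and `-2 ∑_j F_{jk} F_{jl} N_j`. This
expresses `⟨x²⟩`, `⟨y²⟩`, `⟨z²⟩`, `⟨L_x⟩` and `⟨C_x⟩` by the amplitudes, which for `q ≠ 0` are rational in
the frequencies. The results agree with the derivatives of `Ẽ`
(`Params.Stable.energy_deriv`, `Params.Modes.hellmannFeynman`).
-/

noncomputable section

namespace CrankedOscillator

/-! ### Simultaneous diagonalization of the two quadratic forms -/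

/-- Prescribed squares and a consistent prescribed product, signs included. -/
lemma exists_sq_sq_mul {a b c : ℝ} (ha : 0 ≤ a) (hc : 0 ≤ c) (h : a * c = b ^ 2) :
    ∃ e g : ℝ, e ^ 2 = a ∧ g ^ 2 = c ∧ e * g = b := by
  have hs : √a * √c = |b| := by
    rw [← Real.sqrt_mul ha, h, Real.sqrt_sq_eq_abs]
  rcases le_total 0 b with hb | hb
  · exact ⟨√a, √c, Real.sq_sqrt ha, Real.sq_sqrt hc, by rw [hs, abs_of_nonneg hb]⟩
  · refine ⟨√a, -√c, Real.sq_sqrt ha, by rw [neg_sq, Real.sq_sqrt hc], ?_⟩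
    rw [mul_neg, hs, abs_of_nonpos hb, neg_neg]

lemma mul_eq_half_comm {n : Type*} [Fintype n] [DecidableEq n] {M N : Matrix n n ℝ}
    (h : M * N = (1 / 2 : ℝ) • 1) : N * M = (1 / 2 : ℝ) • 1 := by
  have h2 : ((2 : ℝ) • M) * N = 1 := by
    rw [Matrix.smul_mul, h, smul_smul]; norm_num
  have h3 := mul_eq_one_comm.1 h2
  rw [Matrix.mul_smul] at h3
  rw [← h3, smul_smul]; norm_num

/-- The moments that determine the amplitudes of the two modes of a charged particle in the plane,
with potential `p y² + r z²` and cyclotron frequency `k`; for distinct frequencies the amplitudes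
are unique up to a sign. -/
lemma exists_mode_moments {p r k Ω₁ Ω₂ : ℝ} (hp : 0 < p) (hr : 0 < r) (h₁ : 0 < Ω₁)
    (h₂ : 0 < Ω₂) (hsum : Ω₁ ^ 2 + Ω₂ ^ 2 = p + r + k ^ 2) (hprod : Ω₁ ^ 2 * Ω₂ ^ 2 = p * r) :
    ∃ e₁ e₂ g₁ g₂ : ℝ,
      e₁ * g₁ + e₂ * g₂ = 0 ∧ Ω₁ ^ 2 * (e₁ * g₁) + Ω₂ ^ 2 * (e₂ * g₂) = k / 2 ∧
      Ω₁ * e₁ ^ 2 + Ω₂ * e₂ ^ 2 = 1 / 2 ∧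
      Ω₁ ^ 3 * e₁ ^ 2 + Ω₂ ^ 3 * e₂ ^ 2 = (p + k ^ 2) / 2 ∧
      Ω₁ * g₁ ^ 2 + Ω₂ * g₂ ^ 2 = 1 / 2 ∧
      Ω₁ ^ 3 * g₁ ^ 2 + Ω₂ ^ 3 * g₂ ^ 2 = (r + k ^ 2) / 2 ∧
      (Ω₁ ^ 2 - Ω₂ ^ 2 ≠ 0 →
        e₁ ^ 2 = (Ω₁ ^ 2 - r) / (2 * Ω₁ * (Ω₁ ^ 2 - Ω₂ ^ 2)) ∧
        e₁ * g₁ = k / (2 * (Ω₁ ^ 2 - Ω₂ ^ 2)) ∧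
        g₁ ^ 2 = (Ω₁ ^ 2 - p) / (2 * Ω₁ * (Ω₁ ^ 2 - Ω₂ ^ 2)) ∧
        e₂ ^ 2 = (r - Ω₂ ^ 2) / (2 * Ω₂ * (Ω₁ ^ 2 - Ω₂ ^ 2)) ∧
        e₂ * g₂ = -k / (2 * (Ω₁ ^ 2 - Ω₂ ^ 2)) ∧
        g₂ ^ 2 = (p - Ω₂ ^ 2) / (2 * Ω₂ * (Ω₁ ^ 2 - Ω₂ ^ 2))) := by
  have hk : k ^ 2 = Ω₁ ^ 2 + Ω₂ ^ 2 - p - r := by linarith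
  by_cases hΔ : Ω₁ ^ 2 - Ω₂ ^ 2 = 0
  -- equal frequencies force `k = 0` and `p = r`: an isotropic oscillator, with any orthogonal modes
  · have hΩ : Ω₁ = Ω₂ := by
      have : (Ω₁ - Ω₂) * (Ω₁ + Ω₂) = 0 := by linear_combination hΔ
      rcases mul_eq_zero.1 this with h | h <;> linarith
    subst hΩ
    have hz : (p - r) ^ 2 + 2 * k ^ 2 * (p + r) + (k ^ 2) ^ 2 = 0 := by
      linear_combination (-(p + r + k ^ 2) - 2 * Ω₁ ^ 2) * hsum + 4 * hprod
    have hk0 : k = 0 := by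
      have : k ^ 2 * (p + r) = 0 := by
        nlinarith [sq_nonneg (p - r), sq_nonneg (k ^ 2), mul_nonneg (sq_nonneg k) (add_pos hp hr).le]
      rcases mul_eq_zero.1 this with h | h
      · exact pow_eq_zero_iff (two_ne_zero) |>.1 h
      · linarith
    subst hk0
    have hpr : p = r := by
      have : (p - r) ^ 2 = 0 := by linarith
      have := pow_eq_zero_iff (two_ne_zero) |>.1 this
      linarith
    subst hpr
    have hw : Ω₁ ^ 2 = p := by linarith
    have hs : √(1 / (2 * Ω₁)) ^ 2 = 1 / (2 * Ω₁) := Real.sq_sqrt (by positivity)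
    refine ⟨√(1 / (2 * Ω₁)), 0, 0, √(1 / (2 * Ω₁)), by ring, by ring, ?_, ?_, ?_, ?_,
      fun h => absurd hΔ h⟩ <;> rw [hs] <;> field_simp <;> linarith
  · set Δ := Ω₁ ^ 2 - Ω₂ ^ 2 with hΔd
    -- `p` and `r` separate the squared frequencies, so the prescribed squares are non-negative
    have key : ∀ x y w : ℝ, 0 < w → x * y ≤ 0 → x - y = Δ → 0 ≤ x / (2 * w * Δ) := by
      intro x y w hw hxy h
      have : x / (2 * w * Δ) = (x ^ 2 - x * y) / (2 * w * Δ ^ 2) := by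
        rw [div_eq_div_iff (by positivity) (by positivity), ← h]
        ring
      rw [this]
      have : 0 ≤ x ^ 2 - x * y := by nlinarith [sq_nonneg x]
      positivity
    have hrk : (Ω₁ ^ 2 - r) * (Ω₂ ^ 2 - r) ≤ 0 := by
      have : (Ω₁ ^ 2 - r) * (Ω₂ ^ 2 - r) = -(r * k ^ 2) := by
        linear_combination hprod - r * hsum
      rw [this]; nlinarith [mul_nonneg hr.le (sq_nonneg k)]
    have hpk : (Ω₁ ^ 2 - p) * (Ω₂ ^ 2 - p) ≤ 0 := by
      have : (Ω₁ ^ 2 - p) * (Ω₂ ^ 2 - p) = -(p * k ^ 2) := by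
        linear_combination hprod - p * hsum
      rw [this]; nlinarith [mul_nonneg hp.le (sq_nonneg k)]
    obtain ⟨e₁, g₁, ha₁, hc₁, hb₁⟩ := exists_sq_sq_mul (b := k / (2 * Δ))
      (key (Ω₁ ^ 2 - r) (Ω₂ ^ 2 - r) Ω₁ h₁ hrk (by rw [hΔd]; ring))
      (key (Ω₁ ^ 2 - p) (Ω₂ ^ 2 - p) Ω₁ h₁ hpk (by rw [hΔd]; ring))
      (by
        field_simp
        linear_combination Ω₁ ^ 2 * hsum - hprod)
    obtain ⟨e₂, g₂, ha₂, hc₂, hb₂⟩ := exists_sq_sq_mul (b := -k / (2 * Δ))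
      (key (r - Ω₂ ^ 2) (r - Ω₁ ^ 2) Ω₂ h₂ (by linarith) (by rw [hΔd]; ring))
      (key (p - Ω₂ ^ 2) (p - Ω₁ ^ 2) Ω₂ h₂ (by linarith) (by rw [hΔd]; ring))
      (by
        field_simp
        linear_combination Ω₂ ^ 2 * hsum - hprod)
    have hΩ₁ : Ω₁ ^ 2 = Δ + Ω₂ ^ 2 := by rw [hΔd]; ring
    refine ⟨e₁, e₂, g₁, g₂, ?_, ?_, ?_, ?_, ?_, ?_, fun _ => ⟨ha₁, hb₁, hc₁, ha₂, hb₂, hc₂⟩⟩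
    · rw [hb₁, hb₂]; ring
    · rw [hb₁, hb₂, hΩ₁]; field_simp; ring
    · rw [ha₁, ha₂]; field_simp; rw [hΔd]; ring
    · rw [ha₁, ha₂, hk]; field_simp; rw [hΔd]; ring
    · rw [hc₁, hc₂]; field_simp; rw [hΔd]; ring
    · rw [hc₁, hc₂, hk]; field_simp; rw [hΔd]; ring

/-- `ω - (c/b) λ`, the coefficient of `-y p_z` in the Routhian. -/
def Params.crankY (P : Params) : ℝ := P.ω - P.c / P.b * P.lam

/-- `ω - (b/c) λ`, the coefficient of `z p_y` in the Routhian. -/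
def Params.crankZ (P : Params) : ℝ := P.ω - P.b / P.c * P.lam

/-- The assumptions on the parameters: positivity, and cranking below the oscillator
frequencies. -/
structure Params.Stable (P : Params) : Prop where
  hbar : 0 < P.hbar
  m : 0 < P.m
  ωx : 0 < P.ωx
  ωy : 0 < P.ωy
  ωz : 0 < P.ωz
  b : 0 < P.b
  c : 0 < P.c
  hy : |P.crankY| < P.ωy
  hz : |P.crankZ| < P.ωz

/-! ### The frequencies of the new modes -/

namespace Params

variable {P : Params}

lemma Stable.py (h : P.Stable) : 0 < P.ωy ^ 2 - P.crankY ^ 2 := by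
  have := sq_lt_sq' (abs_lt.1 h.hy).1 (abs_lt.1 h.hy).2
  linarith

lemma Stable.pz (h : P.Stable) : 0 < P.ωz ^ 2 - P.crankZ ^ 2 := by
  have := sq_lt_sq' (abs_lt.1 h.hz).1 (abs_lt.1 h.hz).2
  linarith

lemma meanSq_eq (hb : P.b ≠ 0) (hc : P.c ≠ 0) : P.meanSq =
    1 / 2 * (P.ωy ^ 2 + P.ωz ^ 2) + P.crankY * P.crankZ := by
  unfold meanSq crankY crankZ; field_simp; ring

lemma qSq_eq (hb : P.b ≠ 0) (hc : P.c ≠ 0) : P.qSq =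
    1 / 4 * (P.ωy ^ 2 - P.ωz ^ 2) ^ 2
      + (P.crankY + P.crankZ) * (P.crankZ * P.ωy ^ 2 + P.crankY * P.ωz ^ 2) := by
  unfold qSq crankY crankZ; field_simp; ring

/-- `Ω₊² Ω₋²` is the product of the two stability gaps. -/
lemma meanSq_sq_sub_qSq (hb : P.b ≠ 0) (hc : P.c ≠ 0) : P.meanSq ^ 2 - P.qSq =
    (P.ωy ^ 2 - P.crankY ^ 2) * (P.ωz ^ 2 - P.crankZ ^ 2) := by
  rw [meanSq_eq hb hc, qSq_eq hb hc]; ring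

/-- `4 q²` is a sum of non-negative terms in the stability gaps and the total cranking. -/
lemma Stable.qSq_nonneg (h : P.Stable) : 0 ≤ P.qSq := by
  have e : P.qSq = 1 / 4 * (((P.crankY + P.crankZ) ^ 2) ^ 2 + 2 * (P.crankY + P.crankZ) ^ 2 *
      ((P.ωy ^ 2 - P.crankY ^ 2) + (P.ωz ^ 2 - P.crankZ ^ 2)) +
      ((P.ωy ^ 2 - P.crankY ^ 2) - (P.ωz ^ 2 - P.crankZ ^ 2)) ^ 2) := by
    rw [qSq_eq h.b.ne' h.c.ne']; ring
  have := h.py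
  have := h.pz
  rw [e]; positivity

lemma Stable.meanSq_pos (h : P.Stable) : 0 < P.meanSq := by
  have e : P.meanSq = 1 / 2 * ((P.ωy ^ 2 - P.crankY ^ 2) + (P.ωz ^ 2 - P.crankZ ^ 2)
      + (P.crankY + P.crankZ) ^ 2) := by
    rw [meanSq_eq h.b.ne' h.c.ne']; ring
  have := h.py
  have := h.pz
  rw [e]; positivity

lemma sign_sq {σ : ℝ} (hσ : σ = 1 ∨ σ = -1) : σ ^ 2 = 1 := by
  rcases hσ with rfl | rfl <;> norm_num

lemma Stable.q_sq (h : P.Stable) {σ : ℝ} (hσ : σ = 1 ∨ σ = -1) : P.q σ ^ 2 = P.qSq := by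
  rw [q, mul_pow, sign_sq hσ, Real.sq_sqrt h.qSq_nonneg, one_mul]

lemma Stable.abs_q_lt (h : P.Stable) {σ : ℝ} (hσ : σ = 1 ∨ σ = -1) : |P.q σ| < P.meanSq := by
  rw [← abs_of_pos h.meanSq_pos, ← sq_lt_sq, h.q_sq hσ]
  have := meanSq_sq_sub_qSq (P := P) h.b.ne' h.c.ne'
  have := mul_pos h.py h.pz
  linarith

lemma Stable.add_pos (h : P.Stable) {σ : ℝ} (hσ : σ = 1 ∨ σ = -1) : 0 < P.meanSq + P.q σ := by
  linarith [(abs_lt.1 (h.abs_q_lt hσ)).1]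

lemma Stable.sub_pos (h : P.Stable) {σ : ℝ} (hσ : σ = 1 ∨ σ = -1) : 0 < P.meanSq - P.q σ := by
  linarith [(abs_lt.1 (h.abs_q_lt hσ)).2]

lemma Stable.Ωp_pos (h : P.Stable) {σ : ℝ} (hσ : σ = 1 ∨ σ = -1) : 0 < P.Ωp σ :=
  Real.sqrt_pos.2 (h.add_pos hσ)

lemma Stable.Ωm_pos (h : P.Stable) {σ : ℝ} (hσ : σ = 1 ∨ σ = -1) : 0 < P.Ωm σ :=
  Real.sqrt_pos.2 (h.sub_pos hσ)

lemma Stable.Ωp_sq (h : P.Stable) {σ : ℝ} (hσ : σ = 1 ∨ σ = -1) :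
    P.Ωp σ ^ 2 = P.meanSq + P.q σ := Real.sq_sqrt (h.add_pos hσ).le

lemma Stable.Ωm_sq (h : P.Stable) {σ : ℝ} (hσ : σ = 1 ∨ σ = -1) :
    P.Ωm σ ^ 2 = P.meanSq - P.q σ := Real.sq_sqrt (h.sub_pos hσ).le

lemma Stable.Ω_sum (h : P.Stable) {σ : ℝ} (hσ : σ = 1 ∨ σ = -1) :
    P.Ωp σ ^ 2 + P.Ωm σ ^ 2 = (P.ωy ^ 2 - P.crankY ^ 2) + (P.ωz ^ 2 - P.crankZ ^ 2)
      + (P.crankY + P.crankZ) ^ 2 := by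
  rw [h.Ωp_sq hσ, h.Ωm_sq hσ, meanSq_eq h.b.ne' h.c.ne']; ring

lemma Stable.Ω_prod (h : P.Stable) {σ : ℝ} (hσ : σ = 1 ∨ σ = -1) :
    P.Ωp σ ^ 2 * P.Ωm σ ^ 2 =
      (P.ωy ^ 2 - P.crankY ^ 2) * (P.ωz ^ 2 - P.crankZ ^ 2) := by
  rw [h.Ωp_sq hσ, h.Ωm_sq hσ, ← meanSq_sq_sub_qSq h.b.ne' h.c.ne', ← h.q_sq hσ]; ring

/-- The frequencies of the new modes. -/
def newFreq (P : Params) (σ : ℝ) : Fin 3 → ℝ := ![P.ωx, P.Ωp σ, P.Ωm σ]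

/-- The quadratic form in `x, y, i∂_z` that enters the one-particle Routhian, divided by `ħ`, with a
plus sign. -/
def formQ (P : Params) : Matrix (Fin 3) (Fin 3) ℝ :=
  !![P.m * P.ωx ^ 2 / (2 * P.hbar), 0, 0;
     0, P.m * P.ωy ^ 2 / (2 * P.hbar), P.crankY / 2;
     0, P.crankY / 2, P.hbar / (2 * P.m)]

/-- The quadratic form in `∂_x, ∂_y, i z` that enters the one-particle Routhian, divided by `ħ`,
with a minus sign. -/
def formD (P : Params) : Matrix (Fin 3) (Fin 3) ℝ :=
  !![P.hbar / (2 * P.m), 0, 0;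
     0, P.hbar / (2 * P.m), P.crankZ / 2;
     0, P.crankZ / 2, P.m * P.ωz ^ 2 / (2 * P.hbar)]

/-- Real matrices `F`, `G` that diagonalize the two quadratic forms simultaneously and
symplectically. The modes are `d_j = ∑_k (F_{jk} Q_k + G_{jk} D_k)`, with
`Q = (x, y, i∂_z)` and `D = (∂_x, ∂_y, iz)`. The remaining fields record that the `x` mode
decouples, the values of the amplitudes where they are unique, and the equations of motion
of the modes. -/
structure Modes (P : Params) (σ : ℝ) where
  F : Matrix (Fin 3) (Fin 3) ℝ
  G : Matrix (Fin 3) (Fin 3) ℝ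
  /-- The boson commutation relations. -/
  mul_transpose : F * G.transpose = (1 / 2 : ℝ) • 1
  formQ_eq : ∀ k l, ∑ j, P.newFreq σ j * (F j k * F j l) = P.formQ k l
  formD_eq : ∀ k l, ∑ j, P.newFreq σ j * (G j k * G j l) = P.formD k l
  F_zero : F 0 = Pi.single 0 √(P.m * P.ωx / (2 * P.hbar))
  G_zero : G 0 = Pi.single 0 √(P.hbar / (2 * P.m * P.ωx))
  F_succ : ∀ j : Fin 2, F j.succ 0 = 0
  G_succ : ∀ j : Fin 2, G j.succ 0 = 0
  /-- For distinct frequencies the amplitudes are determined. -/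
  amplitudes : P.q σ ≠ 0 →
    G 1 1 ^ 2 = P.hbar / P.m * (P.meanSq + P.q σ - (P.ωz ^ 2 - P.crankZ ^ 2))
        / (4 * P.q σ * P.Ωp σ) ∧
    G 2 1 ^ 2 = P.hbar / P.m * ((P.ωz ^ 2 - P.crankZ ^ 2) - (P.meanSq - P.q σ))
        / (4 * P.q σ * P.Ωm σ) ∧
    F 1 2 ^ 2 = P.hbar / P.m * (P.meanSq + P.q σ - (P.ωy ^ 2 - P.crankY ^ 2))
        / (4 * P.q σ * P.Ωp σ) ∧
    F 2 2 ^ 2 = P.hbar / P.m * ((P.ωy ^ 2 - P.crankY ^ 2) - (P.meanSq - P.q σ))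
        / (4 * P.q σ * P.Ωm σ) ∧
    G 1 1 * F 1 2 = P.hbar / P.m * (P.crankY + P.crankZ) / (4 * P.q σ) ∧
    G 2 1 * F 2 2 = - (P.hbar / P.m * (P.crankY + P.crankZ) / (4 * P.q σ))
  F_one : F 1 1 = P.m / P.hbar * (P.Ωp σ * G 1 1 - P.crankZ * F 1 2)
  F_two : F 2 1 = P.m / P.hbar * (P.Ωm σ * G 2 1 - P.crankZ * F 2 2)
  G_one : G 1 2 = P.m / P.hbar * (P.Ωp σ * F 1 2 - P.crankY * G 1 1)
  G_two : G 2 2 = P.m / P.hbar * (P.Ωm σ * F 2 2 - P.crankY * G 2 1)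

/-- The positive definite quadratic forms are simultaneously diagonalizable. -/
theorem Stable.exists_modes (h : P.Stable) {σ : ℝ} (hσ : σ = 1 ∨ σ = -1) :
    Nonempty (P.Modes σ) := by
  obtain ⟨e₁, e₂, g₁, g₂, h0, hk, he, he3, hg, hg3, hu⟩ := exists_mode_moments h.py h.pz
    (h.Ωp_pos hσ) (h.Ωm_pos hσ) (h.Ω_sum hσ) (h.Ω_prod hσ)
  have hh := h.hbar
  have hm := h.m
  have hx := h.ωx
  set u := P.crankY with hud
  set v := P.crankZ with hvd
  set O₁ := P.Ωp σ with hO₁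
  set O₂ := P.Ωm σ with hO₂
  obtain ⟨s, hs, hs2⟩ : ∃ s : ℝ, 0 < s ∧ s ^ 2 = P.hbar / P.m :=
    ⟨√(P.hbar / P.m), Real.sqrt_pos.2 (by positivity), Real.sq_sqrt (by positivity)⟩
  have hmh : P.m / P.hbar = 1 / s ^ 2 := by rw [hs2, one_div_div]
  have hhm : P.hbar / (2 * P.m) = s ^ 2 / 2 := by rw [hs2]; field_simp
  have hmh' : ∀ w : ℝ, P.m * w / (2 * P.hbar) = w / (2 * s ^ 2) := by
    intro w; rw [hs2]; field_simp
  have hF0 : √(P.m * P.ωx / (2 * P.hbar)) ^ 2 = P.m * P.ωx / (2 * P.hbar) :=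
    Real.sq_sqrt (by positivity)
  have hG0 : √(P.hbar / (2 * P.m * P.ωx)) ^ 2 = P.hbar / (2 * P.m * P.ωx) :=
    Real.sq_sqrt (by positivity)
  have hFG0 : √(P.m * P.ωx / (2 * P.hbar)) * √(P.hbar / (2 * P.m * P.ωx)) = 1 / 2 := by
    rw [← Real.sqrt_mul (by positivity), show P.m * P.ωx / (2 * P.hbar) *
      (P.hbar / (2 * P.m * P.ωx)) = (1 / 2) ^ 2 by field_simp,
      Real.sqrt_sq (by norm_num)]
  have hGF : (!![√(P.hbar / (2 * P.m * P.ωx)), 0, 0;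
          0, s * e₁, (O₁ * g₁ - u * e₁) / s;
          0, s * e₂, (O₂ * g₂ - u * e₂) / s] : Matrix (Fin 3) (Fin 3) ℝ).transpose *
        !![√(P.m * P.ωx / (2 * P.hbar)), 0, 0;
          0, (O₁ * e₁ - v * g₁) / s, s * g₁;
          0, (O₂ * e₂ - v * g₂) / s, s * g₂] = (1 / 2 : ℝ) • 1 := by
    ext i j
    fin_cases i <;> fin_cases j <;>
      simp [Matrix.mul_apply, Fin.sum_univ_three, Matrix.smul_apply]
    · linarith
    · field_simp
      linear_combination 2 * he - 2 * v * h0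
    · linear_combination s ^ 2 * h0
    · field_simp
      linear_combination hk - u * he - v * hg + u * v * h0
    · field_simp
      linear_combination 2 * hg - 2 * u * h0
  refine ⟨⟨!![√(P.m * P.ωx / (2 * P.hbar)), 0, 0;
            0, (O₁ * e₁ - v * g₁) / s, s * g₁;
            0, (O₂ * e₂ - v * g₂) / s, s * g₂],
          !![√(P.hbar / (2 * P.m * P.ωx)), 0, 0;
            0, s * e₁, (O₁ * g₁ - u * e₁) / s;
            0, s * e₂, (O₂ * g₂ - u * e₂) / s], ?_, ?_, ?_, ?_, ?_, ?_, ?_, ?_, ?_, ?_, ?_, ?_⟩⟩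
  · exact mul_eq_half_comm hGF
  · intro k l
    fin_cases k <;> fin_cases l <;>
      simp [Fin.sum_univ_three, newFreq, formQ, ← hO₁, ← hO₂, ← hud, hmh', hhm]
    · rw [← sq, Real.sq_sqrt (by positivity)]; ring
    · field_simp
      linear_combination 2 * he3 - 4 * v * hk + 2 * v ^ 2 * hg
    · field_simp
      linear_combination 2 * hk - 2 * v * hg
    · field_simp
      linear_combination 2 * hk - 2 * v * hg
    · linear_combination s ^ 2 * hg
  · intro k l
    fin_cases k <;> fin_cases l <;>
      simp [Fin.sum_univ_three, newFreq, formD, ← hO₁, ← hO₂, ← hvd, hmh', hhm]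
    · rw [← sq, hG0, hs2]; field_simp
    · linear_combination s ^ 2 * he
    · field_simp
      linear_combination 2 * hk - 2 * u * he
    · field_simp
      linear_combination 2 * hk - 2 * u * he
    · field_simp
      linear_combination 2 * hg3 - 4 * u * hk + 2 * u ^ 2 * he
  · ext k; fin_cases k <;> simp
  · ext k; fin_cases k <;> simp
  · intro j; fin_cases j <;> simp
  · intro j; fin_cases j <;> simp
  · intro hq
    have hΔ : O₁ ^ 2 - O₂ ^ 2 = 2 * P.q σ := by
      rw [hO₁, hO₂, h.Ωp_sq hσ, h.Ωm_sq hσ]; ring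
    obtain ⟨a1, b1, c1, a2, b2, c2⟩ := hu (by rw [hΔ]; exact mul_ne_zero two_ne_zero hq)
    rw [hΔ] at a1 b1 c1 a2 b2 c2
    rw [h.Ωp_sq hσ] at a1 c1
    rw [h.Ωm_sq hσ] at a2 c2
    have hO1 := h.Ωp_pos hσ
    have hO2 := h.Ωm_pos hσ
    rw [← hO₁] at hO1
    rw [← hO₂] at hO2
    refine ⟨?_, ?_, ?_, ?_, ?_, ?_⟩ <;> simp [← hs2, ← hO₁, ← hO₂, ← hud, ← hvd]
    · rw [mul_pow, a1]; field_simp; norm_num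
    · rw [mul_pow, a2]; field_simp; norm_num
    · rw [mul_pow, c1]; field_simp; norm_num
    · rw [mul_pow, c2]; field_simp; norm_num
    · rw [show s * e₁ * (s * g₁) = s ^ 2 * (e₁ * g₁) by ring, b1]; field_simp; norm_num
    · rw [show s * e₂ * (s * g₂) = s ^ 2 * (e₂ * g₂) by ring, b2]; field_simp; norm_num
  all_goals
    simp [← hO₁, ← hO₂, ← hud, ← hvd, hmh]
    field_simp

end Params

/-! ### Positions and derivatives: adjoints and commutators -/

section Operators

variable {A : ℕ} {S : Type*}

section Inner

variable [Fintype S]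

lemma embed_add (Φ Ψ : State A S) : embed (Φ + Ψ) = embed Φ + embed Ψ := by
  ext1 s
  exact (SchwartzMap.toLpCLM ℂ ℂ 2 volume).map_add (Φ s) (Ψ s)

lemma embed_smul (a : ℂ) (Ψ : State A S) : embed (a • Ψ) = a • embed Ψ := by
  ext1 s
  exact (SchwartzMap.toLpCLM ℂ ℂ 2 volume).map_smul a (Ψ s)

variable (A S) in
/-- The inclusion of the regular wave functions in the Hilbert space as a linear map. -/
def embedL : State A S →ₗ[ℂ] Hilb A S where
  toFun := embed
  map_add' := embed_add
  map_smul' := embed_smul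

@[simp] lemma embedL_apply (Ψ : State A S) : embedL A S Ψ = embed Ψ := rfl

lemma embedL_injective : Function.Injective (embedL A S) := by
  intro Φ Ψ h
  funext s
  have h' : (Φ s).toLp 2 (volume : Measure (Config A)) = (Ψ s).toLp 2 volume :=
    congrFun (congrArg WithLp.ofLp h) s
  exact SchwartzMap.injective_toLp 2 volume h'

lemma inner_embed (Φ Ψ : State A S) :
    inner ℂ (embed Φ) (embed Ψ) = ∑ s, ∫ x, conj (Φ s x) * Ψ s x := by
  rw [PiLp.inner_apply]
  refine Finset.sum_congr rfl fun s _ => ?_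
  change inner ℂ ((Φ s).toLp 2 volume) ((Ψ s).toLp 2 volume) = _
  refine (SchwartzMap.inner_toL2_toL2_eq (Φ s) (Ψ s) volume).trans ?_
  exact integral_congr_ae (.of_forall fun x => by simp [mul_comm])

/-- `T'` is a formal adjoint of `T` on the regular wave functions. -/
def IsAdj (T T' : Module.End ℂ (State A S)) : Prop :=
  ∀ Φ Ψ : State A S, inner ℂ (embed (T Φ)) (embed Ψ) = inner ℂ (embed Φ) (embed (T' Ψ))

namespace IsAdj

variable {T T' U U' : Module.End ℂ (State A S)}

lemma add (hT : IsAdj T T') (hU : IsAdj U U') : IsAdj (T + U) (T' + U') := fun Φ Ψ => by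
  simp only [LinearMap.add_apply, embed_add, inner_add_left, inner_add_right, hT Φ Ψ, hU Φ Ψ]

lemma smul (a : ℂ) (hT : IsAdj T T') : IsAdj (a • T) (conj a • T') := fun Φ Ψ => by
  rw [LinearMap.smul_apply, LinearMap.smul_apply, embed_smul, embed_smul, inner_smul_left,
    inner_smul_right, hT Φ Ψ]

lemma neg (hT : IsAdj T T') : IsAdj (-T) (-T') := by
  have h := hT.smul (-1)
  rw [map_neg, map_one] at h
  convert h using 1 <;> module

lemma sub (hT : IsAdj T T') (hU : IsAdj U U') : IsAdj (T - U) (T' - U') := by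
  simpa [sub_eq_add_neg] using hT.add hU.neg

lemma mul (hT : IsAdj T T') (hU : IsAdj U U') : IsAdj (T * U) (U' * T') := fun Φ Ψ => by
  rw [Module.End.mul_apply, hT, hU, Module.End.mul_apply]

lemma zero : IsAdj (0 : Module.End ℂ (State A S)) 0 := fun Φ Ψ => by
  have : embed (0 : State A S) = 0 := (embedL A S).map_zero
  simp [this]

lemma one : IsAdj (1 : Module.End ℂ (State A S)) 1 := fun _ _ => rfl

lemma sum {ι : Type*} (s : Finset ι) {T T' : ι → Module.End ℂ (State A S)}
    (h : ∀ i, IsAdj (T i) (T' i)) : IsAdj (∑ i ∈ s, T i) (∑ i ∈ s, T' i) := by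
  classical
  induction s using Finset.induction_on with
  | empty => simpa using zero
  | insert i s hi ih => rw [Finset.sum_insert hi, Finset.sum_insert hi]; exact (h i).add ih

end IsAdj

lemma isAdj_pos (α : Fin A) (k : Fin 3) : IsAdj (pos A S α k) (pos A S α k) := fun Φ Ψ => by
  simp only [inner_embed, pos_apply, map_mul, Complex.conj_ofReal]
  refine Finset.sum_congr rfl fun s _ => integral_congr_ae (.of_forall fun x => ?_)
  simp only; ring

/-- Integration by parts. -/
lemma isAdj_partialD (α : Fin A) (k : Fin 3) :
    IsAdj (partialD A S α k) (-partialD A S α k) := fun Φ Ψ => by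
  simp only [inner_embed]
  refine Finset.sum_congr rfl fun s _ => ?_
  have h := SchwartzMap.integral_bilinear_lineDerivOp_right_eq_neg_left
    (μ := (volume : Measure (Config A))) (Φ s) (Ψ s)
    ((ContinuousLinearMap.mul ℝ ℂ).comp Complex.conjCLE.toContinuousLinearMap)
    (EuclideanSpace.single (α, k) (1 : ℝ))
  simp only [ContinuousLinearMap.comp_apply, ContinuousLinearMap.mul_apply'] at h
  have h' : ∀ x, ((-partialD A S α k) Ψ) s x =
      -(LineDeriv.lineDerivOp (EuclideanSpace.single (α, k) (1 : ℝ)) (Ψ s) : 𝓢(Config A, ℂ)) x :=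
    fun x => rfl
  simp only [h', mul_neg, integral_neg]
  exact (neg_eq_iff_eq_neg.2 h).symm

end Inner

lemma partialD_eq (α : Fin A) (k : Fin 3) (Ψ : State A S) (s : Fin A → S) :
    partialD A S α k Ψ s = LineDeriv.lineDerivOp (EuclideanSpace.single (α, k) (1 : ℝ)) (Ψ s) :=
  rfl

lemma pos_comm (α β : Fin A) (k l : Fin 3) : Commute (pos A S α k) (pos A S β l) := by
  refine LinearMap.ext fun Ψ => funext fun s => SchwartzMap.ext fun x => ?_
  simp only [Module.End.mul_apply, pos_apply]; ring

lemma partialD_comm (α β : Fin A) (k l : Fin 3) :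
    Commute (partialD A S α k) (partialD A S β l) := by
  refine LinearMap.ext fun Ψ => funext fun s => SchwartzMap.ext fun x => ?_
  have h : ∀ (v w : Config A), (LineDeriv.lineDerivOp v (LineDeriv.lineDerivOp w (Ψ s)) :
      𝓢(Config A, ℂ)) x = fderiv ℝ (fderiv ℝ (Ψ s)) x v w := by
    intro v w
    rw [SchwartzMap.lineDerivOp_apply_eq_fderiv]
    have : ((LineDeriv.lineDerivOp w (Ψ s) : 𝓢(Config A, ℂ)) : Config A → ℂ) =
        fun y => fderiv ℝ (Ψ s) y w := funext fun y => rfl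
    rw [this, fderiv_clm_apply]
    · simp
    · exact (((Ψ s).smooth 2).fderiv_right (m := 1) (by norm_num)).differentiable (by simp) x
    · fun_prop
  rw [Module.End.mul_apply, Module.End.mul_apply, partialD_eq, partialD_eq, partialD_eq,
    partialD_eq, h, h]
  exact (((Ψ s).smooth 2).contDiffAt.isSymmSndFDerivAt (by simp)).eq _ _

/-- The canonical commutation relation `[∂_{α k}, x_{β l}] = δ`. -/
lemma partialD_mul_pos (α β : Fin A) (k l : Fin 3) :
    partialD A S α k * pos A S β l =
      pos A S β l * partialD A S α k + (if α = β ∧ k = l then 1 else 0) := by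
  refine LinearMap.ext fun Ψ => funext fun s => SchwartzMap.ext fun x => ?_
  have hc : HasFDerivAt (fun x : Config A => ((x (β, l) : ℝ) : ℂ))
      (Complex.ofRealCLM.comp (EuclideanSpace.proj (𝕜 := ℝ) (β, l))) x :=
    (Complex.ofRealCLM.comp (EuclideanSpace.proj (𝕜 := ℝ) (β, l))).hasFDerivAt
  have h2 := hc.mul ((Ψ s).hasFDerivAt x)
  have h3 : ((pos A S β l Ψ s : 𝓢(Config A, ℂ)) : Config A → ℂ) =
      fun y => ((y (β, l) : ℝ) : ℂ) * Ψ s y := funext fun y => pos_apply β l Ψ s y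
  have h4 : ∀ Ψ : State A S, partialD A S α k Ψ s x =
      fderiv ℝ (Ψ s) x (EuclideanSpace.single (α, k) (1 : ℝ)) := fun _ => rfl
  rw [Module.End.mul_apply, h4, h3]
  erw [h2.fderiv]
  change _ = pos A S β l (partialD A S α k Ψ) s x +
    (if α = β ∧ k = l then (1 : Module.End ℂ (State A S)) else 0) Ψ s x
  rw [pos_apply, h4]
  by_cases hab : α = β ∧ k = l
  · obtain ⟨rfl, rfl⟩ := hab
    simp
  · have : (β, l) ≠ (α, k) := fun h => hab ⟨(congrArg Prod.fst h).symm, (congrArg Prod.snd h).symm⟩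
    simp [hab, this]

lemma pos_apply_eq_zero (α : Fin A) (k : Fin 3) {Ψ : State A S} {s : Fin A → S} (h : Ψ s = 0) :
    pos A S α k Ψ s = 0 := by
  refine SchwartzMap.ext fun x => ?_
  rw [pos_apply, h]; simp

lemma partialD_apply_eq_zero (α : Fin A) (k : Fin 3) {Ψ : State A S} {s : Fin A → S}
    (h : Ψ s = 0) : partialD A S α k Ψ s = 0 := by
  rw [partialD_eq, h, LineDeriv.lineDerivOp_zero]

variable (A S) in
/-- The operators `Q = (x, y, i∂_z)`. With this choice, which exchanges the roles of position and
momentum in the direction `z`, all coefficients of the Routhian become real. -/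
def opQ (α : Fin A) : Fin 3 → Module.End ℂ (State A S) :=
  ![pos A S α 0, pos A S α 1, Complex.I • partialD A S α 2]

variable (A S) in
/-- The operators `D = (∂_x, ∂_y, i z)`; they act as the derivatives with respect to the mutually
commuting `Q`. -/
def opD (α : Fin A) : Fin 3 → Module.End ℂ (State A S) :=
  ![partialD A S α 0, partialD A S α 1, Complex.I • pos A S α 2]

lemma partialD_comm_pos {α β : Fin A} {k l : Fin 3} (h : k ≠ l) :
    Commute (partialD A S α k) (pos A S β l) := by
  have := partialD_mul_pos (S := S) α β k l
  rw [if_neg (fun h' => h h'.2), add_zero] at this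
  exact this

lemma opQ_comm (α β : Fin A) (k l : Fin 3) : Commute (opQ A S α k) (opQ A S β l) := by
  fin_cases k <;> fin_cases l <;> simp only [opQ]
  · exact pos_comm ..
  · exact pos_comm ..
  · exact ((partialD_comm_pos (by decide)).smul_left _).symm
  · exact pos_comm ..
  · exact pos_comm ..
  · exact ((partialD_comm_pos (by decide)).smul_left _).symm
  · exact (partialD_comm_pos (by decide)).smul_left _
  · exact (partialD_comm_pos (by decide)).smul_left _
  · exact ((partialD_comm ..).smul_left _).smul_right _

lemma opD_comm (α β : Fin A) (k l : Fin 3) : Commute (opD A S α k) (opD A S β l) := by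
  fin_cases k <;> fin_cases l <;> simp only [opD]
  · exact partialD_comm ..
  · exact partialD_comm ..
  · exact ((partialD_comm_pos (by decide)).smul_right _)
  · exact partialD_comm ..
  · exact partialD_comm ..
  · exact ((partialD_comm_pos (by decide)).smul_right _)
  · exact ((partialD_comm_pos (by decide)).smul_right _).symm
  · exact ((partialD_comm_pos (by decide)).smul_right _).symm
  · exact ((pos_comm ..).smul_left _).smul_right _

/-- The canonical commutation relations persist for `Q` and `D`. -/
lemma opD_mul_opQ (α β : Fin A) (k l : Fin 3) :
    opD A S α k * opQ A S β l =
      opQ A S β l * opD A S α k + (if α = β ∧ k = l then 1 else 0) := by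
  have hI : Complex.I * Complex.I = -1 := Complex.I_mul_I
  have hz : pos A S α 2 * partialD A S β 2 =
      partialD A S β 2 * pos A S α 2 - (if α = β then 1 else 0) := by
    rw [partialD_mul_pos]; simp [eq_comm]
  fin_cases k <;> fin_cases l <;>
    simp only [opD, opQ, Fin.isValue, Fin.mk_zero, Fin.mk_one, Fin.reduceFinMk, Matrix.cons_val]
  · simpa using partialD_mul_pos (S := S) α β 0 0
  · simpa using partialD_mul_pos (S := S) α β 0 1
  · simpa using congrArg (Complex.I • ·) (partialD_comm (S := S) α β 0 2).eq
  · simpa using partialD_mul_pos (S := S) α β 1 0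
  · simpa using partialD_mul_pos (S := S) α β 1 1
  · simpa using congrArg (Complex.I • ·) (partialD_comm (S := S) α β 1 2).eq
  · simpa using congrArg (Complex.I • ·) (pos_comm (S := S) α β 2 0).eq
  · simpa using congrArg (Complex.I • ·) (pos_comm (S := S) α β 2 1).eq
  · simp only [smul_mul_assoc, mul_smul_comm, smul_smul, hI, hz]
    simp only [and_true, smul_sub, neg_smul, one_smul]
    abel

/-- `i∂_z` is symmetric, like the positions. -/
lemma isAdj_opQ [Fintype S] (α : Fin A) (k : Fin 3) : IsAdj (opQ A S α k) (opQ A S α k) := by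
  fin_cases k
  · exact isAdj_pos (S := S) α 0
  · exact isAdj_pos (S := S) α 1
  · have := (isAdj_partialD (S := S) α 2).smul Complex.I
    rwa [Complex.conj_I, neg_smul_neg] at this

/-- `i z` is antisymmetric, like the derivatives. -/
lemma isAdj_opD [Fintype S] (α : Fin A) (k : Fin 3) : IsAdj (opD A S α k) (-opD A S α k) := by
  fin_cases k
  · exact isAdj_partialD (S := S) α 0
  · exact isAdj_partialD (S := S) α 1
  · have := (isAdj_pos (S := S) α 2).smul Complex.I
    rw [Complex.conj_I] at this
    have e : -(Complex.I • pos A S α 2) = (-Complex.I) • pos A S α 2 := (neg_smul _ _).symm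
    rw [← e] at this
    exact this

end Operators

/-! ### The Routhian as a quadratic form in bosons -/

section Bosons

variable {A : ℕ} {S : Type*} {P : Params} {σ : ℝ}

namespace Params

lemma Stable.freq_pos (h : P.Stable) (k : Fin 3) : 0 < P.freq k := by
  fin_cases k
  · exact h.ωx
  · exact h.ωy
  · exact h.ωz

variable (P) in
/-- `√(ħ / (2 m ω_k))`, the amplitude of `x_k` in terms of the oscillator bosons. -/
def posAmp (k : Fin 3) : ℝ := √(P.hbar / (2 * P.m * P.freq k))

variable (P) in
/-- `√(m ω_k / (2 ħ))`, the amplitude of `∂_k` in terms of the oscillator bosons. -/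
def derAmp (k : Fin 3) : ℝ := √(P.m * P.freq k / (2 * P.hbar))

lemma Stable.posAmp_mul_derAmp (h : P.Stable) (k : Fin 3) : P.posAmp k * P.derAmp k = 1 / 2 := by
  have := h.freq_pos k
  have := h.hbar
  have := h.m
  rw [posAmp, derAmp, ← Real.sqrt_mul (by positivity),
    show P.hbar / (2 * P.m * P.freq k) * (P.m * P.freq k / (2 * P.hbar)) = (1 / 2) ^ 2 by
      field_simp, Real.sqrt_sq (by norm_num)]

lemma Stable.ann_eq (h : P.Stable) (α : Fin A) (k : Fin 3) : P.ann A S α k =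
    (P.derAmp k : ℂ) • pos A S α k + (P.posAmp k : ℂ) • partialD A S α k := by
  have := h.freq_pos k
  have := h.hbar
  have := h.m
  have h1 : (√(2 * P.hbar * P.m * P.freq k))⁻¹ * (P.m * P.freq k) = P.derAmp k := by
    rw [derAmp, eq_comm, Real.sqrt_eq_iff_eq_sq (by positivity) (by positivity), mul_pow, inv_pow,
      Real.sq_sqrt (by positivity)]
    field_simp
  have h2 : (√(2 * P.hbar * P.m * P.freq k))⁻¹ * P.hbar = P.posAmp k := by
    rw [posAmp, eq_comm, Real.sqrt_eq_iff_eq_sq (by positivity) (by positivity), mul_pow, inv_pow,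
      Real.sq_sqrt (by positivity)]
    field_simp
  rw [ann, smul_add, smul_smul, smul_smul, ← Complex.ofReal_mul, ← Complex.ofReal_mul, h1, h2]

lemma cre_eq_two_pos_sub (α : Fin A) (k : Fin 3) : P.cre A S α k =
    ((2 * ((√(2 * P.hbar * P.m * P.freq k))⁻¹ * (P.m * P.freq k)) : ℝ) : ℂ) • pos A S α k
      - P.ann A S α k := by
  rw [cre, ann]
  push_cast
  module

lemma Stable.cre_eq (h : P.Stable) (α : Fin A) (k : Fin 3) : P.cre A S α k =
    (P.derAmp k : ℂ) • pos A S α k - (P.posAmp k : ℂ) • partialD A S α k := by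
  have := h.freq_pos k
  have := h.hbar
  have := h.m
  have h1 : (√(2 * P.hbar * P.m * P.freq k))⁻¹ * (P.m * P.freq k) = P.derAmp k := by
    rw [derAmp, eq_comm, Real.sqrt_eq_iff_eq_sq (by positivity) (by positivity), mul_pow, inv_pow,
      Real.sq_sqrt (by positivity)]
    field_simp
  rw [cre_eq_two_pos_sub, h1, h.ann_eq]
  push_cast
  module

lemma Stable.derAmp_sq (h : P.Stable) (k : Fin 3) :
    P.derAmp k ^ 2 = P.m * P.freq k / (2 * P.hbar) := by
  have := h.freq_pos k
  have := h.hbar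
  have := h.m
  exact Real.sq_sqrt (by positivity)

lemma Stable.posAmp_sq (h : P.Stable) (k : Fin 3) :
    P.posAmp k ^ 2 = P.hbar / (2 * P.m * P.freq k) := by
  have := h.freq_pos k
  have := h.hbar
  have := h.m
  exact Real.sq_sqrt (by positivity)

/-- The generator `-iħ ∑_α (r y ∂_z - s z ∂_y)` in terms of the bosons. -/
lemma Stable.bosonCirc_eq (h : P.Stable) (r s : ℝ) : P.bosonCirc A S r s =
    (-Complex.I * P.hbar) • ∑ α, ((r : ℂ) • (pos A S α 1 * partialD A S α 2)
      - (s : ℂ) • (pos A S α 2 * partialD A S α 1)) := by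
  have hy := h.ωy
  have hz := h.ωz
  have hh := h.hbar
  have hm := h.m
  have hr : √(P.ωy * P.ωz) ≠ 0 := by positivity
  have e1 : P.derAmp 1 * P.posAmp 2 = √(P.ωy * P.ωz) / (2 * P.ωz) := by
    rw [derAmp, posAmp, ← Real.sqrt_mul (by simp [freq]; positivity),
      Real.sqrt_eq_iff_eq_sq (by simp [freq]; positivity) (by positivity), div_pow,
      Real.sq_sqrt (by positivity)]
    simp [freq]; field_simp
  have e2 : P.derAmp 2 * P.posAmp 1 = √(P.ωy * P.ωz) / (2 * P.ωy) := by
    rw [derAmp, posAmp, ← Real.sqrt_mul (by simp [freq]; positivity),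
      Real.sqrt_eq_iff_eq_sq (by simp [freq]; positivity) (by positivity), div_pow,
      Real.sq_sqrt (by positivity)]
    simp [freq]; field_simp
  rw [bosonCirc, Finset.smul_sum, Finset.smul_sum]
  refine Finset.sum_congr rfl fun α _ => ?_
  have hpp := (pos_comm (S := S) α α 2 1).eq
  have hdd := (partialD_comm (S := S) α α 2 1).eq
  have h12 := (partialD_comm_pos (S := S) (α := α) (β := α) (k := 1) (l := 2) (by decide)).eq
  have h21 := (partialD_comm_pos (S := S) (α := α) (β := α) (k := 2) (l := 1) (by decide)).eq
  have a1 : P.cre A S α 1 * P.ann A S α 2 - P.cre A S α 2 * P.ann A S α 1 =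
      ((2 * (P.derAmp 1 * P.posAmp 2) : ℝ) : ℂ) • (pos A S α 1 * partialD A S α 2)
      - ((2 * (P.derAmp 2 * P.posAmp 1) : ℝ) : ℂ) • (pos A S α 2 * partialD A S α 1) := by
    simp only [h.cre_eq, h.ann_eq, mul_add, sub_mul, smul_mul_assoc, mul_smul_comm,
      hpp, hdd, h12, h21]
    push_cast
    module
  have a2 : P.cre A S α 1 * P.cre A S α 2 - P.ann A S α 2 * P.ann A S α 1 =
      -(((2 * (P.derAmp 1 * P.posAmp 2) : ℝ) : ℂ) • (pos A S α 1 * partialD A S α 2))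
      - ((2 * (P.derAmp 2 * P.posAmp 1) : ℝ) : ℂ) • (pos A S α 2 * partialD A S α 1) := by
    simp only [h.cre_eq, h.ann_eq, mul_add, add_mul, sub_mul, mul_sub, smul_mul_assoc,
      mul_smul_comm, hpp, hdd, h12, h21]
    push_cast
    module
  rw [a1, a2, e1, e2]
  set w := √(P.ωy * P.ωz)
  have hrc : (w : ℂ) ≠ 0 := by exact_mod_cast hr
  have hyc : (P.ωy : ℂ) ≠ 0 := by exact_mod_cast hy.ne'
  have hzc : (P.ωz : ℂ) ≠ 0 := by exact_mod_cast hz.ne'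
  push_cast
  match_scalars <;> field_simp <;> ring

lemma Stable.angMom_eq (h : P.Stable) : P.angMom A S = P.bosonCirc A S 1 1 := by
  simp [h.bosonCirc_eq, angMom]

lemma Stable.circ_eq (h : P.Stable) :
    P.circ A S = P.bosonCirc A S (P.c / P.b) (P.b / P.c) := by
  rw [h.bosonCirc_eq, circ]

/-- The one-dimensional oscillator. -/
lemma Stable.oscillator_eq (h : P.Stable) (α : Fin A) (k : Fin 3) :
    ((P.hbar * P.freq k : ℝ) : ℂ) • (P.cre A S α k * P.ann A S α k + (1 / 2 : ℂ) • 1) =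
      ((-(P.hbar ^ 2 / (2 * P.m)) : ℝ) : ℂ) • (partialD A S α k * partialD A S α k)
        + ((1 / 2 * P.m * P.freq k ^ 2 : ℝ) : ℂ) • (pos A S α k * pos A S α k) := by
  have hf := h.freq_pos k
  have hh := h.hbar
  have hm := h.m
  have hc := partialD_mul_pos (S := S) α α k k
  rw [if_pos ⟨rfl, rfl⟩] at hc
  have e : P.cre A S α k * P.ann A S α k =
      ((P.derAmp k ^ 2 : ℝ) : ℂ) • (pos A S α k * pos A S α k)
      - ((P.posAmp k ^ 2 : ℝ) : ℂ) • (partialD A S α k * partialD A S α k)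
      - ((P.posAmp k * P.derAmp k : ℝ) : ℂ) • 1 := by
    simp only [h.cre_eq, h.ann_eq, mul_add, sub_mul, smul_mul_assoc, mul_smul_comm, hc]
    push_cast
    module
  rw [e, h.posAmp_mul_derAmp, h.derAmp_sq, h.posAmp_sq]
  have hhc : (P.hbar : ℂ) ≠ 0 := by exact_mod_cast hh.ne'
  have hmc : (P.m : ℂ) ≠ 0 := by exact_mod_cast hm.ne'
  have hfc : (P.freq k : ℂ) ≠ 0 := by exact_mod_cast hf.ne'
  push_cast
  match_scalars <;> field_simp
  norm_num

lemma Stable.routhian_eq_bosons (h : P.Stable) : P.routhian A S =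
    ∑ α, ∑ k, ((P.hbar * P.freq k : ℝ) : ℂ) •
        (P.cre A S α k * P.ann A S α k + (1 / 2 : ℂ) • 1)
      - ((P.ω : ℂ) • P.bosonCirc A S 1 1
        - (P.lam : ℂ) • P.bosonCirc A S (P.c / P.b) (P.b / P.c)) := by
  rw [← h.angMom_eq, ← h.circ_eq, routhian]
  congr 1
  simp only [h.oscillator_eq, sumSq, Finset.smul_sum, Finset.sum_add_distrib]
  congr 1
  exact Finset.sum_comm

/-! ### The new modes -/

/-- Since `i y ∂_z` is a product of two `Q` and `i z ∂_y` a product of two `D`, the angular momentum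
and the circulation have real coefficients in `Q` and `D`. -/
lemma generator_eq (r s : ℂ) :
    (-Complex.I * P.hbar) • ∑ α, (r • (pos A S α 1 * partialD A S α 2)
      - s • (pos A S α 2 * partialD A S α 1)) =
    (-(P.hbar : ℂ)) • ∑ α, (r • (opQ A S α 1 * opQ A S α 2) - s • (opD A S α 2 * opD A S α 1)) := by
  rw [Finset.smul_sum, Finset.smul_sum]
  refine Finset.sum_congr rfl fun α _ => ?_
  simp only [opQ, opD, Matrix.cons_val, smul_mul_assoc, mul_smul_comm]
  module

lemma angMom_eq_opQ : P.angMom A S =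
    (-(P.hbar : ℂ)) • ∑ α, (opQ A S α 1 * opQ A S α 2 - opD A S α 2 * opD A S α 1) := by
  simpa [angMom] using generator_eq (A := A) (S := S) (P := P) 1 1

lemma circ_eq_opQ : P.circ A S = (-(P.hbar : ℂ)) • ∑ α,
    (((P.c / P.b : ℝ) : ℂ) • (opQ A S α 1 * opQ A S α 2)
      - ((P.b / P.c : ℝ) : ℂ) • (opD A S α 2 * opD A S α 1)) :=
  generator_eq _ _

/-- The Routhian is a difference of two real quadratic forms, one in the commuting operators `Q`,
the other in the commuting operators `D`. -/
lemma Stable.routhian_eq_forms (h : P.Stable) : P.routhian A S =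
    (P.hbar : ℂ) • ∑ α, ∑ k, ∑ l, ((P.formQ k l : ℂ) • (opQ A S α k * opQ A S α l)
      - (P.formD k l : ℂ) • (opD A S α k * opD A S α l)) := by
  have hhc : (P.hbar : ℂ) ≠ 0 := by exact_mod_cast h.hbar.ne'
  have hmc : (P.m : ℂ) ≠ 0 := by exact_mod_cast h.m.ne'
  rw [routhian, angMom_eq_opQ, circ_eq_opQ]
  simp only [sumSq, Finset.smul_sum, Fin.sum_univ_three]
  simp only [← Finset.sum_add_distrib, ← Finset.sum_sub_distrib]
  refine Finset.sum_congr rfl fun α _ => ?_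
  have hI : Complex.I * Complex.I = -1 := Complex.I_mul_I
  have q12 := (opQ_comm (S := S) α α 2 1).eq
  have d12 := (opD_comm (S := S) α α 2 1).eq
  have q22 : opQ A S α 2 * opQ A S α 2 = -(partialD A S α 2 * partialD A S α 2) := by
    simp [opQ, smul_smul]
  have d22 : opD A S α 2 * opD A S α 2 = -(pos A S α 2 * pos A S α 2) := by
    simp [opD, smul_smul]
  rw [q22, d22, q12, d12]
  have q0 : opQ A S α 0 = pos A S α 0 := rfl
  have q1 : opQ A S α 1 = pos A S α 1 := rfl
  have d0 : opD A S α 0 = partialD A S α 0 := rfl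
  have d1 : opD A S α 1 = partialD A S α 1 := rfl
  simp only [formQ, formD, freq, q0, d0, Matrix.of_apply, Matrix.cons_val, crankY, crankZ]
  generalize opQ A S α 1 * opQ A S α 2 = x12
  generalize opD A S α 1 * opD A S α 2 = y12
  simp only [q1, d1]
  push_cast
  match_scalars <;> field_simp <;> ring

end Params

end Bosons

namespace Params

section Modes

variable {A : ℕ} {S : Type*} {P : Params} {σ : ℝ}

namespace Modes

variable (M : P.Modes σ)

variable (A S) in
/-- The combination `∑_k F_{jk} Q_k`. -/
def formF (α : Fin A) (j : Fin 3) : Module.End ℂ (State A S) :=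
  ∑ k, (M.F j k : ℂ) • opQ A S α k

variable (A S) in
/-- The combination `∑_k G_{jk} D_k`. -/
def formG (α : Fin A) (j : Fin 3) : Module.End ℂ (State A S) :=
  ∑ k, (M.G j k : ℂ) • opD A S α k

variable (A S) in
/-- The annihilation operators of the new modes. -/
def ann (α : Fin A) (j : Fin 3) : Module.End ℂ (State A S) := M.formF A S α j + M.formG A S α j

variable (A S) in
/-- The creation operators of the new modes. -/
def cre (α : Fin A) (j : Fin 3) : Module.End ℂ (State A S) := M.formF A S α j - M.formG A S α j

lemma sum_F_mul_G (j k : Fin 3) : ∑ l, M.F j l * M.G k l = if j = k then 1 / 2 else 0 := by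
  have := congrFun (congrFun M.mul_transpose j) k
  simpa [Matrix.mul_apply, Matrix.one_apply] using this

lemma sum_G_mul_F (k l : Fin 3) : ∑ j, M.G j k * M.F j l = if k = l then 1 / 2 else 0 := by
  have := congrFun (congrFun (mul_eq_half_comm M.mul_transpose) k) l
  simpa [Matrix.mul_apply, Matrix.one_apply] using this

lemma formF_comm (α β : Fin A) (j k : Fin 3) : Commute (M.formF A S α j) (M.formF A S β k) :=
  Commute.sum_left _ _ _ fun _ _ => Commute.sum_right _ _ _ fun _ _ =>
    ((opQ_comm ..).smul_left _).smul_right _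

lemma formG_comm (α β : Fin A) (j k : Fin 3) : Commute (M.formG A S α j) (M.formG A S β k) :=
  Commute.sum_left _ _ _ fun _ _ => Commute.sum_right _ _ _ fun _ _ =>
    ((opD_comm ..).smul_left _).smul_right _

lemma formG_mul_formF (α β : Fin A) (j k : Fin 3) :
    M.formG A S α j * M.formF A S β k = M.formF A S β k * M.formG A S α j +
      (if α = β ∧ j = k then (1 / 2 : ℂ) else 0) • 1 := by
  have h : ∀ l l', ((M.G j l : ℂ) • opD A S α l) * ((M.F k l' : ℂ) • opQ A S β l') =
      ((M.F k l' : ℂ) • opQ A S β l') * ((M.G j l : ℂ) • opD A S α l)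
      + (if α = β ∧ l = l' then ((M.F k l * M.G j l : ℝ) : ℂ) else 0) • 1 := by
    intro l l'
    rw [smul_mul_smul_comm, smul_mul_smul_comm, opD_mul_opQ, smul_add, mul_comm (M.F k l' : ℂ)]
    congr 1
    split_ifs with hl
    · rw [hl.2]; push_cast; rw [mul_comm]
    · simp
  rw [formF, formG, Finset.sum_mul_sum, Finset.sum_mul_sum, Finset.sum_comm (s := Finset.univ)
    (f := fun i j_1 => (M.F k i : ℂ) • opQ A S β i * (M.G j j_1 : ℂ) • opD A S α j_1)]
  simp only [h, Finset.sum_add_distrib, ← Finset.sum_smul]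
  congr 2
  by_cases hab : α = β
  · simp only [hab, true_and, Finset.sum_ite_eq, Finset.mem_univ, if_true]
    rw [← Complex.ofReal_sum, M.sum_F_mul_G, apply_ite Complex.ofReal]
    simp [eq_comm]
  · simp [hab]

lemma ann_mul_cre (α β : Fin A) (j k : Fin 3) :
    M.ann A S α j * M.cre A S β k - M.cre A S β k * M.ann A S α j =
      if α = β ∧ j = k then 1 else 0 := by
  have h1 := M.formG_mul_formF (S := S) α β j k
  have h2 := M.formG_mul_formF (S := S) β α k j
  have hc : (β = α ∧ k = j) ↔ (α = β ∧ j = k) := by rw [eq_comm, @eq_comm _ k]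
  rw [if_congr hc rfl rfl] at h2
  rw [ann, cre, add_mul, mul_sub, mul_sub, sub_mul, mul_add, mul_add, h1, h2,
    (M.formF_comm (S := S) α β j k).eq, (M.formG_comm (S := S) α β j k).eq]
  split_ifs <;> module

lemma ann_comm (α β : Fin A) (j k : Fin 3) : Commute (M.ann A S α j) (M.ann A S β k) := by
  have h1 := M.formG_mul_formF (S := S) α β j k
  have h2 := M.formG_mul_formF (S := S) β α k j
  have hc : (β = α ∧ k = j) ↔ (α = β ∧ j = k) := by rw [eq_comm, @eq_comm _ k]
  rw [if_congr hc rfl rfl] at h2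
  rw [Commute, SemiconjBy, ann, ann, add_mul, mul_add, mul_add, add_mul, mul_add, mul_add, h1, h2,
    (M.formF_comm (S := S) α β j k).eq, (M.formG_comm (S := S) α β j k).eq]
  split_ifs <;> module

lemma cre_comm (α β : Fin A) (j k : Fin 3) : Commute (M.cre A S α j) (M.cre A S β k) := by
  have h1 := M.formG_mul_formF (S := S) α β j k
  have h2 := M.formG_mul_formF (S := S) β α k j
  have hc : (β = α ∧ k = j) ↔ (α = β ∧ j = k) := by rw [eq_comm, @eq_comm _ k]
  rw [if_congr hc rfl rfl] at h2
  rw [Commute, SemiconjBy, cre, cre, sub_mul, mul_sub, mul_sub, sub_mul, mul_sub, mul_sub, h1, h2,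
    (M.formF_comm (S := S) α β j k).eq, (M.formG_comm (S := S) α β j k).eq]
  split_ifs <;> module

/-- The transformation of the `Q` is inverted by the transposed matrix of the `D`. -/
lemma opQ_eq (α : Fin A) (k : Fin 3) : opQ A S α k =
    ∑ j, (M.G j k : ℂ) • (M.ann A S α j + M.cre A S α j) := by
  have h : ∀ j, M.ann A S α j + M.cre A S α j = (2 : ℂ) • ∑ l, (M.F j l : ℂ) • opQ A S α l := by
    intro j
    rw [ann, cre, formF, add_add_sub_cancel, two_smul]
  simp only [h, Finset.smul_sum, smul_smul]
  rw [Finset.sum_comm]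
  simp only [← Finset.sum_smul]
  have h2 : ∀ l, ∑ j, (M.G j k : ℂ) * (2 * (M.F j l : ℂ)) = if k = l then 1 else 0 := by
    intro l
    have := congrArg (fun r : ℝ => (2 * r : ℂ)) (M.sum_G_mul_F k l)
    simp only [Complex.ofReal_sum, Finset.mul_sum] at this
    rw [show ∑ j, (M.G j k : ℂ) * (2 * (M.F j l : ℂ)) = ∑ j, 2 * ((M.G j k * M.F j l : ℝ) : ℂ) from
      Finset.sum_congr rfl fun j _ => by push_cast; ring, this]
    split_ifs <;> simp
  simp [h2]

lemma opD_eq (α : Fin A) (k : Fin 3) : opD A S α k =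
    ∑ j, (M.F j k : ℂ) • (M.ann A S α j - M.cre A S α j) := by
  have h : ∀ j, M.ann A S α j - M.cre A S α j = (2 : ℂ) • ∑ l, (M.G j l : ℂ) • opD A S α l := by
    intro j
    rw [ann, cre, formG, add_sub_sub_cancel, two_smul]
  simp only [h, Finset.smul_sum, smul_smul]
  rw [Finset.sum_comm]
  simp only [← Finset.sum_smul]
  have h2 : ∀ l, ∑ j, (M.F j k : ℂ) * (2 * (M.G j l : ℂ)) = if k = l then 1 else 0 := by
    intro l
    have := congrArg (fun r : ℝ => (2 * r : ℂ)) (M.sum_G_mul_F l k)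
    simp only [Complex.ofReal_sum, Finset.mul_sum] at this
    rw [show ∑ j, (M.F j k : ℂ) * (2 * (M.G j l : ℂ)) = ∑ j, 2 * ((M.G j l * M.F j k : ℝ) : ℂ) from
      Finset.sum_congr rfl fun j _ => by push_cast; ring, this]
    rcases eq_or_ne l k with rfl | hlk
    · simp
    · simp [hlk, hlk.symm]
  simp [h2]

lemma isAdj_cre [Fintype S] (α : Fin A) (j : Fin 3) : IsAdj (M.cre A S α j) (M.ann A S α j) := by
  have h1 : IsAdj (M.formF A S α j) (M.formF A S α j) := IsAdj.sum _ fun k => by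
    simpa using (isAdj_opQ (S := S) α k).smul (M.F j k : ℂ)
  have h2 : IsAdj (M.formG A S α j) (-M.formG A S α j) := by
    rw [formG, ← Finset.sum_neg_distrib]
    refine IsAdj.sum _ fun k => ?_
    have := (isAdj_opD (S := S) α k).smul (M.G j k : ℂ)
    rwa [Complex.conj_ofReal, smul_neg] at this
  have := h1.sub h2
  rwa [sub_neg_eq_add] at this

lemma number_eq (α : Fin A) (j : Fin 3) :
    M.cre A S α j * M.ann A S α j + (1 / 2 : ℂ) • 1 =
      M.formF A S α j * M.formF A S α j - M.formG A S α j * M.formG A S α j := by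
  have h1 := M.formG_mul_formF (S := S) α α j j
  rw [if_pos ⟨rfl, rfl⟩] at h1
  rw [cre, ann, sub_mul, mul_add, mul_add, h1]
  module

/-- The new modes diagonalize the Routhian. -/
lemma routhian_eq (h : P.Stable) : P.routhian A S =
    ∑ j, ((P.hbar * P.newFreq σ j : ℝ) : ℂ) •
      ∑ α, (M.cre A S α j * M.ann A S α j + (1 / 2 : ℂ) • 1) := by
  rw [h.routhian_eq_forms]
  simp only [M.number_eq, Finset.smul_sum]
  rw [Finset.sum_comm (s := (Finset.univ : Finset (Fin 3)))]
  refine Finset.sum_congr rfl fun α _ => ?_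
  have key : ∀ (C B : Fin 3 → Fin 3 → ℝ) (T : Fin 3 → Module.End ℂ (State A S)),
      (∀ k l, ∑ j, P.newFreq σ j * (C j k * C j l) = B k l) →
      ∑ k, ∑ l, (P.hbar : ℂ) • (B k l : ℂ) • (T k * T l) =
        ∑ j, ((P.hbar * P.newFreq σ j : ℝ) : ℂ) •
          ((∑ k, (C j k : ℂ) • T k) * ∑ k, (C j k : ℂ) • T k) := by
    intro C B T hB
    simp only [Finset.sum_mul_sum, smul_mul_smul_comm, Finset.smul_sum, smul_smul]
    rw [Finset.sum_comm' (t' := Finset.univ) (s' := fun _ => Finset.univ) (by simp)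
      (s := (Finset.univ : Finset (Fin 3))) (f := fun j k => ∑ l,
        (((P.hbar * P.newFreq σ j : ℝ) : ℂ) * ((C j k : ℂ) * (C j l : ℂ))) • (T k * T l))]
    refine Finset.sum_congr rfl fun k _ => ?_
    rw [Finset.sum_comm]
    refine Finset.sum_congr rfl fun l _ => ?_
    rw [← Finset.sum_smul, ← hB]
    push_cast
    rw [Finset.mul_sum]
    simp only [mul_assoc]
  simp only [smul_sub, Finset.sum_sub_distrib]
  exact congrArg₂ (· - ·) (key M.F P.formQ _ M.formQ_eq) (key M.G P.formD _ M.formD_eq)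

/-- The coefficients of the positions in the annihilation operators. -/
def posCoeff : Matrix (Fin 3) (Fin 3) ℂ := fun j => ![M.F j 0, M.F j 1, Complex.I * M.G j 2]

/-- The coefficients of the derivatives in the annihilation operators. -/
def derCoeff : Matrix (Fin 3) (Fin 3) ℂ := fun j => ![M.G j 0, M.G j 1, Complex.I * M.F j 2]

/-- The coefficients `U` of the Bogoliubov transformation. -/
def U : Matrix (Fin 3) (Fin 3) ℂ := fun j k =>
  M.posCoeff j k * P.posAmp k + M.derCoeff j k * P.derAmp k

/-- The coefficients `V` of the Bogoliubov transformation. -/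
def V : Matrix (Fin 3) (Fin 3) ℂ := fun j k =>
  M.posCoeff j k * P.posAmp k - M.derCoeff j k * P.derAmp k

lemma ann_eq (α : Fin A) (j : Fin 3) : M.ann A S α j =
    ∑ k, (M.posCoeff j k • pos A S α k + M.derCoeff j k • partialD A S α k) := by
  simp only [ann, formF, formG, posCoeff, derCoeff, opQ, opD, Fin.sum_univ_three, Matrix.cons_val]
  module

lemma cre_eq (α : Fin A) (j : Fin 3) : M.cre A S α j =
    ∑ k, (conj (M.posCoeff j k) • pos A S α k - conj (M.derCoeff j k) • partialD A S α k) := by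
  simp only [cre, formF, formG, posCoeff, derCoeff, opQ, opD, Fin.sum_univ_three, Matrix.cons_val,
    map_mul, Complex.conj_I, Complex.conj_ofReal]
  module

lemma newAnn_eq (h : P.Stable) (α : Fin A) (j : Fin 3) :
    P.newAnn A S M.U M.V α j = M.ann A S α j := by
  rw [newAnn, ann_eq]
  refine Finset.sum_congr rfl fun k _ => ?_
  have hk : (P.posAmp k : ℂ) * P.derAmp k = 1 / 2 := by
    rw [← Complex.ofReal_mul, h.posAmp_mul_derAmp]; norm_num
  rw [h.ann_eq, h.cre_eq, U, V]
  match_scalars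
  · linear_combination 2 * M.posCoeff j k * hk
  · linear_combination 2 * M.derCoeff j k * hk

lemma newCre_eq (h : P.Stable) (α : Fin A) (j : Fin 3) :
    P.newCre A S M.U M.V α j = M.cre A S α j := by
  rw [newCre, cre_eq]
  refine Finset.sum_congr rfl fun k _ => ?_
  have hk : (P.posAmp k : ℂ) * P.derAmp k = 1 / 2 := by
    rw [← Complex.ofReal_mul, h.posAmp_mul_derAmp]; norm_num
  rw [h.ann_eq, h.cre_eq, U, V, map_add, map_sub, map_mul, map_mul, Complex.conj_ofReal,
    Complex.conj_ofReal]
  match_scalars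
  · linear_combination 2 * conj (M.posCoeff j k) * hk
  · linear_combination -2 * conj (M.derCoeff j k) * hk

lemma isCanonical (h : P.Stable) : P.IsCanonical A S M.U M.V := by
  intro α β j k
  simp only [M.newAnn_eq h, M.newCre_eq h]
  exact ⟨M.ann_mul_cre α β j k, (M.ann_comm α β j k).eq, (M.cre_comm α β j k).eq⟩

lemma U_zero (h : P.Stable) : M.U 0 = Pi.single 0 1 := by
  have hk := h.posAmp_mul_derAmp 0
  have hF : M.F 0 0 = P.derAmp 0 := by simp [M.F_zero, derAmp, freq]
  have hG : M.G 0 0 = P.posAmp 0 := by simp [M.G_zero, posAmp, freq]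
  ext k
  fin_cases k
  · have := congrArg (fun r : ℝ => (2 * r : ℂ)) hk
    simp [U, posCoeff, derCoeff, hF, hG] at this ⊢
    linear_combination this
  · simp [U, posCoeff, derCoeff, M.F_zero, M.G_zero]
  · simp [U, posCoeff, derCoeff, M.F_zero, M.G_zero]

lemma V_zero : M.V 0 = 0 := by
  have hF : M.F 0 0 = P.derAmp 0 := by simp [M.F_zero, derAmp, freq]
  have hG : M.G 0 0 = P.posAmp 0 := by simp [M.G_zero, posAmp, freq]
  ext k
  fin_cases k
  · simp [V, posCoeff, derCoeff, hF, hG, mul_comm]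
  · simp [V, posCoeff, derCoeff, M.F_zero, M.G_zero]
  · simp [V, posCoeff, derCoeff, M.F_zero, M.G_zero]

lemma number_eq_cre_mul_ann (h : P.Stable) (α : Fin A) (j : Fin 3) :
    P.number A S M.U M.V α j = M.cre A S α j * M.ann A S α j := by
  rw [number, M.newAnn_eq h, M.newCre_eq h]

lemma routhian_eq_quanta (h : P.Stable) : P.routhian A S =
    ((P.hbar * P.ωx : ℝ) : ℂ) • P.quanta A S M.U M.V 0
      + ((P.hbar * P.Ωp σ : ℝ) : ℂ) • P.quanta A S M.U M.V 1
      + ((P.hbar * P.Ωm σ : ℝ) : ℂ) • P.quanta A S M.U M.V 2 := by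
  rw [M.routhian_eq h, Fin.sum_univ_three]
  simp only [quanta, M.number_eq_cre_mul_ann h]
  rfl

end Modes

end Modes

end Params

/-! ### Boson algebra: excitations of a vacuum -/

section Fock

variable {ι V H : Type*} [AddCommGroup V] [Module ℂ V] [NormedAddCommGroup H]
  [InnerProductSpace ℂ H]

/-- Boson commutation relations for annihilation operators `a` and creation operators `c`, that
are adjoint to each other with respect to the inner product that is induced by a linear map `J`. -/
structure IsBosonFamily [DecidableEq ι] (J : V →ₗ[ℂ] H) (a c : ι → Module.End ℂ V) : Prop where
  ann_mul_cre : ∀ i j, a i * c j = c j * a i + (if i = j then 1 else 0)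
  cre_comm : ∀ i j, Commute (c i) (c j)
  adj : ∀ i u v, inner ℂ (J (c i u)) (J v) = inner ℂ (J u) (J (a i v))

lemma leftCommutative_of_commute {c : ι → Module.End ℂ V} (hc : ∀ i j, Commute (c i) (c j)) :
    LeftCommutative (fun i (w : V) => c i w) :=
  ⟨fun i j w => by rw [← Module.End.mul_apply, (hc i j).eq, Module.End.mul_apply]⟩

/-- The state with the quanta listed in `m`: the product of the creation operators `c i`, `i ∈ m`,
applied to `v`. -/
def excite (c : ι → Module.End ℂ V) (hc : ∀ i j, Commute (c i) (c j)) (v : V) (m : Multiset ι) :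
    V :=
  haveI := leftCommutative_of_commute hc
  m.foldr (fun i w => c i w) v

section

variable {c : ι → Module.End ℂ V} {hc : ∀ i j, Commute (c i) (c j)} {v : V}

@[simp] lemma excite_zero : excite c hc v 0 = v := rfl

@[simp] lemma excite_cons (i : ι) (m : Multiset ι) :
    excite c hc v (i ::ₘ m) = c i (excite c hc v m) := by
  have := leftCommutative_of_commute hc
  exact Multiset.foldr_cons (fun i (w : V) => c i w) v i m

/-- A linear map that intertwines the creation operators relabels the quanta. -/
lemma map_excite {T : Module.End ℂ V} {π : ι → ι} (hT : ∀ i w, T (c i w) = c (π i) (T w))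
    (m : Multiset ι) : T (excite c hc v m) = excite c hc (T v) (m.map π) := by
  induction m using Multiset.induction_on with
  | empty => simp
  | cons i m ih => rw [excite_cons, hT, ih, Multiset.map_cons, excite_cons]

end

namespace IsBosonFamily

variable [DecidableEq ι] {J : V →ₗ[ℂ] H} {a c : ι → Module.End ℂ V} (h : IsBosonFamily J a c)
  {v : V}
include h

lemma number_excite (hv : ∀ i, a i v = 0) (i : ι) (m : Multiset ι) :
    c i (a i (excite c h.cre_comm v m)) = (m.count i : ℂ) • excite c h.cre_comm v m := by
  induction m using Multiset.induction_on with
  | empty => simp [hv]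
  | cons j m ih =>
    set w := excite c h.cre_comm v m with hw
    have e1 : a i (c j w) = c j (a i w) + (if i = j then (1 : Module.End ℂ V) else 0) w := by
      have := LinearMap.congr_fun (h.ann_mul_cre i j) w
      simpa using this
    have e2 : c i (c j (a i w)) = c j (c i (a i w)) := by
      have := LinearMap.congr_fun (h.cre_comm i j).eq (a i w)
      simpa using this
    rw [excite_cons, e1, map_add, e2, ih, map_smul, Multiset.count_cons]
    split_ifs with hij
    · subst hij
      simp [add_smul, hw]
    · simp [hw]

/-- The span of the excitations is invariant under the creation operators. -/
lemma cre_mem_span (i : ι) {x : V}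
    (hx : x ∈ Submodule.span ℂ (Set.range (excite c h.cre_comm v))) :
    c i x ∈ Submodule.span ℂ (Set.range (excite c h.cre_comm v)) := by
  refine Submodule.span_induction ?_ ?_ ?_ ?_ hx
  · rintro _ ⟨m, rfl⟩
    exact Submodule.subset_span ⟨i ::ₘ m, excite_cons i m⟩
  · simp
  · intro x y _ _ hx hy
    rw [map_add]; exact add_mem hx hy
  · intro r x _ hx
    rw [map_smul]; exact Submodule.smul_mem _ _ hx

lemma ann_excite_mem (hv : ∀ i, a i v = 0) (i : ι) (m : Multiset ι) :
    a i (excite c h.cre_comm v m) ∈ Submodule.span ℂ (Set.range (excite c h.cre_comm v)) := by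
  induction m using Multiset.induction_on with
  | empty => simp [hv]
  | cons j m ih =>
    set w := excite c h.cre_comm v m with hw
    have e1 : a i (c j w) = c j (a i w) + (if i = j then (1 : Module.End ℂ V) else 0) w := by
      have := LinearMap.congr_fun (h.ann_mul_cre i j) w
      simpa using this
    rw [excite_cons, e1]
    refine add_mem ?_ ?_
    · exact h.cre_mem_span j ih
    · split_ifs
      · exact Submodule.subset_span ⟨m, rfl⟩
      · simp

/-- The span of the excitations of a vacuum is invariant under the annihilation operators. -/
lemma ann_mem_span (hv : ∀ i, a i v = 0) (i : ι) {x : V}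
    (hx : x ∈ Submodule.span ℂ (Set.range (excite c h.cre_comm v))) :
    a i x ∈ Submodule.span ℂ (Set.range (excite c h.cre_comm v)) := by
  refine Submodule.span_induction ?_ ?_ ?_ ?_ hx
  · rintro _ ⟨m, rfl⟩
    exact h.ann_excite_mem hv i m
  · simp
  · intro x y _ _ hx hy
    rw [map_add]; exact add_mem hx hy
  · intro r x _ hx
    rw [map_smul]; exact Submodule.smul_mem _ _ hx

lemma adj' (i : ι) (u w : V) : inner ℂ (J (a i u)) (J w) = inner ℂ (J u) (J (c i w)) := by
  rw [← inner_conj_symm, ← h.adj, inner_conj_symm]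

lemma excite_ne_zero (hv : ∀ i, a i v = 0) (hv0 : J v ≠ 0) (m : Multiset ι) :
    J (excite c h.cre_comm v m) ≠ 0 := by
  induction m using Multiset.induction_on with
  | empty => simpa using hv0
  | cons i m ih =>
    intro h0
    set w := excite c h.cre_comm v m with hw
    have e1 : a i (c i w) = c i (a i w) + w := by
      have := LinearMap.congr_fun (h.ann_mul_cre i i) w
      simpa using this
    have e2 : inner ℂ (J (c i w)) (J (c i w)) = ((m.count i : ℂ) + 1) * inner ℂ (J w) (J w) := by
      rw [h.adj, e1, hw, h.number_excite hv, ← hw, map_add, map_smul, inner_add_right,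
        inner_smul_right]
      ring
    rw [← excite_cons (c := c) (hc := h.cre_comm), h0, inner_zero_left, eq_comm, mul_eq_zero] at e2
    rcases e2 with e2 | e2
    · exact Nat.cast_add_one_ne_zero _ e2
    · exact ih (inner_self_eq_zero.1 e2)

/-- Eigenvectors of the number operators for different eigenvalues are orthogonal. -/
lemma inner_eq_zero_of_number {i : ι} {p q : ℝ} (hpq : p ≠ q) {u w : V}
    (hu : c i (a i u) = (p : ℂ) • u) (hw : c i (a i w) = (q : ℂ) • w) :
    inner ℂ (J u) (J w) = 0 := by
  have e : inner ℂ (J (c i (a i u))) (J w) = inner ℂ (J u) (J (c i (a i w))) := by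
    rw [h.adj, h.adj']
  rw [hu, hw, map_smul, map_smul, inner_smul_left, inner_smul_right, Complex.conj_ofReal] at e
  have : ((p : ℂ) - q) * inner ℂ (J u) (J w) = 0 := by linear_combination e
  rcases mul_eq_zero.1 this with h' | h'
  · exact absurd (by exact_mod_cast sub_eq_zero.1 h') hpq
  · exact h'

lemma inner_excite_of_ne {v' : V} (hv : ∀ i, a i v = 0) (hv' : ∀ i, a i v' = 0)
    {m m' : Multiset ι} (hm : m ≠ m') :
    inner ℂ (J (excite c h.cre_comm v m)) (J (excite c h.cre_comm v' m')) = 0 := by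
  obtain ⟨i, hi⟩ : ∃ i, m.count i ≠ m'.count i := by
    by_contra! hc
    exact hm (Multiset.ext.2 hc)
  exact h.inner_eq_zero_of_number (i := i) (p := m.count i) (q := m'.count i)
    (by exact_mod_cast hi) (by simpa using h.number_excite hv i m)
    (by simpa using h.number_excite hv' i m')

end IsBosonFamily

/-- The multiset in which `i` occurs `n i` times. -/
def ofCount [Fintype ι] (n : ι → ℕ) : Multiset ι := ∑ i, Multiset.replicate (n i) i

lemma count_ofCount [Fintype ι] [DecidableEq ι] (n : ι → ℕ) (i : ι) :
    (ofCount n).count i = n i := by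
  simp [ofCount, Multiset.count_sum', Multiset.count_replicate]

lemma ofCount_count [Fintype ι] [DecidableEq ι] (m : Multiset ι) :
    ofCount (fun i => m.count i) = m :=
  Multiset.ext.2 fun i => count_ofCount _ i

lemma map_ofCount [Fintype ι] (n : ι → ℕ) (π : Equiv.Perm ι) :
    (ofCount n).map π = ofCount (n ∘ π.symm) := by
  classical
  refine Multiset.ext.2 fun i => ?_
  obtain ⟨j, rfl⟩ := π.surjective i
  rw [Multiset.count_map_eq_count' _ _ π.injective, count_ofCount, count_ofCount]
  simp

end Fock

/-! ### Gaussian wave functions and the completeness of their polynomial multiples -/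

section Gaussian

lemma mul_sub_mul_sq_le {a c : ℝ} (hc : 0 < c) (t : ℝ) : a * t - c * t ^ 2 ≤ a ^ 2 / (4 * c) := by
  rw [le_div_iff₀ (by positivity)]
  nlinarith [sq_nonneg (a - 2 * c * t)]

lemma exists_one_add_pow_mul_exp_le {c : ℝ} (hc : 0 < c) (N : ℕ) :
    ∃ C : ℝ, ∀ t : ℝ, 0 ≤ t → (1 + t) ^ N * Real.exp (-(c * t ^ 2)) ≤ C := by
  refine ⟨N.factorial * Real.exp (1 + 1 ^ 2 / (4 * c)), fun t ht => ?_⟩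
  have h1 : (1 + t) ^ N ≤ N.factorial * Real.exp (1 + t) := by
    have := Real.pow_div_factorial_le_exp (1 + t) (by positivity) N
    rwa [div_le_iff₀ (by positivity), mul_comm] at this
  calc (1 + t) ^ N * Real.exp (-(c * t ^ 2))
      ≤ N.factorial * Real.exp (1 + t) * Real.exp (-(c * t ^ 2)) := by gcongr
    _ = N.factorial * Real.exp (1 + (1 * t - c * t ^ 2)) := by
        rw [mul_assoc, ← Real.exp_add]; ring_nf
    _ ≤ _ := by gcongr; exact mul_sub_mul_sq_le hc t

lemma norm_iteratedFDeriv_cexp (n : ℕ) (z : ℂ) :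
    ‖iteratedFDeriv ℝ n Complex.exp z‖ = ‖Complex.exp z‖ := by
  have h : ContDiffAt ℂ n Complex.exp z := Complex.contDiff_exp.contDiffAt
  rw [← h.restrictScalars_iteratedFDeriv (𝕜 := ℝ), Function.comp_apply,
    ContinuousMultilinearMap.norm_restrictScalars, norm_iteratedFDeriv_eq_norm_iteratedDeriv]
  have := congrFun (iteratedDeriv_cexp_const_mul n 1) z
  simp only [one_mul, one_pow] at this
  rw [this]

variable {E : Type*} [NormedAddCommGroup E]

/-- The Schwartz function `exp f`, for an exponent of temperate growth whose real part is bounded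
above by a negative multiple of the squared norm. -/
def expSchwartz [NormedSpace ℝ E] (f : E → ℂ) (hf : f.HasTemperateGrowth) {c : ℝ} (hc : 0 < c)
    (hfc : ∀ x, (f x).re ≤ -(c * ‖x‖ ^ 2)) : 𝓢(E, ℂ) where
  toFun x := Complex.exp (f x)
  smooth' := hf.1.cexp
  decay' k n := by
    obtain ⟨K, C, hC, hb⟩ := hf.norm_iteratedFDeriv_le_uniform n
    obtain ⟨B, hB⟩ := exists_one_add_pow_mul_exp_le hc (k + K * n)
    refine ⟨n.factorial * (1 + C) ^ n * B, fun x => ?_⟩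
    have h1 : (1 : ℝ) ≤ 1 + ‖x‖ := by linarith [norm_nonneg x]
    have hD : 1 ≤ (1 + C) * (1 + ‖x‖) ^ K := one_le_mul_of_one_le_of_one_le (by linarith)
      (one_le_pow₀ h1)
    have h := norm_iteratedFDeriv_comp_le (𝕜 := ℝ) (g := Complex.exp) (f := f) (n := n)
      (N := n) (Complex.contDiff_exp (𝕜 := ℝ)) (hf.1.of_le (by exact_mod_cast le_top)) le_rfl x
      (C := ‖Complex.exp (f x)‖)
      (D := (1 + C) * (1 + ‖x‖) ^ K) (fun i _ => (norm_iteratedFDeriv_cexp i _).le)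
      (fun i hi hin => by
        refine (hb i hin x).trans ?_
        calc C * (1 + ‖x‖) ^ K ≤ (1 + C) * (1 + ‖x‖) ^ K := by gcongr; linarith
          _ ≤ _ := le_self_pow₀ hD (by omega))
    have he : ‖Complex.exp (f x)‖ ≤ Real.exp (-(c * ‖x‖ ^ 2)) := by
      rw [Complex.norm_exp]; exact Real.exp_le_exp.2 (hfc x)
    have hx : ‖x‖ ^ k ≤ (1 + ‖x‖) ^ k := by gcongr; linarith
    calc ‖x‖ ^ k * ‖iteratedFDeriv ℝ n (fun x => Complex.exp (f x)) x‖
        ≤ (1 + ‖x‖) ^ k * (n.factorial * Real.exp (-(c * ‖x‖ ^ 2)) *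
            ((1 + C) * (1 + ‖x‖) ^ K) ^ n) := by
          refine mul_le_mul hx (h.trans ?_) (norm_nonneg _) (by positivity)
          gcongr
      _ = n.factorial * (1 + C) ^ n *
            ((1 + ‖x‖) ^ (k + K * n) * Real.exp (-(c * ‖x‖ ^ 2))) := by
          rw [mul_pow, pow_add, pow_mul]; ring
      _ ≤ _ := by
          gcongr
          exact hB _ (norm_nonneg x)

variable [InnerProductSpace ℝ E] [FiniteDimensional ℝ E] [MeasurableSpace E] [BorelSpace E]

/-- An integrable function whose Fourier transform vanishes is zero almost everywhere. -/
lemma ae_eq_zero_of_fourier_eq_zero {h : E → ℂ} (hh : Integrable h)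
    (h0 : ∀ ξ, FourierTransform.fourier h ξ = 0) : ∀ᵐ x, h x = 0 := by
  refine ae_eq_zero_of_integral_contDiff_smul_eq_zero hh.locallyIntegrable fun g hg hgs => ?_
  have hg' : ContDiff ℝ (⊤ : ℕ∞) (fun x => (g x : ℂ)) := Complex.ofRealCLM.contDiff.comp hg
  have hgs' : HasCompactSupport (fun x => (g x : ℂ)) :=
    hgs.comp_left (g := fun r : ℝ => (r : ℂ)) rfl
  set ψ : 𝓢(E, ℂ) := hgs'.toSchwartzMap hg' with hψ
  set φ : 𝓢(E, ℂ) := FourierTransformInv.fourierInv ψ with hφ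
  have e : FourierTransform.fourier (φ : E → ℂ) = ψ := by
    rw [← SchwartzMap.fourier_coe, hφ, FourierTransform.fourier_fourierInv_eq]
  have key : ∫ ξ, FourierTransform.fourier h ξ • φ ξ =
      ∫ x, h x • FourierTransform.fourier (φ : E → ℂ) x := by
    have := VectorFourier.integral_fourierIntegral_smul_eq_flip (L := innerₗ E)
      Real.continuous_fourierChar continuous_inner hh (φ.integrable (μ := volume))
    rwa [flip_innerₗ] at this
  simp only [h0, zero_smul, integral_zero, e] at key
  rw [key]
  refine integral_congr_ae (.of_forall fun x => ?_)
  have : ψ x = (g x : ℂ) := rfl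
  simp [this, mul_comm]

/-- A function that decays faster than any exponential and has vanishing moments is zero: its
Fourier transform is the sum of the moments. -/
lemma ae_eq_zero_of_moments {h : E → ℂ} (hm : AEStronglyMeasurable h)
    (hint : ∀ a : ℝ, Integrable (fun x => Real.exp (a * ‖x‖) * ‖h x‖))
    (hmom : ∀ (ξ : E) (n : ℕ), ∫ x, ((inner ℝ ξ x : ℝ) : ℂ) ^ n * h x = 0) :
    ∀ᵐ x, h x = 0 := by
  have hh : Integrable h := by
    have := hint 0
    simp only [zero_mul, Real.exp_zero, one_mul] at this
    exact (integrable_norm_iff hm).1 this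
  refine ae_eq_zero_of_fourier_eq_zero hh fun ξ => ?_
  rw [Real.fourier_eq']
  set z : ℂ := -2 * Real.pi * Complex.I with hz
  have hs := hasSum_integral_of_dominated_convergence (μ := (volume : Measure E))
    (F := fun (n : ℕ) x => (z * ((inner ℝ ξ x : ℝ) : ℂ)) ^ n / n.factorial * h x)
    (f := fun x => Complex.exp (z * ((inner ℝ ξ x : ℝ) : ℂ)) * h x)
    (fun n x => (‖z‖ * ‖ξ‖ * ‖x‖) ^ n / n.factorial * ‖h x‖) ?_ ?_ ?_ ?_ ?_
  · have h0 : ∀ n : ℕ, ∫ x, (z * ((inner ℝ ξ x : ℝ) : ℂ)) ^ n / n.factorial * h x = 0 := by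
      intro n
      rw [← mul_zero (z ^ n / n.factorial), ← hmom ξ n, ← integral_const_mul]
      refine integral_congr_ae (.of_forall fun x => ?_)
      simp only [mul_pow]; ring
    simp only [h0] at hs
    rw [← hs.unique hasSum_zero]
    refine integral_congr_ae (.of_forall fun x => ?_)
    simp only [smul_eq_mul]
    rw [real_inner_comm, hz]
    congr 2
    push_cast; ring
  · intro n
    refine AEStronglyMeasurable.mul (Continuous.aestronglyMeasurable ?_) hm
    fun_prop
  · refine fun n => .of_forall fun x => ?_
    rw [norm_mul, norm_div, norm_pow, norm_mul, Complex.norm_real, Complex.norm_natCast, mul_assoc]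
    gcongr
    exact norm_inner_le_norm ξ x
  · exact .of_forall fun x => (Real.summable_pow_div_factorial _).mul_right _
  · refine (hint (‖z‖ * ‖ξ‖)).congr (.of_forall fun x => ?_)
    simp only
    rw [tsum_mul_right, Real.exp_eq_exp_ℝ, NormedSpace.exp_eq_tsum_div]
  · refine .of_forall fun x => HasSum.mul_right _ ?_
    rw [Complex.exp_eq_exp_ℂ]
    exact NormedSpace.expSeries_div_hasSum_exp _

/-- The multiples of a Gaussian by powers of linear forms are total in `L²`. -/
lemma ae_eq_zero_of_gaussian_moments {f : E → ℂ} (hf : MemLp f 2) {g : 𝓢(E, ℂ)} {c : ℝ}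
    (hc : 0 < c) (hg0 : ∀ x, g x ≠ 0) (hg : ∀ x, ‖g x‖ ≤ Real.exp (-(c * ‖x‖ ^ 2)))
    (hmom : ∀ (ξ : E) (n : ℕ), ∫ x, conj (((inner ℝ ξ x : ℝ) : ℂ) ^ n * g x) * f x = 0) :
    ∀ᵐ x, f x = 0 := by
  have h := ae_eq_zero_of_moments (h := fun x => conj (g x) * f x) ?_ ?_ ?_
  · filter_upwards [h] with x hx
    exact (mul_eq_zero.1 hx).resolve_left (by simpa using hg0 x)
  · exact (Complex.continuous_conj.comp g.continuous).aestronglyMeasurable.mul hf.1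
  · intro a
    have hc2 : 0 < c / 2 := by positivity
    set G : 𝓢(E, ℂ) := expSchwartz (fun x => ((-(c / 2 * ‖x‖ ^ 2) : ℝ) : ℂ)) (by
      have h1 : (fun x : E => ‖x‖ ^ 2).HasTemperateGrowth :=
        Function.hasTemperateGrowth_norm_sq E
      have h2 := (Function.HasTemperateGrowth.const (E := E) (c / 2)).mul h1
      exact Complex.ofRealCLM.hasTemperateGrowth.comp h2.neg) hc2 (fun x => (Complex.ofReal_re _).le) with hG
    have hGn : ∀ x, ‖G x‖ = Real.exp (-(c / 2 * ‖x‖ ^ 2)) := fun x => by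
      change ‖Complex.exp _‖ = _
      rw [Complex.norm_exp, Complex.ofReal_re]
    have hm : MemLp (fun x => Real.exp (a * ‖x‖) * ‖g x‖) 2 (volume : Measure E) := by
      have hGL : MemLp (fun x => Real.exp (a ^ 2 / (4 * (c / 2))) * ‖G x‖) 2
          (volume : Measure E) := (G.memLp 2 volume).norm.const_mul _
      refine hGL.mono ?_ (.of_forall fun x => ?_)
      · exact Continuous.aestronglyMeasurable (by fun_prop)
      · rw [Real.norm_of_nonneg (by positivity), Real.norm_of_nonneg (by positivity), hGn]
        calc Real.exp (a * ‖x‖) * ‖g x‖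
            ≤ Real.exp (a * ‖x‖) * Real.exp (-(c * ‖x‖ ^ 2)) := by gcongr; exact hg x
          _ = Real.exp (a * ‖x‖ - c / 2 * ‖x‖ ^ 2) * Real.exp (-(c / 2 * ‖x‖ ^ 2)) := by
            rw [← Real.exp_add, ← Real.exp_add]; ring_nf
          _ ≤ _ := by
            gcongr
            exact mul_sub_mul_sq_le hc2 _
    refine (hm.integrable_mul hf.norm).congr (.of_forall fun x => ?_)
    simp [mul_assoc]
  · intro ξ n
    rw [← hmom ξ n]
    refine integral_congr_ae (.of_forall fun x => ?_)
    simp only [map_mul, map_pow, Complex.conj_ofReal, mul_assoc]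

end Gaussian

/-! ### The vacuum of the new modes and the complete system of its excitations -/

section Vacuum

variable {A : ℕ} {S : Type*} {P : Params} {σ : ℝ}

/-- Two orthogonal non-zero vectors in the plane determine every vector. -/
lemma eq_zero_of_orthogonal {e₁ e₂ g₁ g₂ x₁ x₂ : ℝ} (h : e₁ * g₁ + e₂ * g₂ = 0)
    (he : e₁ ^ 2 + e₂ ^ 2 ≠ 0) (hg : g₁ ^ 2 + g₂ ^ 2 ≠ 0) (hxe : x₁ * e₁ + x₂ * e₂ = 0)
    (hxg : x₁ * g₁ + x₂ * g₂ = 0) : x₁ = 0 ∧ x₂ = 0 := by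
  have hd : e₁ * g₂ - e₂ * g₁ ≠ 0 := by
    intro h0
    have : (e₁ ^ 2 + e₂ ^ 2) * (g₁ ^ 2 + g₂ ^ 2) = 0 := by
      linear_combination (e₁ * g₁ + e₂ * g₂) * h + (e₁ * g₂ - e₂ * g₁) * h0
    exact (mul_ne_zero he hg) this
  constructor
  · refine (mul_eq_zero.1 (?_ : x₁ * (e₁ * g₂ - e₂ * g₁) = 0)).resolve_right hd
    linear_combination g₂ * hxe - e₂ * hxg
  · refine (mul_eq_zero.1 (?_ : x₂ * (e₁ * g₂ - e₂ * g₁) = 0)).resolve_right hd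
    linear_combination e₁ * hxg - g₁ * hxe

/-- The complex symmetric matrix of the exponent of the vacuum: real and positive on the diagonal,
imaginary off the diagonal. It is determined by the condition that the new annihilation
operators vanish on the vacuum. -/
lemma Params.Modes.exists_vacuum_exponent (h : P.Stable) (M : P.Modes σ) :
    ∃ a b d κ : ℝ, 0 < a ∧ 0 < b ∧ 0 < d ∧ ∀ j, M.F j 0 = a * M.G j 0 ∧
      M.F j 1 = b * M.G j 1 - κ * M.F j 2 ∧ M.G j 2 = κ * M.G j 1 + d * M.F j 2 := by
  have h11 := M.sum_G_mul_F 1 1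
  have h12 := M.sum_G_mul_F 1 2
  have h21 := M.sum_G_mul_F 2 1
  have h22 := M.sum_G_mul_F 2 2
  simp [Fin.sum_univ_three, M.F_zero, M.G_zero] at h11 h12 h21 h22
  have hE : 0 < M.G 1 1 ^ 2 + M.G 2 1 ^ 2 := by
    refine lt_of_le_of_ne (by positivity) fun h0 => ?_
    have h1 : M.G 1 1 = 0 := by nlinarith [sq_nonneg (M.G 1 1), sq_nonneg (M.G 2 1)]
    have h2 : M.G 2 1 = 0 := by nlinarith [sq_nonneg (M.G 1 1), sq_nonneg (M.G 2 1)]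
    rw [h1, h2] at h11; norm_num at h11
  have hH : 0 < M.F 1 2 ^ 2 + M.F 2 2 ^ 2 := by
    refine lt_of_le_of_ne (by positivity) fun h0 => ?_
    have h1 : M.F 1 2 = 0 := by nlinarith [sq_nonneg (M.F 1 2), sq_nonneg (M.F 2 2)]
    have h2 : M.F 2 2 = 0 := by nlinarith [sq_nonneg (M.F 1 2), sq_nonneg (M.F 2 2)]
    rw [h1, h2] at h22; norm_num at h22
  set E := M.G 1 1 ^ 2 + M.G 2 1 ^ 2 with hEd
  set W := M.F 1 2 ^ 2 + M.F 2 2 ^ 2 with hWd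
  set κ := (M.G 1 2 * M.G 1 1 + M.G 2 2 * M.G 2 1) / E with hκ
  have hκE : κ * E = M.G 1 2 * M.G 1 1 + M.G 2 2 * M.G 2 1 := by rw [hκ]; field_simp
  have hb : 1 / (2 * E) * E = 1 / 2 := by field_simp
  have hd : 1 / (2 * W) * W = 1 / 2 := by field_simp
  set b := 1 / (2 * E)
  set d := 1 / (2 * W)
  have hG := eq_zero_of_orthogonal h12 hE.ne' hH.ne'
    (x₁ := M.G 1 2 - (κ * M.G 1 1 + d * M.F 1 2)) (x₂ := M.G 2 2 - (κ * M.G 2 1 + d * M.F 2 2))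
    (by rw [hEd] at hκE; linear_combination -hκE - d * h12)
    (by rw [hWd] at hd; linear_combination h22 - hd - κ * h12)
  have hd0 : 0 < d := by positivity
  have hFW : M.F 1 1 * M.F 1 2 + M.F 2 1 * M.F 2 2 = -(κ * W) := by
    have e1 : d * (M.F 1 1 * M.F 1 2 + M.F 2 1 * M.F 2 2) = d * -(κ * W) := by
      linear_combination h21 - κ * h11 - M.F 1 1 * hG.1 - M.F 2 1 * hG.2 + κ * hd
    exact mul_left_cancel₀ hd0.ne' e1
  have hF := eq_zero_of_orthogonal h12 hE.ne' hH.ne'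
    (x₁ := M.F 1 1 - (b * M.G 1 1 - κ * M.F 1 2)) (x₂ := M.F 2 1 - (b * M.G 2 1 - κ * M.F 2 2))
    (by rw [hEd] at hb; linear_combination h11 - hb + κ * h12)
    (by rw [hWd] at hFW; linear_combination hFW - b * h12)
  have hm := h.m
  have hh := h.hbar
  have hx := h.ωx
  refine ⟨P.m * P.ωx / P.hbar, b, d, κ, by positivity, by positivity, hd0, fun j => ?_⟩
  fin_cases j
  · refine ⟨?_, by simp [M.F_zero, M.G_zero], by simp [M.F_zero, M.G_zero]⟩
    simp only [M.F_zero, M.G_zero, Fin.zero_eta, Pi.single_eq_same]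
    rw [Real.sqrt_eq_iff_eq_sq (by positivity) (by positivity), mul_pow,
      Real.sq_sqrt (by positivity)]
    field_simp
  · exact ⟨by rw [show (⟨1, by decide⟩ : Fin 3) = Fin.succ 0 from rfl, M.F_succ, M.G_succ, mul_zero],
      sub_eq_zero.1 hF.1, sub_eq_zero.1 hG.1⟩
  · exact ⟨by rw [show (⟨2, by decide⟩ : Fin 3) = Fin.succ 1 from rfl, M.F_succ, M.G_succ, mul_zero],
      sub_eq_zero.1 hF.2, sub_eq_zero.1 hG.2⟩

/-- The exponent `-½ ∑_α (a x² + b y² + d z² + 2 i κ y z)` of a Gaussian wave function. -/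
def gaussExponent (a b d κ : ℝ) (x : Config A) : ℂ :=
  ∑ α, (-(1 / 2 : ℂ)) * (a * (x (α, 0) : ℂ) ^ 2 + b * (x (α, 1) : ℂ) ^ 2 +
    d * (x (α, 2) : ℂ) ^ 2 + 2 * Complex.I * κ * (x (α, 1) * x (α, 2)))

lemma gaussExponent_hasTemperateGrowth (a b d κ : ℝ) :
    (gaussExponent (A := A) a b d κ).HasTemperateGrowth := by
  refine Function.HasTemperateGrowth.sum fun α _ => ?_
  have h0 := hasTemperateGrowth_coord (α, 0)
  have h1 := hasTemperateGrowth_coord (α, 1)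
  have h2 := hasTemperateGrowth_coord (α, 2)
  have hc : ∀ z : ℂ, (fun _ : Config A => z).HasTemperateGrowth := fun z => .const z
  exact (hc _).mul (((((hc _).mul (h0.pow 2)).add ((hc _).mul (h1.pow 2))).add
    ((hc _).mul (h2.pow 2))).add ((hc _).mul (h1.mul h2)))

lemma gaussExponent_re_le {a b d : ℝ} (κ : ℝ) {c : ℝ} (ha : c ≤ a) (hb : c ≤ b) (hd : c ≤ d)
    (x : Config A) : (gaussExponent a b d κ x).re ≤ -(c / 2 * ‖x‖ ^ 2) := by
  rw [EuclideanSpace.real_norm_sq_eq, Fintype.sum_prod_type, gaussExponent, Complex.re_sum,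
    Finset.mul_sum, ← Finset.sum_neg_distrib]
  refine Finset.sum_le_sum fun α _ => ?_
  rw [Fin.sum_univ_three]
  have e : ((-(1 / 2 : ℂ)) * (a * (x (α, 0) : ℂ) ^ 2 + b * (x (α, 1) : ℂ) ^ 2 +
      d * (x (α, 2) : ℂ) ^ 2 + 2 * Complex.I * κ * (x (α, 1) * x (α, 2)))).re =
      -(1 / 2) * (a * x (α, 0) ^ 2 + b * x (α, 1) ^ 2 + d * x (α, 2) ^ 2) := by
    have : ((-(1 / 2 : ℂ)) * (a * (x (α, 0) : ℂ) ^ 2 + b * (x (α, 1) : ℂ) ^ 2 +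
      d * (x (α, 2) : ℂ) ^ 2 + 2 * Complex.I * κ * (x (α, 1) * x (α, 2)))) =
      ((-(1 / 2) * (a * x (α, 0) ^ 2 + b * x (α, 1) ^ 2 + d * x (α, 2) ^ 2) : ℝ) : ℂ) +
      ((-(κ * (x (α, 1) * x (α, 2))) : ℝ) : ℂ) * Complex.I := by
      push_cast; ring
    rw [this, Complex.add_re, Complex.ofReal_re, Complex.re_ofReal_mul, Complex.I_re, mul_zero,
      add_zero]
  rw [e]
  nlinarith [mul_le_mul_of_nonneg_right ha (sq_nonneg (x (α, 0))),
    mul_le_mul_of_nonneg_right hb (sq_nonneg (x (α, 1))),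
    mul_le_mul_of_nonneg_right hd (sq_nonneg (x (α, 2)))]

lemma gaussExponent_fderiv (a b d κ : ℝ) (x : Config A) (β : Fin A) (k : Fin 3) :
    ∃ L : Config A →L[ℝ] ℂ, HasFDerivAt (gaussExponent a b d κ) L x ∧
      L (EuclideanSpace.single (β, k) (1 : ℝ)) =
        -(![(a * x (β, 0) : ℂ), b * x (β, 1) + Complex.I * κ * x (β, 2),
          d * x (β, 2) + Complex.I * κ * x (β, 1)] k) := by
  have hc : ∀ i : Fin A × Fin 3, HasFDerivAt (fun x : Config A => ((x i : ℝ) : ℂ))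
      (Complex.ofRealCLM.comp (EuclideanSpace.proj (𝕜 := ℝ) i)) x := fun i =>
    (Complex.ofRealCLM.comp (EuclideanSpace.proj (𝕜 := ℝ) i)).hasFDerivAt
  refine ⟨_, HasFDerivAt.fun_sum fun α _ => (((((hc (α, 0)).pow 2).const_mul (a : ℂ)).add
    (((hc (α, 1)).pow 2).const_mul (b : ℂ))).add (((hc (α, 2)).pow 2).const_mul (d : ℂ))).add
    (((hc (α, 1)).mul (hc (α, 2))).const_mul (2 * Complex.I * κ)) |>.const_mul (-(1 / 2 : ℂ)), ?_⟩
  fin_cases k <;> simp <;>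
    rw [Finset.sum_eq_single β (fun α _ hα => by simp [hα]) (by simp)] <;> simp <;> ring

end Vacuum

section FockStates

variable {A : ℕ} {S : Type*} {P : Params} {σ : ℝ}

lemma inner_embed_left [Fintype S] (Φ : State A S) (Ψ : Hilb A S) :
    inner ℂ (embed Φ) Ψ = ∑ s, ∫ x, conj (Φ s x) * Ψ s x := by
  rw [PiLp.inner_apply]
  refine Finset.sum_congr rfl fun s _ => ?_
  rw [L2.inner_def]
  refine integral_congr_ae ?_
  filter_upwards [(Φ s).coeFn_toLp 2 volume] with x hx
  have : (embed Φ s : Config A → ℂ) x = Φ s x := hx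
  rw [this]
  simp [mul_comm]

/-- `g` is the spatial part of the vacuum: a Gaussian bound, no zeros, symmetric under exchange of
the particles, and annihilated by all new modes, whatever the internal states. -/
structure Params.Modes.IsVacuum (M : P.Modes σ) (S : Type*) (g : 𝓢(Config A, ℂ)) : Prop where
  ne_zero : ∀ x, g x ≠ 0
  norm_le : ∃ c > 0, ∀ x, ‖g x‖ ≤ Real.exp (-(c * ‖x‖ ^ 2))
  perm : ∀ π x, g (permConfig π x) = g x
  ann_eq_zero : ∀ Ψ : State A S, (∀ s, Ψ s = g ∨ Ψ s = 0) → ∀ α j, M.ann A S α j Ψ = 0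

namespace Params.Modes

/-- The vacuum is a Gaussian. -/
lemma exists_isVacuum (h : P.Stable) (M : P.Modes σ) (A : ℕ) (S : Type*) :
    ∃ g : 𝓢(Config A, ℂ), M.IsVacuum S g := by
  obtain ⟨a, b, d, κ, ha, hb, hd, hM⟩ := M.exists_vacuum_exponent h
  have hc : 0 < min a (min b d) := lt_min ha (lt_min hb hd)
  have hre := gaussExponent_re_le (A := A) κ (min_le_left a (min b d))
    ((min_le_right a (min b d)).trans (min_le_left b d))
    ((min_le_right a (min b d)).trans (min_le_right b d))
  set g : 𝓢(Config A, ℂ) := expSchwartz (gaussExponent a b d κ)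
    (gaussExponent_hasTemperateGrowth a b d κ) (half_pos hc) hre with hg
  have hgx : ∀ x, g x = Complex.exp (gaussExponent a b d κ x) := fun _ => rfl
  refine ⟨g, fun x => Complex.exp_ne_zero _, ⟨_, half_pos hc, fun x => ?_⟩, fun π x => ?_, ?_⟩
  · rw [hgx, Complex.norm_exp]
    exact Real.exp_le_exp.2 (hre x)
  · rw [hgx, hgx]
    congr 1
    exact Equiv.sum_comp π (fun α => (-(1 / 2 : ℂ)) * (a * (x (α, 0) : ℂ) ^ 2 +
      b * (x (α, 1) : ℂ) ^ 2 + d * (x (α, 2) : ℂ) ^ 2 +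
      2 * Complex.I * κ * (x (α, 1) * x (α, 2))))
  · intro Ψ hΨ α j
    rw [M.ann_eq]
    refine funext fun s => SchwartzMap.ext fun x => ?_
    rw [LinearMap.sum_apply, Finset.sum_apply]
    simp only [Fin.sum_univ_three, LinearMap.add_apply, LinearMap.smul_apply, Pi.add_apply,
      Pi.smul_apply, _root_.add_apply, _root_.smul_apply, Pi.zero_apply,
      _root_.zero_apply, smul_eq_mul, pos_apply]
    rcases hΨ s with hs | hs
    · have hD : ∀ k, partialD A S α k Ψ s x = -(![(a * x (α, 0) : ℂ),
          b * x (α, 1) + Complex.I * κ * x (α, 2),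
          d * x (α, 2) + Complex.I * κ * x (α, 1)] k) * g x := by
        intro k
        obtain ⟨L, hL, hLk⟩ := gaussExponent_fderiv a b d κ x α k
        rw [partialD_eq, hs, SchwartzMap.lineDerivOp_apply_eq_fderiv]
        have : HasFDerivAt (g : Config A → ℂ) (Complex.exp (gaussExponent a b d κ x) • L) x :=
          hL.cexp
        rw [this.fderiv, _root_.smul_apply, hLk, hgx, smul_eq_mul, mul_comm]
      obtain ⟨h0, h1, h2⟩ := hM j
      rw [hD, hD, hD, hs]
      simp only [Modes.posCoeff, Modes.derCoeff, Matrix.cons_val, h0, h1, h2]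
      push_cast
      linear_combination (-(M.F j 2 : ℂ) * κ * x (α, 1) * g x) * Complex.I_sq
    · rw [partialD_apply_eq_zero α 0 hs, partialD_apply_eq_zero α 1 hs,
        partialD_apply_eq_zero α 2 hs, hs]
      simp

/-- The new modes as a family of bosons, indexed by the particle and the direction. -/
lemma isBosonFamily [Fintype S] (M : P.Modes σ) : IsBosonFamily (embedL A S)
    (fun i : Fin A × Fin 3 => M.ann A S i.1 i.2) (fun i => M.cre A S i.1 i.2) where
  ann_mul_cre i j := by
    have := M.ann_mul_cre (S := S) i.1 j.1 i.2 j.2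
    rw [sub_eq_iff_eq_add'] at this
    simpa only [Prod.ext_iff] using this
  cre_comm i j := M.cre_comm ..
  adj i := M.isAdj_cre i.1 i.2

open scoped Classical in
/-- The vacuum with internal states `s`. -/
def vac (g : 𝓢(Config A, ℂ)) (s : Fin A → S) : State A S := Pi.single s g

variable (M : P.Modes σ)

/-- The unnormalized state with `n α j` quanta of the mode `j` of particle `α`. -/
def fock (g : 𝓢(Config A, ℂ)) (n : Fin A → Fin 3 → ℕ) (s : Fin A → S) : State A S :=
  excite (fun i : Fin A × Fin 3 => M.cre A S i.1 i.2) (fun _ _ => M.cre_comm ..) (vac g s)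
    (ofCount fun i => n i.1 i.2)

/-- The normalized state with `n α j` quanta of the mode `j` of particle `α`. -/
def fockState [Fintype S] (g : 𝓢(Config A, ℂ)) (n : Fin A → Fin 3 → ℕ) (s : Fin A → S) :
    State A S :=
  ((‖embed (M.fock g n s)‖⁻¹ : ℝ) : ℂ) • M.fock g n s

lemma cre_apply_eq_zero (α : Fin A) {Ψ : State A S}
    {s : Fin A → S} (hs : Ψ s = 0) (j : Fin 3) : M.cre A S α j Ψ s = 0 := by
  rw [M.cre_eq, LinearMap.sum_apply, Finset.sum_apply]
  refine Finset.sum_eq_zero fun k _ => ?_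
  rw [LinearMap.sub_apply, LinearMap.smul_apply, LinearMap.smul_apply, Pi.sub_apply,
    Pi.smul_apply, Pi.smul_apply, pos_apply_eq_zero α k hs, partialD_apply_eq_zero α k hs]
  simp

lemma excite_vac_apply {g : 𝓢(Config A, ℂ)} {s s' : Fin A → S} (hs : s' ≠ s)
    (m : Multiset (Fin A × Fin 3)) :
    excite (fun i : Fin A × Fin 3 => M.cre A S i.1 i.2) (fun _ _ => M.cre_comm ..) (vac g s) m s'
      = 0 := by
  induction m using Multiset.induction_on with
  | empty => simp [vac, hs]
  | cons i m ih => rw [excite_cons]; exact M.cre_apply_eq_zero i.1 ih i.2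

variable {M} {g : 𝓢(Config A, ℂ)} (hg : M.IsVacuum S g)
include hg

lemma IsVacuum.ann_vac (s : Fin A → S) (i : Fin A × Fin 3) : M.ann A S i.1 i.2 (vac g s) = 0 := by
  classical
  refine hg.ann_eq_zero _ (fun s' => ?_) i.1 i.2
  rcases eq_or_ne s' s with rfl | hs
  · exact .inl (by simp [vac])
  · exact .inr (by simp [vac, hs])

variable [Fintype S]

lemma IsVacuum.embed_vac_ne_zero (s : Fin A → S) : embedL A S (vac g s) ≠ 0 := by
  classical
  rw [Ne, map_eq_zero_iff _ embedL_injective]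
  intro h0
  have := congrArg (fun Ψ : State A S => Ψ s 0) h0
  simp [vac] at this
  exact hg.ne_zero 0 this

lemma IsVacuum.embed_fock_ne_zero (n : Fin A → Fin 3 → ℕ) (s : Fin A → S) :
    embed (M.fock g n s) ≠ 0 :=
  M.isBosonFamily.excite_ne_zero (hg.ann_vac s) (hg.embed_vac_ne_zero s) _

lemma IsVacuum.number_fockState (n : Fin A → Fin 3 → ℕ) (s : Fin A → S) (α : Fin A) (j : Fin 3) :
    (M.cre A S α j * M.ann A S α j) (M.fockState g n s) = (n α j : ℂ) • M.fockState g n s := by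
  have := M.isBosonFamily.number_excite (hg.ann_vac s) (α, j) (ofCount fun i => n i.1 i.2)
  rw [count_ofCount] at this
  rw [fockState, map_smul, Module.End.mul_apply, smul_comm]
  exact congrArg _ this

lemma IsVacuum.orthonormal : Orthonormal ℂ
    (fun p : (Fin A → Fin 3 → ℕ) × (Fin A → S) => embed (M.fockState g p.1 p.2)) := by
  refine ⟨fun p => ?_, fun p p' hp => ?_⟩
  · have := norm_ne_zero_iff.2 (hg.embed_fock_ne_zero p.1 p.2)
    change ‖embed (M.fockState g p.1 p.2)‖ = 1
    rw [fockState, embed_smul, norm_smul, Complex.norm_real, norm_inv, norm_norm,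
      inv_mul_cancel₀ this]
  · change inner ℂ (embed (M.fockState g p.1 p.2)) (embed (M.fockState g p'.1 p'.2)) = 0
    rw [fockState, fockState, embed_smul, embed_smul, inner_smul_left, inner_smul_right]
    suffices inner ℂ (embed (M.fock g p.1 p.2)) (embed (M.fock g p'.1 p'.2)) = 0 by
      rw [this, mul_zero, mul_zero]
    by_cases hs : p.2 = p'.2
    · have hn : p.1 ≠ p'.1 := fun hn => hp (Prod.ext hn hs)
      refine M.isBosonFamily.inner_excite_of_ne (hg.ann_vac p.2) (hg.ann_vac p'.2) fun hm => hn ?_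
      funext α j
      have := congrArg (Multiset.count (α, j)) hm
      rwa [count_ofCount, count_ofCount] at this
    -- states with different internal states have disjoint supports
    · rw [inner_embed]
      refine Finset.sum_eq_zero fun s _ => ?_
      rcases eq_or_ne s p.2 with rfl | h1
      · have := M.excite_vac_apply (g := g) hs (ofCount fun i => p'.1 i.1 i.2)
        simp [fock, this]
      · have := M.excite_vac_apply (g := g) h1 (ofCount fun i => p.1 i.1 i.2)
        simp [fock, this]

omit hg [Fintype S] in
/-- A space of states that is invariant under the creation and annihilation operators is invariant
under the positions. -/
lemma pos_mem (M : P.Modes σ) {W : Submodule ℂ (State A S)}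
    (hc : ∀ α j, ∀ Φ ∈ W, M.cre A S α j Φ ∈ W) (ha : ∀ α j, ∀ Φ ∈ W, M.ann A S α j Φ ∈ W)
    (α : Fin A) (k : Fin 3) {Φ : State A S} (hΦ : Φ ∈ W) : pos A S α k Φ ∈ W := by
  have hQ : ∀ k, opQ A S α k Φ ∈ W := by
    intro k
    rw [M.opQ_eq, LinearMap.sum_apply]
    exact W.sum_mem fun j _ => W.smul_mem _ (W.add_mem (ha α j Φ hΦ) (hc α j Φ hΦ))
  have hD : ∀ k, opD A S α k Φ ∈ W := by
    intro k
    rw [M.opD_eq, LinearMap.sum_apply]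
    exact W.sum_mem fun j _ => W.smul_mem _ (W.sub_mem (ha α j Φ hΦ) (hc α j Φ hΦ))
  fin_cases k
  · exact hQ 0
  · exact hQ 1
  · have := W.smul_mem (-Complex.I) (hD 2)
    have e : (-Complex.I) • opD A S α 2 Φ = pos A S α 2 Φ := by
      simp [opD, smul_smul]
    rwa [e] at this

/-- Completeness: the span of the excitations of a vacuum contains its products with powers of
linear forms, since it is invariant under the positions. -/
lemma IsVacuum.orthogonal_eq_bot : (Submodule.span ℂ (Set.range
    (fun p : (Fin A → Fin 3 → ℕ) × (Fin A → S) => embed (M.fockState g p.1 p.2))))ᗮ = ⊥ := by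
  rw [Submodule.eq_bot_iff]
  intro Ψ hΨ
  rw [Submodule.mem_orthogonal] at hΨ
  have hfock : ∀ n s, inner ℂ (embed (M.fock g n s)) Ψ = 0 := by
    intro n s
    have h1 := hΨ _ (Submodule.subset_span ⟨(n, s), rfl⟩)
    have h2 := norm_ne_zero_iff.2 (hg.embed_fock_ne_zero n s)
    simp only [fockState, embed_smul, inner_smul_left, Complex.conj_ofReal] at h1
    exact (mul_eq_zero.1 h1).resolve_left (by simpa using h2)
  ext1 s
  set b := M.isBosonFamily (A := A) (S := S)
  set W := Submodule.span ℂ (Set.range (excite _ b.cre_comm (vac g s))) with hW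
  have hW0 : ∀ Φ ∈ W, inner ℂ (embed Φ) Ψ = 0 ∧ ∀ s', s' ≠ s → Φ s' = 0 := by
    intro Φ hΦ
    refine Submodule.span_induction ?_ ?_ ?_ ?_ hΦ
    · rintro _ ⟨m, rfl⟩
      refine ⟨?_, fun s' hs => M.excite_vac_apply hs m⟩
      have := hfock (fun α j => m.count (α, j)) s
      rwa [fock, ofCount_count] at this
    · have : embed (0 : State A S) = 0 := (embedL A S).map_zero
      exact ⟨by rw [this, inner_zero_left], fun _ _ => rfl⟩
    · rintro x y _ _ ⟨hx, hx'⟩ ⟨hy, hy'⟩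
      exact ⟨by rw [embed_add, inner_add_left, hx, hy, add_zero],
        fun s' hs => by rw [Pi.add_apply, hx' s' hs, hy' s' hs, add_zero]⟩
    · rintro r x _ ⟨hx, hx'⟩
      exact ⟨by rw [embed_smul, inner_smul_left, hx, mul_zero],
        fun s' hs => by rw [Pi.smul_apply, hx' s' hs, smul_zero]⟩
  have hpos : ∀ α k, ∀ Φ ∈ W, pos A S α k Φ ∈ W := fun α k Φ hΦ =>
    M.pos_mem (fun α j Φ hΦ => b.cre_mem_span (α, j) hΦ)
      (fun α j Φ hΦ => b.ann_mem_span (hg.ann_vac s) (α, j) hΦ) α k hΦ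
  obtain ⟨c, hc, hgc⟩ := hg.norm_le
  have hmem : MemLp (Ψ s : Config A → ℂ) 2 volume := Lp.memLp (Ψ s)
  have key := ae_eq_zero_of_gaussian_moments hmem hc hg.ne_zero hgc fun ξ n => ?_
  · exact Lp.eq_zero_iff_ae_eq_zero.2 key
  · have hn : ∃ Φ ∈ W, ∀ x, Φ s x = ((inner ℝ ξ x : ℝ) : ℂ) ^ n * g x := by
      induction n with
      | zero =>
        refine ⟨vac g s, Submodule.subset_span ⟨0, rfl⟩, fun x => ?_⟩
        simp [vac]
      | succ n ih =>
        obtain ⟨Φ, hΦ, hΦx⟩ := ih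
        refine ⟨∑ i : Fin A × Fin 3, (ξ i : ℂ) • pos A S i.1 i.2 Φ,
          W.sum_mem fun i _ => W.smul_mem _ (hpos _ _ _ hΦ), fun x => ?_⟩
        rw [Finset.sum_apply, _root_.sum_apply]
        simp only [Pi.smul_apply, _root_.smul_apply, pos_apply, hΦx, smul_eq_mul]
        rw [pow_succ, mul_right_comm, mul_comm, PiLp.inner_apply, Complex.ofReal_sum, Finset.mul_sum]
        refine Finset.sum_congr rfl fun i _ => ?_
        simp
        ring
    obtain ⟨Φ, hΦ, hΦx⟩ := hn
    obtain ⟨h1, h2⟩ := hW0 Φ hΦ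
    rw [inner_embed_left, Finset.sum_eq_single s] at h1
    · simpa only [hΦx] using h1
    · intro s' _ hs
      simp [h2 s' hs]
    · simp

end Params.Modes

end FockStates

/-! ### The spectrum -/

section Spectrum

variable {A : ℕ} {S : Type*} {P : Params} {σ : ℝ}

lemma IsAdj.symm [Fintype S] {T T' : Module.End ℂ (State A S)} (h : IsAdj T T') : IsAdj T' T :=
  fun Φ Ψ => by rw [← inner_conj_symm, ← h, inner_conj_symm]

lemma HasRegularEigenvalue.hasL2Eigenvalue [Fintype S] {T : Module.End ℂ (State A S)}
    (hT : IsAdj T T) {K : Hilb A S → Prop} {E : ℂ} (h : HasRegularEigenvalue T K E) :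
    HasL2Eigenvalue T K E := by
  obtain ⟨Φ, hK, hΦ⟩ := h
  refine ⟨embed Φ, hK, ?_, fun Ψ => ?_⟩
  · exact (map_ne_zero_iff (embedL A S) embedL_injective).2 hΦ.2
  · rw [hT, hΦ.apply_eq_smul, embed_smul, inner_smul_right]

namespace Params.Modes

variable (M : P.Modes σ)

include M in
lemma routhian_isAdj [Fintype S] (h : P.Stable) : IsAdj (P.routhian A S) (P.routhian A S) := by
  rw [M.routhian_eq h]
  refine IsAdj.sum _ fun j => ?_
  have e : ((P.hbar * P.newFreq σ j : ℝ) : ℂ) = conj ((P.hbar * P.newFreq σ j : ℝ) : ℂ) :=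
    (Complex.conj_ofReal _).symm
  conv => arg 2; rw [e]
  refine IsAdj.smul _ (IsAdj.sum _ fun α => ?_)
  refine ((M.isAdj_cre α j).mul (M.isAdj_cre α j).symm).add ?_
  have := IsAdj.smul (1 / 2 : ℂ) (IsAdj.one (A := A) (S := S))
  rwa [show conj (1 / 2 : ℂ) = 1 / 2 by rw [map_div₀, map_one, map_ofNat]] at this

lemma quanta_eq (h : P.Stable) (j : Fin 3) : P.quanta A S M.U M.V j =
    ∑ α, (M.cre A S α j * M.ann A S α j + (1 / 2 : ℂ) • 1) := by
  simp only [quanta, M.number_eq_cre_mul_ann h]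

lemma routhian_apply_of_quanta (h : P.Stable) {N : Fin 3 → ℝ} {Ψ : State A S}
    (hΨ : ∀ j, P.quanta A S M.U M.V j Ψ = (N j : ℂ) • Ψ) :
    P.routhian A S Ψ = (P.energy σ N : ℂ) • Ψ := by
  rw [M.routhian_eq_quanta h, LinearMap.add_apply, LinearMap.add_apply, LinearMap.smul_apply,
    LinearMap.smul_apply, LinearMap.smul_apply, hΨ, hΨ, hΨ, energy]
  push_cast
  module

variable {M} {g : 𝓢(Config A, ℂ)}

lemma IsVacuum.routhian_fockState [Fintype S] (h : P.Stable) (hg : M.IsVacuum S g)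
    (n : Fin A → Fin 3 → ℕ) (s : Fin A → S) :
    P.routhian A S (M.fockState g n s) =
      (P.energy σ (totalQuanta n) : ℂ) • M.fockState g n s := by
  refine M.routhian_apply_of_quanta h fun j => ?_
  rw [M.quanta_eq h, LinearMap.sum_apply, totalQuanta, Complex.ofReal_sum, Finset.sum_smul]
  refine Finset.sum_congr rfl fun α _ => ?_
  rw [LinearMap.add_apply, hg.number_fockState, LinearMap.smul_apply, Module.End.one_apply]
  push_cast
  module

lemma IsVacuum.fockState_ne_zero [Fintype S] (hg : M.IsVacuum S g)
    (n : Fin A → Fin 3 → ℕ) (s : Fin A → S) : M.fockState g n s ≠ 0 := by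
  intro h0
  have h1 := hg.orthonormal.1 (n, s)
  have h2 : embed (0 : State A S) = 0 := (embedL A S).map_zero
  simp [h0, h2] at h1

/-- The orthonormal basis of states with definite numbers of quanta and internal states. -/
def IsVacuum.basis [Fintype S] (hg : M.IsVacuum S g) :
    HilbertBasis ((Fin A → Fin 3 → ℕ) × (Fin A → S)) ℂ (Hilb A S) :=
  HilbertBasis.mkOfOrthogonalEqBot hg.orthonormal hg.orthogonal_eq_bot

lemma IsVacuum.basis_apply [Fintype S] (hg : M.IsVacuum S g)
    (n : Fin A → Fin 3 → ℕ) (s : Fin A → S) : hg.basis (n, s) = embed (M.fockState g n s) := by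
  rw [IsVacuum.basis, HilbertBasis.coe_mkOfOrthogonalEqBot]

lemma IsVacuum.exists_inner_ne_zero [Fintype S] (hg : M.IsVacuum S g) {Ψ : Hilb A S}
    (hΨ : Ψ ≠ 0) : ∃ n s, inner ℂ (embed (M.fockState g n s)) Ψ ≠ 0 := by
  by_contra! h0
  refine hΨ (hg.basis.repr.map_eq_zero_iff.1 ?_)
  ext p
  rw [hg.basis.repr_apply_apply, hg.basis_apply p.1 p.2, h0]
  rfl

/-- An eigenvalue is the energy of any basis state on which the eigenvector has a component. -/
lemma IsVacuum.eq_energy_of_inner_ne_zero [Fintype S] (h : P.Stable) (hg : M.IsVacuum S g)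
    {Ψ : Hilb A S} {E : ℂ}
    (hE : ∀ Φ : State A S, inner ℂ (embed (P.routhian A S Φ)) Ψ = E * inner ℂ (embed Φ) Ψ)
    {n : Fin A → Fin 3 → ℕ} {s : Fin A → S} (hn : inner ℂ (embed (M.fockState g n s)) Ψ ≠ 0) :
    E = (P.energy σ (totalQuanta n) : ℂ) := by
  have := hE (M.fockState g n s)
  rw [hg.routhian_fockState h, embed_smul, inner_smul_left, Complex.conj_ofReal] at this
  exact (mul_right_cancel₀ hn this).symm

end Params.Modes

end Spectrum

/-! ### Exchange of the particles -/

section Exchange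

variable {A : ℕ} {S : Type*} {P : Params} {σ : ℝ}

/-- The exchange of the particles as an isometry of the configuration space. -/
def permConfigL (π : Equiv.Perm (Fin A)) : Config A ≃ₗᵢ[ℝ] Config A :=
  LinearIsometryEquiv.piLpCongrLeft 2 ℝ ℝ (π.symm.prodCongr (Equiv.refl (Fin 3)))

lemma permConfigL_apply (π : Equiv.Perm (Fin A)) (x : Config A) :
    permConfigL π x = permConfig π x := by
  ext i
  simp [permConfigL, permConfig, LinearIsometryEquiv.piLpCongrLeft_apply,
    Equiv.piCongrLeft', Equiv.prodCongr]
  rfl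

lemma permConfig_single (π : Equiv.Perm (Fin A)) (α : Fin A) (k : Fin 3) :
    permConfig π (EuclideanSpace.single (π α, k) 1) = EuclideanSpace.single (α, k) 1 := by
  ext i
  simp [permConfig, Prod.ext_iff]

lemma measurePreserving_permConfig (π : Equiv.Perm (Fin A)) :
    MeasurePreserving (permConfig π) := by
  have := (permConfigL π).measurePreserving
  rwa [funext (permConfigL_apply π)] at this

variable (S) in
/-- The exchange of the particles, on regular wave functions: `(πΨ)_s(x) = Ψ_{s ∘ π}(x ∘ π)`. -/
def exchange (π : Equiv.Perm (Fin A)) : Module.End ℂ (State A S) :=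
  LinearMap.pi fun s => (SchwartzMap.compCLMOfContinuousLinearEquiv ℂ
    (permConfigL π).toContinuousLinearEquiv).toLinearMap ∘ₗ LinearMap.proj (s ∘ π)

lemma exchange_apply (π : Equiv.Perm (Fin A)) (Ψ : State A S) (s : Fin A → S) (x : Config A) :
    exchange S π Ψ s x = Ψ (s ∘ π) (permConfig π x) := by
  simp [exchange, ← permConfigL_apply]

lemma exchange_pos (π : Equiv.Perm (Fin A)) (α : Fin A) (k : Fin 3) (Ψ : State A S) :
    exchange S π (pos A S α k Ψ) = pos A S (π α) k (exchange S π Ψ) := by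
  refine funext fun s => SchwartzMap.ext fun x => ?_
  rw [exchange_apply, pos_apply, pos_apply, exchange_apply]
  rfl

lemma exchange_partialD (π : Equiv.Perm (Fin A)) (α : Fin A) (k : Fin 3) (Ψ : State A S) :
    exchange S π (partialD A S α k Ψ) = partialD A S (π α) k (exchange S π Ψ) := by
  refine funext fun s => SchwartzMap.ext fun x => ?_
  rw [exchange_apply, partialD_apply, partialD_apply, lineDeriv, lineDeriv]
  congr 1
  funext t
  rw [exchange_apply]
  congr 1
  rw [← permConfigL_apply, ← permConfigL_apply, map_add, map_smul, permConfigL_apply π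
    (EuclideanSpace.single _ _), permConfig_single]

lemma exchange_exchange (π τ : Equiv.Perm (Fin A)) (Ψ : State A S) :
    exchange S π (exchange S τ Ψ) = exchange S (π * τ) Ψ := by
  refine funext fun s => SchwartzMap.ext fun x => ?_
  simp only [exchange_apply]
  rfl

/-- An exchange of the particles is unitary: it can be moved to the other side of a scalar
product, at the cost of the sign of the permutation if the other state is antisymmetric. -/
lemma inner_exchange [Fintype S] {Ψ : Hilb A S} (hΨ : IsAntisymmetric Ψ) (π : Equiv.Perm (Fin A))
    (Φ : State A S) : inner ℂ (embed (exchange S π Φ)) Ψ =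
      ((Equiv.Perm.sign π : ℤ) : ℂ) * inner ℂ (embed Φ) Ψ := by
  have hsq : ((Equiv.Perm.sign π : ℤ) : ℂ) * ((Equiv.Perm.sign π : ℤ) : ℂ) = 1 := by
    rcases Int.units_eq_one_or (Equiv.Perm.sign π) with h | h <;> simp [h]
  have key : ∀ s : Fin A → S, ∫ x, conj (Φ (s ∘ π) x) * Ψ (s ∘ π) x =
      ((Equiv.Perm.sign π : ℤ) : ℂ) * ∫ x, conj (exchange S π Φ s x) * Ψ s x := by
    intro s
    have hmp := (measurePreserving_permConfig (A := A) π)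
    have he : MeasurableEmbedding (permConfig π : Config A → Config A) := by
      rw [← funext (permConfigL_apply π)]
      exact (permConfigL π).toHomeomorph.measurableEmbedding
    rw [← hmp.integral_comp he, ← integral_const_mul]
    refine integral_congr_ae ?_
    filter_upwards [hΨ π s] with x hx
    rw [hx, exchange_apply]
    ring
  rw [inner_embed_left, inner_embed_left]
  have e := Equiv.sum_comp (π.symm.arrowCongr (Equiv.refl S))
    (fun s => ∫ x, conj (Φ s x) * Ψ s x)
  rw [← e]
  have e2 : ∀ s : Fin A → S, (π.symm.arrowCongr (Equiv.refl S)) s = s ∘ π := fun s => rfl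
  simp only [e2, key]
  rw [← Finset.mul_sum, ← mul_assoc, hsq, one_mul]

lemma isAntisymmetric_embed [Fintype S] {Ψ : State A S}
    (hΨ : ∀ π, exchange S π Ψ = ((Equiv.Perm.sign π : ℤ) : ℂ) • Ψ) : IsAntisymmetric (embed Ψ) := by
  intro π s
  have h1 : ∀ s, (embed Ψ s : Config A → ℂ) =ᵐ[volume] Ψ s := fun s => (Ψ s).coeFn_toLp 2 volume
  filter_upwards [h1 s, (measurePreserving_permConfig (A := A) π).quasiMeasurePreserving.ae_eq_comp
    (h1 (s ∘ π))] with x hx hx'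
  simp only [Function.comp] at hx'
  have := congrArg (fun Φ : State A S => Φ s x) (hΨ π)
  simp only [exchange_apply] at this
  rw [hx]
  exact hx'.trans this

lemma comp_swap_symm {ι X : Type*} [DecidableEq ι] {f : ι → X} {i j : ι} (h : f i = f j) :
    f ∘ (Equiv.swap i j).symm = f := by
  funext k
  simp only [Function.comp, Equiv.symm_swap]
  rcases eq_or_ne k i with rfl | hi
  · simp [h]
  · rcases eq_or_ne k j with rfl | hj
    · simp [h]
    · rw [Equiv.swap_apply_of_ne_of_ne hi hj]

namespace Params.Modes

variable (M : P.Modes σ)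

lemma exchange_cre (π : Equiv.Perm (Fin A)) (α : Fin A) (j : Fin 3) (Ψ : State A S) :
    exchange S π (M.cre A S α j Ψ) = M.cre A S (π α) j (exchange S π Ψ) := by
  simp only [M.cre_eq, LinearMap.sum_apply, LinearMap.sub_apply, LinearMap.smul_apply, map_sum,
    map_sub, map_smul, exchange_pos, exchange_partialD]

variable {M} {g : 𝓢(Config A, ℂ)}

lemma IsVacuum.exchange_fock (hg : M.IsVacuum S g) (π : Equiv.Perm (Fin A))
    (n : Fin A → Fin 3 → ℕ) (s : Fin A → S) :
    exchange S π (M.fock g n s) = M.fock g (n ∘ π.symm) (s ∘ π.symm) := by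
  classical
  have hv : exchange S π (vac g s) = vac g (s ∘ π.symm) := by
    refine funext fun s' => SchwartzMap.ext fun x => ?_
    have hs : s' ∘ π = s ↔ s' = s ∘ π.symm := by
      constructor
      · rintro rfl; ext; simp
      · rintro rfl; ext; simp
    rw [exchange_apply, vac, vac, Pi.single_apply, Pi.single_apply, if_congr hs rfl rfl]
    split_ifs
    · exact hg.perm π x
    · rfl
  rw [fock, fock, map_excite (π := π.prodCongr (Equiv.refl (Fin 3)))
    (fun i w => M.exchange_cre π i.1 i.2 w), map_ofCount, hv]
  rfl

lemma IsVacuum.exchange_fockState [Fintype S] (hg : M.IsVacuum S g) (π : Equiv.Perm (Fin A))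
    (n : Fin A → Fin 3 → ℕ) (s : Fin A → S) :
    ∃ r : ℝ, exchange S π (M.fockState g n s) =
      (r : ℂ) • M.fockState g (n ∘ π.symm) (s ∘ π.symm) := by
  have := norm_ne_zero_iff.2 (hg.embed_fock_ne_zero (n ∘ π.symm) (s ∘ π.symm))
  refine ⟨‖embed (M.fock g n s)‖⁻¹ * ‖embed (M.fock g (n ∘ π.symm) (s ∘ π.symm))‖, ?_⟩
  rw [fockState, fockState, map_smul, hg.exchange_fock, smul_smul, ← Complex.ofReal_mul, mul_assoc,
    mul_inv_cancel₀ this, mul_one]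

/-- The Pauli principle: an antisymmetric state has no component in which two particles agree in
the numbers of quanta and in the internal state. -/
lemma IsVacuum.injective_of_inner_ne_zero [Fintype S] (hg : M.IsVacuum S g) {Ψ : Hilb A S}
    (hΨ : IsAntisymmetric Ψ) {n : Fin A → Fin 3 → ℕ} {s : Fin A → S}
    (hn : inner ℂ (embed (M.fockState g n s)) Ψ ≠ 0) :
    Function.Injective fun α => (n α, s α) := by
  classical
  intro α β hαβ
  by_contra hne
  obtain ⟨hn1, hs1⟩ : n α = n β ∧ s α = s β := Prod.ext_iff.1 hαβ
  have hf : exchange S (Equiv.swap α β) (M.fockState g n s) = M.fockState g n s := by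
    rw [fockState, map_smul, hg.exchange_fock, comp_swap_symm hn1, comp_swap_symm hs1]
  have := inner_exchange hΨ (Equiv.swap α β) (M.fockState g n s)
  rw [hf, Equiv.Perm.sign_swap hne] at this
  refine hn ?_
  push_cast at this
  linear_combination this / 2

/-- The Slater determinant of distinct one-particle states is an eigenstate. -/
lemma IsVacuum.exists_antisymmetric [Fintype S] (h : P.Stable) (hg : M.IsVacuum S g)
    {n : Fin A → Fin 3 → ℕ} {s : Fin A → S} (hns : Function.Injective fun α => (n α, s α)) :
    HasRegularEigenvalue (P.routhian A S) IsAntisymmetric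
      (P.energy σ (totalQuanta n) : ℂ) := by
  set Φ := M.fockState g n s with hΦ
  set Ψ : State A S :=
    ∑ π : Equiv.Perm (Fin A), ((Equiv.Perm.sign π : ℤ) : ℂ) • exchange S π Φ with hΨ
  have hsq : ∀ π : Equiv.Perm (Fin A),
      ((Equiv.Perm.sign π : ℤ) : ℂ) * ((Equiv.Perm.sign π : ℤ) : ℂ) = 1 := by
    intro π
    rcases Int.units_eq_one_or (Equiv.Perm.sign π) with h | h <;> simp [h]
  refine ⟨Ψ, isAntisymmetric_embed fun τ => ?_, ?_, fun h0 => ?_⟩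
  · rw [hΨ, map_sum, Finset.smul_sum, ← Equiv.sum_comp (Equiv.mulLeft τ)
      (fun π => ((Equiv.Perm.sign τ : ℤ) : ℂ) • ((Equiv.Perm.sign π : ℤ) : ℂ) • exchange S π Φ)]
    refine Finset.sum_congr rfl fun π _ => ?_
    rw [map_smul, exchange_exchange, smul_smul, Equiv.coe_mulLeft, Equiv.Perm.sign_mul]
    push_cast
    rw [← mul_assoc, hsq, one_mul]
  · rw [Module.End.mem_eigenspace_iff, hΨ, map_sum, Finset.smul_sum]
    refine Finset.sum_congr rfl fun π _ => ?_
    obtain ⟨r, hr⟩ := hg.exchange_fockState π n s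
    have hN : totalQuanta (n ∘ π.symm) = totalQuanta n :=
      funext fun k => Equiv.sum_comp π.symm fun α => ((n α k : ℝ) + 1 / 2)
    rw [hΦ, hr, map_smul, map_smul, hg.routhian_fockState h, hN, smul_comm (r : ℂ), smul_comm]
  · have h1 : inner ℂ (embed Φ) (embedL A S Ψ) = 1 := by
      rw [hΨ, map_sum, inner_sum, Finset.sum_eq_single 1]
      · have e1 : exchange S 1 Φ = Φ := funext fun s => SchwartzMap.ext fun x =>
          exchange_apply 1 Φ s x
        rw [e1, Equiv.Perm.sign_one, embedL_apply]
        have := inner_self_eq_norm_sq_to_K (𝕜 := ℂ) (embed Φ)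
        have h2 := hg.orthonormal.1 (n, s)
        simp only at h2
        rw [h2] at this
        simpa using this
      · intro π _ hπ
        obtain ⟨r, hr⟩ := hg.exchange_fockState π n s
        rw [map_smul, inner_smul_right, hr, map_smul, inner_smul_right, embedL_apply]
        -- a permutation that fixes the list of distinct one-particle states is trivial
        have hne : (n, s) ≠ (n ∘ π.symm, s ∘ π.symm) := by
          intro he
          rw [Prod.ext_iff] at he
          refine hπ (Equiv.ext fun α => hns ?_)
          refine Prod.ext ?_ ?_
          · have := congrFun he.1 (π α)
            simpa using this
          · have := congrFun he.2 (π α)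
            simpa using this
        have := hg.orthonormal.2 hne
        simp only at this
        rw [this, mul_zero, mul_zero]
      · simp
    rw [h0, map_zero, inner_zero_right] at h1
    exact zero_ne_one h1

/-- The spectrum, on all states and on the antisymmetric states. -/
lemma IsVacuum.spectrum [Fintype S] [Nonempty S] (h : P.Stable) (hg : M.IsVacuum S g) (E : ℂ) :
    (HasL2Eigenvalue (P.routhian A S) (fun _ => True) E ↔
        ∃ n : Fin A → Fin 3 → ℕ, E = (P.energy σ (totalQuanta n) : ℂ)) ∧
      (HasRegularEigenvalue (P.routhian A S) (fun _ => True) E ↔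
        ∃ n : Fin A → Fin 3 → ℕ, E = (P.energy σ (totalQuanta n) : ℂ)) ∧
      (HasL2Eigenvalue (P.routhian A S) IsAntisymmetric E ↔
        ∃ (n : Fin A → Fin 3 → ℕ) (s : Fin A → S), Function.Injective (fun α => (n α, s α)) ∧
          E = (P.energy σ (totalQuanta n) : ℂ)) ∧
      (HasRegularEigenvalue (P.routhian A S) IsAntisymmetric E ↔
        ∃ (n : Fin A → Fin 3 → ℕ) (s : Fin A → S), Function.Injective (fun α => (n α, s α)) ∧
          E = (P.energy σ (totalQuanta n) : ℂ)) := by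
  have hT := M.routhian_isAdj (A := A) (S := S) h
  have h1 : HasL2Eigenvalue (P.routhian A S) (fun _ => True) E →
      ∃ n : Fin A → Fin 3 → ℕ, E = (P.energy σ (totalQuanta n) : ℂ) := by
    rintro ⟨Ψ, -, hΨ, hE⟩
    obtain ⟨n, s, hn⟩ := hg.exists_inner_ne_zero hΨ
    exact ⟨n, hg.eq_energy_of_inner_ne_zero h hE hn⟩
  have h2 : HasL2Eigenvalue (P.routhian A S) IsAntisymmetric E →
      ∃ (n : Fin A → Fin 3 → ℕ) (s : Fin A → S), Function.Injective (fun α => (n α, s α)) ∧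
        E = (P.energy σ (totalQuanta n) : ℂ) := by
    rintro ⟨Ψ, hA, hΨ, hE⟩
    obtain ⟨n, s, hn⟩ := hg.exists_inner_ne_zero hΨ
    exact ⟨n, s, hg.injective_of_inner_ne_zero hA hn, hg.eq_energy_of_inner_ne_zero h hE hn⟩
  have h3 : (∃ n : Fin A → Fin 3 → ℕ, E = (P.energy σ (totalQuanta n) : ℂ)) →
      HasRegularEigenvalue (P.routhian A S) (fun _ => True) E := by
    rintro ⟨n, rfl⟩
    let s : Fin A → S := fun _ => Classical.arbitrary S
    exact ⟨M.fockState g n s, trivial, Module.End.mem_eigenspace_iff.2 (hg.routhian_fockState h n s),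
      hg.fockState_ne_zero n s⟩
  have h4 : (∃ (n : Fin A → Fin 3 → ℕ) (s : Fin A → S),
        Function.Injective (fun α => (n α, s α)) ∧ E = (P.energy σ (totalQuanta n) : ℂ)) →
      HasRegularEigenvalue (P.routhian A S) IsAntisymmetric E := by
    rintro ⟨n, s, hns, rfl⟩
    exact hg.exists_antisymmetric h hns
  exact ⟨⟨h1, fun hE => (h3 hE).hasL2Eigenvalue hT⟩, ⟨fun hE => h1 (hE.hasL2Eigenvalue hT), h3⟩,
    ⟨h2, fun hE => (h4 hE).hasL2Eigenvalue hT⟩, ⟨fun hE => h2 (hE.hasL2Eigenvalue hT), h4⟩⟩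

end Params.Modes

end Exchange

/-! ### Expectations in states with definite numbers of quanta -/

section Expectations

variable {A : ℕ} {S : Type*} [Fintype S] {P : Params} {σ : ℝ}

lemma expect_add (T U : Module.End ℂ (State A S)) (Ψ : State A S) :
    expect (T + U) Ψ = expect T Ψ + expect U Ψ := by
  rw [expect, LinearMap.add_apply, embed_add, inner_add_right, expect, expect]

lemma expect_smul (a : ℂ) (T : Module.End ℂ (State A S)) (Ψ : State A S) :
    expect (a • T) Ψ = a * expect T Ψ := by
  rw [expect, LinearMap.smul_apply, embed_smul, inner_smul_right, expect]

lemma expect_sub (T U : Module.End ℂ (State A S)) (Ψ : State A S) :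
    expect (T - U) Ψ = expect T Ψ - expect U Ψ := by
  have h : T - U = T + (-1 : ℂ) • U := by module
  rw [h, expect_add, expect_smul]
  ring

lemma expect_sum {ι : Type*} (s : Finset ι) (T : ι → Module.End ℂ (State A S)) (Ψ : State A S) :
    expect (∑ i ∈ s, T i) Ψ = ∑ i ∈ s, expect (T i) Ψ := by
  simp only [expect, LinearMap.sum_apply, ← embedL_apply, map_sum, inner_sum]

lemma IsAdj.expect_mul {T T' : Module.End ℂ (State A S)} (h : IsAdj T T')
    (U : Module.End ℂ (State A S)) (Ψ : State A S) :
    expect (T' * U) Ψ = inner ℂ (embed (T Ψ)) (embed (U Ψ)) := by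
  rw [expect, Module.End.mul_apply, h]

lemma IsAdj.inner_eq_zero_of_ne {T : Module.End ℂ (State A S)} (hT : IsAdj T T) {p q : ℝ}
    (hpq : p ≠ q) {Φ Ψ : State A S} (hΦ : T Φ = (p : ℂ) • Φ) (hΨ : T Ψ = (q : ℂ) • Ψ) :
    inner ℂ (embed Φ) (embed Ψ) = 0 := by
  have e := hT Φ Ψ
  rw [hΦ, hΨ, embed_smul, embed_smul, inner_smul_left, inner_smul_right, Complex.conj_ofReal] at e
  have : ((p : ℂ) - q) * inner ℂ (embed Φ) (embed Ψ) = 0 := by linear_combination e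
  rcases mul_eq_zero.1 this with h' | h'
  · exact absurd (by exact_mod_cast sub_eq_zero.1 h') hpq
  · exact h'

namespace Params.Modes

variable (M : P.Modes σ)

variable (A S) in
/-- The total number of quanta in the mode `j`, without the zero-point contribution. -/
def totalNumber (j : Fin 3) : Module.End ℂ (State A S) := ∑ α, M.cre A S α j * M.ann A S α j

lemma totalNumber_isAdj (j : Fin 3) : IsAdj (M.totalNumber A S j) (M.totalNumber A S j) :=
  IsAdj.sum _ fun α => (M.isAdj_cre α j).mul (M.isAdj_cre α j).symm

omit [Fintype S] in
lemma totalNumber_mul_ann (i : Fin 3) (β : Fin A) (k : Fin 3) :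
    M.totalNumber A S i * M.ann A S β k =
      M.ann A S β k * M.totalNumber A S i - if i = k then M.ann A S β k else 0 := by
  have key : ∀ α, M.cre A S α i * M.ann A S α i * M.ann A S β k =
      M.ann A S β k * (M.cre A S α i * M.ann A S α i) -
        if α = β then (if i = k then M.ann A S β k else 0) else 0 := by
    intro α
    have h := M.ann_mul_cre (S := S) β α k i
    rw [mul_assoc, (M.ann_comm (S := S) α β i k).eq, ← mul_assoc, ← mul_assoc,
      sub_eq_iff_eq_add.1 h]
    by_cases h1 : α = β
    · subst h1
      by_cases h2 : i = k
      · subst h2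
        simp [add_mul]
      · simp [h2, Ne.symm h2]
    · simp [h1, Ne.symm h1]
  rw [totalNumber, Finset.sum_mul, Finset.sum_congr rfl fun α _ => key α, Finset.sum_sub_distrib,
    Finset.mul_sum, Finset.sum_ite_eq' Finset.univ β, if_pos (Finset.mem_univ β)]

omit [Fintype S] in
lemma totalNumber_mul_cre (i : Fin 3) (β : Fin A) (k : Fin 3) :
    M.totalNumber A S i * M.cre A S β k =
      M.cre A S β k * M.totalNumber A S i + if i = k then M.cre A S β k else 0 := by
  have key : ∀ α, M.cre A S α i * M.ann A S α i * M.cre A S β k =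
      M.cre A S β k * (M.cre A S α i * M.ann A S α i) +
        if α = β then (if i = k then M.cre A S β k else 0) else 0 := by
    intro α
    have h := M.ann_mul_cre (S := S) α β i k
    rw [mul_assoc, sub_eq_iff_eq_add.1 h, mul_add, ← mul_assoc, (M.cre_comm (S := S) α β i k).eq,
      mul_assoc]
    by_cases h1 : α = β
    · subst h1
      by_cases h2 : i = k
      · subst h2
        simp [add_comm]
      · simp [h2]
    · simp [h1]
  rw [totalNumber, Finset.sum_mul, Finset.sum_congr rfl fun α _ => key α, Finset.sum_add_distrib,
    Finset.mul_sum, Finset.sum_ite_eq' Finset.univ β, if_pos (Finset.mem_univ β)]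

variable {M} {Ψ : State A S} {ν : Fin 3 → ℝ}
  (hν : ∀ j, M.totalNumber A S j Ψ = (ν j : ℂ) • Ψ)
include hν

omit [Fintype S] in
lemma totalNumber_ann_apply (i : Fin 3) (β : Fin A) (k : Fin 3) :
    M.totalNumber A S i (M.ann A S β k Ψ) =
      ((ν i - if i = k then 1 else 0 : ℝ) : ℂ) • M.ann A S β k Ψ := by
  have := LinearMap.congr_fun (M.totalNumber_mul_ann (S := S) i β k) Ψ
  rw [Module.End.mul_apply, LinearMap.sub_apply, Module.End.mul_apply, hν, map_smul] at this
  rw [this]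
  split_ifs
  · push_cast; module
  · simp

omit [Fintype S] in
lemma totalNumber_cre_apply (i : Fin 3) (β : Fin A) (k : Fin 3) :
    M.totalNumber A S i (M.cre A S β k Ψ) =
      ((ν i + if i = k then 1 else 0 : ℝ) : ℂ) • M.cre A S β k Ψ := by
  have := LinearMap.congr_fun (M.totalNumber_mul_cre (S := S) i β k) Ψ
  rw [Module.End.mul_apply, LinearMap.add_apply, Module.End.mul_apply, hν, map_smul] at this
  rw [this]
  split_ifs
  · push_cast; module
  · simp

/-- The number of quanta of the mode `j` is lower in one of the states than in `Ψ`, and in the other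
one it is not. -/
lemma inner_ann_cre (α β : Fin A) (j k : Fin 3) :
    inner ℂ (embed (M.ann A S α j Ψ)) (embed (M.cre A S β k Ψ)) = 0 := by
  refine (M.totalNumber_isAdj j).inner_eq_zero_of_ne ?_ (totalNumber_ann_apply hν j α j)
    (totalNumber_cre_apply hν j β k)
  rw [if_pos rfl]
  split_ifs <;> linarith

lemma inner_cre_ann (α β : Fin A) (j k : Fin 3) :
    inner ℂ (embed (M.cre A S α j Ψ)) (embed (M.ann A S β k Ψ)) = 0 := by
  rw [← inner_conj_symm, inner_ann_cre hν, map_zero]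

lemma inner_ann_ann (α β : Fin A) {j k : Fin 3} (hjk : j ≠ k) :
    inner ℂ (embed (M.ann A S α j Ψ)) (embed (M.ann A S β k Ψ)) = 0 := by
  refine (M.totalNumber_isAdj j).inner_eq_zero_of_ne ?_ (totalNumber_ann_apply hν j α j)
    (totalNumber_ann_apply hν j β k)
  rw [if_pos rfl, if_neg hjk]
  linarith

lemma inner_cre_cre (α β : Fin A) {j k : Fin 3} (hjk : j ≠ k) :
    inner ℂ (embed (M.cre A S α j Ψ)) (embed (M.cre A S β k Ψ)) = 0 := by
  refine (M.totalNumber_isAdj j).inner_eq_zero_of_ne ?_ (totalNumber_cre_apply hν j α j)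
    (totalNumber_cre_apply hν j β k)
  rw [if_pos rfl, if_neg hjk]
  linarith

variable (hΨ : ‖embed Ψ‖ = 1)
include hΨ

lemma sum_inner_ann (j : Fin 3) :
    ∑ α, inner ℂ (embed (M.ann A S α j Ψ)) (embed (M.ann A S α j Ψ)) = (ν j : ℂ) := by
  have h : expect (M.totalNumber A S j) Ψ = (ν j : ℂ) := by
    rw [expect, hν, embed_smul, inner_smul_right, inner_self_eq_norm_sq_to_K, hΨ]
    simp
  rw [← h, totalNumber, expect_sum]
  exact Finset.sum_congr rfl fun α _ => ((M.isAdj_cre α j).symm.expect_mul _ _).symm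

lemma sum_inner_cre (j : Fin 3) :
    ∑ α, inner ℂ (embed (M.cre A S α j Ψ)) (embed (M.cre A S α j Ψ)) = (ν j : ℂ) + A := by
  have h1 : inner ℂ (embed Ψ) (embed Ψ) = 1 := by
    rw [inner_self_eq_norm_sq_to_K, hΨ]; simp
  have h : ∀ α, inner ℂ (embed (M.cre A S α j Ψ)) (embed (M.cre A S α j Ψ)) =
      inner ℂ (embed (M.ann A S α j Ψ)) (embed (M.ann A S α j Ψ)) + 1 := by
    intro α
    rw [← (M.isAdj_cre α j).expect_mul, ← (M.isAdj_cre α j).symm.expect_mul,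
      sub_eq_iff_eq_add'.1 (M.ann_mul_cre (S := S) α α j j), if_pos ⟨rfl, rfl⟩, expect_add]
    congr 1
  rw [Finset.sum_congr rfl fun α _ => h α, Finset.sum_add_distrib, sum_inner_ann hν hΨ]
  simp

/-- In a state with definite total numbers of quanta only the diagonal terms of a bilinear
expression in `d ± d†` contribute. -/
lemma sum_inner_form {ε : ℂ} (hε : conj ε * ε = 1) (a b : Fin 3 → ℝ) :
    ∑ α, inner ℂ (embed ((∑ j, (a j : ℂ) • (M.ann A S α j + ε • M.cre A S α j)) Ψ))
        (embed ((∑ j, (b j : ℂ) • (M.ann A S α j + ε • M.cre A S α j)) Ψ)) =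
      ((∑ j, a j * b j * (2 * ν j + A) : ℝ) : ℂ) := by
  have key : ∀ α, inner ℂ (embed ((∑ j, (a j : ℂ) • (M.ann A S α j + ε • M.cre A S α j)) Ψ))
        (embed ((∑ j, (b j : ℂ) • (M.ann A S α j + ε • M.cre A S α j)) Ψ)) =
      ∑ j, (a j * b j : ℂ) * (inner ℂ (embed (M.ann A S α j Ψ)) (embed (M.ann A S α j Ψ)) +
        inner ℂ (embed (M.cre A S α j Ψ)) (embed (M.cre A S α j Ψ))) := by
    intro α
    simp only [LinearMap.sum_apply, LinearMap.smul_apply, LinearMap.add_apply, ← embedL_apply,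
      map_sum, map_smul, map_add, sum_inner, inner_sum, inner_smul_left, inner_smul_right,
      Complex.conj_ofReal]
    refine Finset.sum_congr rfl fun j _ => ?_
    rw [Finset.sum_eq_single j]
    · simp only [embedL_apply, inner_add_left, inner_add_right, inner_smul_left, inner_smul_right,
        inner_ann_cre hν, inner_cre_ann hν]
      linear_combination (a j * b j : ℂ) *
        inner ℂ (embed (M.cre A S α j Ψ)) (embed (M.cre A S α j Ψ)) * hε
    · intro i _ hij
      simp only [embedL_apply, inner_add_left, inner_add_right, inner_smul_left, inner_smul_right,
        inner_ann_cre hν, inner_cre_ann hν, inner_ann_ann hν _ _ hij, inner_cre_cre hν _ _ hij]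
      ring
    · simp
  rw [Finset.sum_congr rfl fun α _ => key α, Finset.sum_comm, Complex.ofReal_sum]
  refine Finset.sum_congr rfl fun j _ => ?_
  rw [← Finset.mul_sum, Finset.sum_add_distrib, sum_inner_ann hν hΨ, sum_inner_cre hν hΨ]
  push_cast
  ring

lemma expect_opQ_mul_opQ (k l : Fin 3) : expect (∑ α, opQ A S α k * opQ A S α l) Ψ =
    ((∑ j, M.G j k * M.G j l * (2 * ν j + A) : ℝ) : ℂ) := by
  rw [← sum_inner_form hν hΨ (ε := 1) (by simp), expect_sum]
  refine Finset.sum_congr rfl fun α _ => ?_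
  rw [(isAdj_opQ α k).expect_mul, M.opQ_eq, M.opQ_eq]
  simp only [one_smul]

lemma expect_opD_mul_opD (k l : Fin 3) : expect (∑ α, opD A S α k * opD A S α l) Ψ =
    -((∑ j, M.F j k * M.F j l * (2 * ν j + A) : ℝ) : ℂ) := by
  rw [← sum_inner_form hν hΨ (ε := -1) (by simp), expect_sum, ← Finset.sum_neg_distrib]
  refine Finset.sum_congr rfl fun α _ => ?_
  have e : ∀ j, M.ann A S α j + (-1 : ℂ) • M.cre A S α j = M.ann A S α j - M.cre A S α j :=
    fun j => by module
  have e2 : opD A S α k * opD A S α l = (-1 : ℂ) • ((-opD A S α k) * opD A S α l) := by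
    refine LinearMap.ext fun Φ => ?_
    rw [LinearMap.smul_apply, Module.End.mul_apply, Module.End.mul_apply, LinearMap.neg_apply]
    module
  rw [e2, expect_smul, (isAdj_opD α k).expect_mul, M.opD_eq, M.opD_eq]
  simp only [e]
  ring

end Params.Modes

end Expectations

/-! ### Derivatives of the energy -/

namespace Params

variable {P : Params} {σ : ℝ}

/-- The derivative of the energy along a curve of parameters with fixed `ħ` and `ω_x`, in terms of
those of `½(Ω₊² + Ω₋²)` and of `q²`. -/
lemma Stable.hasDerivAt_energy (h : P.Stable) (hσ : σ = 1 ∨ σ = -1) (hq : P.q σ ≠ 0)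
    (N : Fin 3 → ℝ) {C : ℝ → Params} {t₀ a b : ℝ} (h₀ : C t₀ = P)
    (hC : ∀ t, (C t).hbar = P.hbar ∧ (C t).ωx = P.ωx)
    (ha : HasDerivAt (fun t => (C t).meanSq) a t₀) (hb : HasDerivAt (fun t => (C t).qSq) b t₀) :
    HasDerivAt (fun t => (C t).energy σ N)
      (P.hbar / 2 * (a * P.ratioSum σ N + b / (2 * P.q σ) * P.ratioDiff σ N)) t₀ := by
  have hp := h.Ωp_pos hσ
  have hm := h.Ωm_pos hσ
  have hQ : P.qSq ≠ 0 := by rw [← h.q_sq hσ]; exact pow_ne_zero 2 hq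
  have hdq : HasDerivAt (fun t => (C t).q σ) (b / (2 * P.q σ)) t₀ := by
    refine ((hb.sqrt (by rwa [h₀])).const_mul σ).congr_deriv ?_
    rw [h₀, q]
    have hs : √P.qSq ≠ 0 := fun h0 => hq (by rw [q, h0, mul_zero])
    rcases hσ with rfl | rfl
    · ring
    · field_simp
  have hdp : HasDerivAt (fun t => (C t).Ωp σ) ((a + b / (2 * P.q σ)) / (2 * P.Ωp σ)) t₀ := by
    have := (ha.add hdq).sqrt (by simpa only [Pi.add_apply, h₀] using (h.add_pos hσ).ne')
    simp only [Pi.add_apply, h₀] at this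
    exact this
  have hdm : HasDerivAt (fun t => (C t).Ωm σ) ((a - b / (2 * P.q σ)) / (2 * P.Ωm σ)) t₀ := by
    have := (ha.sub hdq).sqrt (by simpa only [Pi.sub_apply, h₀] using (h.sub_pos hσ).ne')
    simp only [Pi.sub_apply, h₀] at this
    exact this
  have := ((hdp.const_mul P.hbar).mul_const (N 1)).const_add (P.hbar * P.ωx * N 0)
  refine ((this.add ((hdm.const_mul P.hbar).mul_const (N 2))).congr_of_eventuallyEq
    (.of_forall fun t => ?_)).congr_deriv ?_
  · simp [energy, hC t]
  · rw [ratioSum, ratioDiff]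
    field_simp
    ring

/-- As functions of a single parameter, `½(Ω₊² + Ω₋²)` and `q²` are polynomials of this form. -/
lemma hasDerivAt_quartic (a b c d t : ℝ) :
    HasDerivAt (fun t : ℝ => a + b * t + c * t ^ 2 + d * t ^ 4) (b + 2 * c * t + 4 * d * t ^ 3) t := by
  have h := (((hasDerivAt_id t).const_mul b).const_add a).add ((hasDerivAt_pow 2 t).const_mul c)
  refine (h.add ((hasDerivAt_pow 4 t).const_mul d)).congr_deriv ?_
  push_cast
  ring

/-! ### Closed formulas for the expectation values -/

/-- `⟨∑ y²⟩` in units of `ħ / m`, for distinct frequencies. -/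
def meanY (P : Params) (σ : ℝ) (N : Fin 3 → ℝ) : ℝ :=
  1 / 2 * P.ratioSum σ N + 1 / (2 * P.q σ) * P.ratioDiff σ N *
    (1 / 2 * (P.ωy ^ 2 - P.ωz ^ 2) + 2 * P.ω ^ 2 + (1 + P.b ^ 2 / P.c ^ 2) * P.lam ^ 2
      - (P.c / P.b + 3 * (P.b / P.c)) * P.ω * P.lam)

/-- `⟨∑ z²⟩` in units of `ħ / m`, for distinct frequencies. -/
def meanZ (P : Params) (σ : ℝ) (N : Fin 3 → ℝ) : ℝ :=
  1 / 2 * P.ratioSum σ N - 1 / (2 * P.q σ) * P.ratioDiff σ N *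
    (1 / 2 * (P.ωy ^ 2 - P.ωz ^ 2) - 2 * P.ω ^ 2 - (1 + P.c ^ 2 / P.b ^ 2) * P.lam ^ 2
      + (P.b / P.c + 3 * (P.c / P.b)) * P.ω * P.lam)

/-- `⟨L_x⟩`, for distinct frequencies. -/
def meanL (P : Params) (σ : ℝ) (N : Fin 3 → ℝ) : ℝ :=
  -P.hbar * P.ratioSum σ N * (P.ω - 1 / 2 * (P.c / P.b + P.b / P.c) * P.lam)
    - P.hbar / (2 * P.q σ) * P.ratioDiff σ N *
      (2 * (P.ωy ^ 2 + P.ωz ^ 2) * P.ω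
        - 1 / 2 * ((P.b / P.c + 3 * (P.c / P.b)) * P.ωz ^ 2
          + (P.c / P.b + 3 * (P.b / P.c)) * P.ωy ^ 2) * P.lam)

/-- `⟨C_x⟩`, for distinct frequencies. -/
def meanC (P : Params) (σ : ℝ) (N : Fin 3 → ℝ) : ℝ :=
  P.hbar * P.ratioSum σ N * (P.lam - 1 / 2 * (P.c / P.b + P.b / P.c) * P.ω)
    + P.hbar / (2 * P.q σ) * P.ratioDiff σ N *
      ((P.b ^ 2 + P.c ^ 2) * (P.ωy ^ 2 / P.c ^ 2 + P.ωz ^ 2 / P.b ^ 2) * P.lam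
        - 1 / 2 * ((P.c / P.b + 3 * (P.b / P.c)) * P.ωy ^ 2
          + (P.b / P.c + 3 * (P.c / P.b)) * P.ωz ^ 2) * P.ω)

/-- The derivatives of the energy are the expectation values of the derivatives of the Routhian. -/
lemma Stable.energy_deriv (h : P.Stable) (hσ : σ = 1 ∨ σ = -1) (hq : P.q σ ≠ 0)
    (N : Fin 3 → ℝ) :
    HasDerivAt (fun t => energy {P with ωy := t} σ N) (P.hbar * P.ωy * P.meanY σ N) P.ωy ∧
    HasDerivAt (fun t => energy {P with ωz := t} σ N) (P.hbar * P.ωz * P.meanZ σ N) P.ωz ∧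
    HasDerivAt (fun t => energy {P with ω := t} σ N) (-P.meanL σ N) P.ω ∧
    HasDerivAt (fun t => energy {P with lam := t} σ N) (P.meanC σ N) P.lam := by
  have hb := h.b.ne'
  have hc := h.c.ne'
  refine ⟨?_, ?_, ?_, ?_⟩
  · refine (h.hasDerivAt_energy hσ hq N (C := fun t => {P with ωy := t}) rfl
      (fun t => ⟨rfl, rfl⟩)
      ((hasDerivAt_quartic (meanSq {P with ωy := 0}) 0 (1 / 2) 0 P.ωy).congr_of_eventuallyEq
        (.of_forall fun t => ?_))
      ((hasDerivAt_quartic (qSq {P with ωy := 0}) 0 (-(1 / 2) * P.ωz ^ 2 + (2 * P.ω ^ 2 + P.lam ^ 2)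
        + P.b ^ 2 / P.c ^ 2 * P.lam ^ 2 - (P.c / P.b + 3 * (P.b / P.c)) * P.ω * P.lam)
        (1 / 4) P.ωy).congr_of_eventuallyEq
        (.of_forall fun t => ?_))).congr_deriv ?_
    · simp only [meanSq]; ring
    · simp only [qSq]; ring
    · rw [meanY]; field_simp; ring
  · refine (h.hasDerivAt_energy hσ hq N (C := fun t => {P with ωz := t}) rfl
      (fun t => ⟨rfl, rfl⟩)
      ((hasDerivAt_quartic (meanSq {P with ωz := 0}) 0 (1 / 2) 0 P.ωz).congr_of_eventuallyEq
        (.of_forall fun t => ?_))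
      ((hasDerivAt_quartic (qSq {P with ωz := 0}) 0 (-(1 / 2) * P.ωy ^ 2 + (2 * P.ω ^ 2 + P.lam ^ 2)
        + P.c ^ 2 / P.b ^ 2 * P.lam ^ 2 - (P.b / P.c + 3 * (P.c / P.b)) * P.ω * P.lam)
        (1 / 4) P.ωz).congr_of_eventuallyEq
        (.of_forall fun t => ?_))).congr_deriv ?_
    · simp only [meanSq]; ring
    · simp only [qSq]; ring
    · rw [meanZ]; field_simp; ring
  · refine (h.hasDerivAt_energy hσ hq N (C := fun t => {P with ω := t}) rfl
      (fun t => ⟨rfl, rfl⟩)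
      ((hasDerivAt_quartic (meanSq {P with ω := 0}) (-((P.c / P.b + P.b / P.c) * P.lam)) 1 0
        P.ω).congr_of_eventuallyEq (.of_forall fun t => ?_))
      ((hasDerivAt_quartic (qSq {P with ω := 0})
        (-(((P.c / P.b + 3 * (P.b / P.c)) * P.ωy ^ 2 +
          (P.b / P.c + 3 * (P.c / P.b)) * P.ωz ^ 2) * P.lam))
        (2 * (P.ωy ^ 2 + P.ωz ^ 2)) 0 P.ω).congr_of_eventuallyEq
        (.of_forall fun t => ?_))).congr_deriv ?_
    · simp only [meanSq]; ring
    · simp only [qSq]; ring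
    · rw [meanL]; field_simp; ring
  · refine (h.hasDerivAt_energy hσ hq N (C := fun t => {P with lam := t}) rfl
      (fun t => ⟨rfl, rfl⟩)
      ((hasDerivAt_quartic (meanSq {P with lam := 0}) (-((P.c / P.b + P.b / P.c) * P.ω)) 1 0
        P.lam).congr_of_eventuallyEq (.of_forall fun t => ?_))
      ((hasDerivAt_quartic (qSq {P with lam := 0})
        (-(((P.c / P.b + 3 * (P.b / P.c)) * P.ωy ^ 2 +
          (P.b / P.c + 3 * (P.c / P.b)) * P.ωz ^ 2) * P.ω))
        (P.ωy ^ 2 + P.ωz ^ 2 + (P.b ^ 2 / P.c ^ 2 * P.ωy ^ 2 + P.c ^ 2 / P.b ^ 2 * P.ωz ^ 2)) 0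
        P.lam).congr_of_eventuallyEq (.of_forall fun t => ?_))).congr_deriv ?_
    · simp only [meanSq]; ring
    · simp only [qSq]; ring
    · rw [meanC]; field_simp; ring

end Params

namespace Params.Modes

variable {A : ℕ} {S : Type*} [Fintype S] {P : Params} {σ : ℝ}
variable (M : P.Modes σ)

omit [Fintype S] in
lemma totalNumber_of_quanta (h : P.Stable) {N : Fin 3 → ℝ} {Ψ : State A S}
    (hN : ∀ j, P.quanta A S M.U M.V j Ψ = (N j : ℂ) • Ψ) (j : Fin 3) :
    M.totalNumber A S j Ψ = ((N j - A / 2 : ℝ) : ℂ) • Ψ := by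
  have := hN j
  rw [M.quanta_eq h, Finset.sum_add_distrib, LinearMap.add_apply, Finset.sum_const,
    Finset.card_univ, Fintype.card_fin, LinearMap.smul_apply, LinearMap.smul_apply,
    Module.End.one_apply] at this
  rw [totalNumber, eq_sub_of_add_eq this]
  push_cast
  module

variable {M} (h : P.Stable) {N : Fin 3 → ℝ} {Ψ : State A S} (hΨ : ‖embed Ψ‖ = 1)
  (hN : ∀ j, P.quanta A S M.U M.V j Ψ = (N j : ℂ) • Ψ)
include h hΨ hN

lemma expect_sum_opQ (k l : Fin 3) : expect (∑ α, opQ A S α k * opQ A S α l) Ψ =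
    ((2 * ∑ j, M.G j k * M.G j l * N j : ℝ) : ℂ) := by
  rw [expect_opQ_mul_opQ (M.totalNumber_of_quanta h hN) hΨ, Finset.mul_sum]
  congr 1
  refine Finset.sum_congr rfl fun j _ => ?_
  ring

lemma expect_sum_opD (k l : Fin 3) : expect (∑ α, opD A S α k * opD A S α l) Ψ =
    ((-2 * ∑ j, M.F j k * M.F j l * N j : ℝ) : ℂ) := by
  rw [expect_opD_mul_opD (M.totalNumber_of_quanta h hN) hΨ, Finset.mul_sum,
    ← Complex.ofReal_neg, ← Finset.sum_neg_distrib]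
  congr 1
  refine Finset.sum_congr rfl fun j _ => ?_
  ring

lemma expect_sumSq_zero : expect (sumSq A S 0) Ψ = ((P.hbar / P.m * (N 0 / P.ωx) : ℝ) : ℂ) := by
  have hm := h.m
  have hh := h.hbar
  have hx := h.ωx
  have e := expect_sum_opQ h hΨ hN 0 0
  have h0 : M.G 0 0 * M.G 0 0 = P.hbar / (2 * P.m * P.ωx) := by
    rw [M.G_zero, Pi.single_eq_same, Real.mul_self_sqrt (by positivity)]
  have h1 : M.G 1 0 = 0 := M.G_succ 0
  have h2 : M.G 2 0 = 0 := M.G_succ 1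
  rw [Fin.sum_univ_three, h0, h1, h2] at e
  refine e.trans (congrArg _ ?_)
  field_simp
  ring

variable (hσ : σ = 1 ∨ σ = -1) (hq : P.q σ ≠ 0)
include hσ hq

lemma expect_sumSq_one : expect (sumSq A S 1) Ψ = ((P.hbar / P.m * P.meanY σ N : ℝ) : ℂ) := by
  have hp := (h.Ωp_pos hσ).ne'
  have hn := (h.Ωm_pos hσ).ne'
  have hb := h.b.ne'
  have hc := h.c.ne'
  have hm := h.m.ne'
  have e := expect_sum_opQ h hΨ hN 1 1
  obtain ⟨h1, h2, -⟩ := M.amplitudes hq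
  have h0 : M.G 0 1 = 0 := by rw [M.G_zero]; simp
  rw [Fin.sum_univ_three, h0, ← pow_two, ← pow_two, ← pow_two, h1, h2] at e
  refine e.trans (congrArg _ ?_)
  rw [meanY, ratioSum, ratioDiff, meanSq_eq hb hc, crankY, crankZ]
  generalize P.Ωp σ = O₁ at *
  generalize P.Ωm σ = O₂ at *
  generalize P.q σ = q at *
  field_simp
  ring

lemma expect_sumSq_two : expect (sumSq A S 2) Ψ = ((P.hbar / P.m * P.meanZ σ N : ℝ) : ℂ) := by
  have hp := (h.Ωp_pos hσ).ne'
  have hn := (h.Ωm_pos hσ).ne'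
  have hb := h.b.ne'
  have hc := h.c.ne'
  have hm := h.m.ne'
  have hz : sumSq A S 2 = (-1 : ℂ) • ∑ α, opD A S α 2 * opD A S α 2 := by
    rw [sumSq, Finset.smul_sum]
    refine Finset.sum_congr rfl fun α _ => ?_
    simp [opD, smul_smul]
  have e := expect_sum_opD h hΨ hN 2 2
  obtain ⟨-, -, h1, h2, -⟩ := M.amplitudes hq
  have h0 : M.F 0 2 = 0 := by rw [M.F_zero]; simp
  rw [Fin.sum_univ_three, h0, ← pow_two, ← pow_two, ← pow_two, h1, h2] at e
  rw [hz, expect_smul, e, ← Complex.ofReal_one, ← Complex.ofReal_neg, ← Complex.ofReal_mul]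
  refine congrArg _ ?_
  rw [meanZ, ratioSum, ratioDiff, meanSq_eq hb hc, crankY, crankZ]
  generalize P.Ωp σ = O₁ at *
  generalize P.Ωm σ = O₂ at *
  generalize P.q σ = q at *
  field_simp
  ring

lemma expect_generators : expect (P.angMom A S) Ψ = ((P.meanL σ N : ℝ) : ℂ) ∧
    expect (P.circ A S) Ψ = ((P.meanC σ N : ℝ) : ℂ) := by
  have hp := (h.Ωp_pos hσ).ne'
  have hn := (h.Ωm_pos hσ).ne'
  have hps := h.Ωp_sq hσ
  have hns := h.Ωm_sq hσ
  have hb := h.b.ne'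
  have hc := h.c.ne'
  have hm := h.m.ne'
  have hh := h.hbar.ne'
  have e1 := expect_sum_opQ h hΨ hN 1 2
  have e2 := expect_sum_opD h hΨ hN 2 1
  obtain ⟨g1, g2, f1, f2, k1, k2⟩ := M.amplitudes hq
  have hF0 : M.F 0 2 = 0 := by rw [M.F_zero]; simp
  have hG0 : M.G 0 1 = 0 := by rw [M.G_zero]; simp
  set s := P.ratioSum σ N with hs
  set t := P.ratioDiff σ N with ht
  -- the weights `Ω_j N_j` in terms of the ratios `N_j / Ω_j`
  have hO : P.Ωp σ * N 1 - P.Ωm σ * N 2 = P.meanSq * t + P.q σ * s := by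
    have i1 : P.Ωp σ * N 1 = P.Ωp σ ^ 2 * (N 1 / P.Ωp σ) := by field_simp
    have i2 : P.Ωm σ * N 2 = P.Ωm σ ^ 2 * (N 2 / P.Ωm σ) := by field_simp
    rw [i1, i2, hps, hns, hs, ht, ratioSum, ratioDiff]
    ring
  have x1 : 2 * ∑ j, M.G j 1 * M.G j 2 * N j =
      (P.crankY + P.crankZ) / (2 * P.q σ) * (P.meanSq * t + P.q σ * s)
        - P.crankY / 2 * (s + (P.meanSq - (P.ωz ^ 2 - P.crankZ ^ 2)) * t / P.q σ) := by
    have i1 : M.G 1 1 * M.G 1 2 = P.m / P.hbar *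
        (P.Ωp σ * (M.G 1 1 * M.F 1 2) - P.crankY * M.G 1 1 ^ 2) := by rw [M.G_one]; ring
    have i2 : M.G 2 1 * M.G 2 2 = P.m / P.hbar *
        (P.Ωm σ * (M.G 2 1 * M.F 2 2) - P.crankY * M.G 2 1 ^ 2) := by rw [M.G_two]; ring
    rw [Fin.sum_univ_three, hG0, i1, i2, g1, g2, k1, k2, ← hO, hs, ht, ratioSum, ratioDiff]
    generalize P.meanSq = mean
    field_simp
    ring
  have x2 : 2 * ∑ j, M.F j 2 * M.F j 1 * N j =
      (P.crankY + P.crankZ) / (2 * P.q σ) * (P.meanSq * t + P.q σ * s)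
        - P.crankZ / 2 * (s + (P.meanSq - (P.ωy ^ 2 - P.crankY ^ 2)) * t / P.q σ) := by
    have i1 : M.F 1 2 * M.F 1 1 = P.m / P.hbar *
        (P.Ωp σ * (M.G 1 1 * M.F 1 2) - P.crankZ * M.F 1 2 ^ 2) := by rw [M.F_one]; ring
    have i2 : M.F 2 2 * M.F 2 1 = P.m / P.hbar *
        (P.Ωm σ * (M.G 2 1 * M.F 2 2) - P.crankZ * M.F 2 2 ^ 2) := by rw [M.F_two]; ring
    rw [Fin.sum_univ_three, hF0, i1, i2, f1, f2, k1, k2, ← hO, hs, ht, ratioSum, ratioDiff]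
    generalize P.meanSq = mean
    field_simp
    ring
  rw [x1] at e1
  rw [neg_mul, x2] at e2
  constructor
  · rw [angMom_eq_opQ, expect_smul, Finset.sum_sub_distrib, expect_sub, e1, e2,
      ← Complex.ofReal_sub, ← Complex.ofReal_neg, ← Complex.ofReal_mul]
    refine congrArg _ ?_
    rw [meanL, ← hs, ← ht, meanSq_eq hb hc, crankY, crankZ]
    generalize P.q σ = q at *
    clear_value s t
    field_simp
    ring
  · rw [circ_eq_opQ, expect_smul, Finset.sum_sub_distrib, expect_sub, ← Finset.smul_sum,
      ← Finset.smul_sum, expect_smul, expect_smul, e1, e2, ← Complex.ofReal_mul,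
      ← Complex.ofReal_mul, ← Complex.ofReal_sub, ← Complex.ofReal_neg, ← Complex.ofReal_mul]
    refine congrArg _ ?_
    rw [meanC, ← hs, ← ht, meanSq_eq hb hc, crankY, crankZ]
    generalize P.q σ = q at *
    clear_value s t
    field_simp
    ring

end Params.Modes

/-! ### The Hellmann–Feynman identities -/

section HellmannFeynman

variable {A : ℕ} {S : Type*} [Fintype S] {P : Params} {σ : ℝ}

lemma Params.expect_routhian (P : Params) (Ψ : State A S) : expect (P.routhian A S) Ψ =
    expect (((-(P.hbar ^ 2 / (2 * P.m)) : ℝ) : ℂ) • ∑ α, ∑ k, partialD A S α k * partialD A S α k) Ψ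
      + ∑ k, ((1 / 2 * P.m * P.freq k ^ 2 : ℝ) : ℂ) * expect (sumSq A S k) Ψ
      - ((P.ω : ℂ) * expect (P.angMom A S) Ψ - P.lam * expect (P.circ A S) Ψ) := by
  rw [routhian, expect_sub, expect_add, expect_sub, expect_smul (P.ω : ℂ), expect_smul (P.lam : ℂ),
    expect_sum]
  simp only [expect_smul]

/-- An expectation that depends on the parameter `t` through `a t² + b t` only. -/
lemma hasDerivAt_expect {f : ℝ → ℂ} {K : ℂ} {a b D t : ℝ}
    (hf : ∀ u : ℝ, f u = K + (a : ℂ) * (u : ℂ) ^ 2 + b * u) (hD : 2 * a * t + b = D) :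
    HasDerivAt f (D : ℂ) t := by
  have h : HasDerivAt (fun u : ℝ => (u : ℂ)) 1 t := Complex.ofRealCLM.hasDerivAt
  have h2 := (((h.pow 2).const_mul (a : ℂ)).const_add K).add (h.const_mul (b : ℂ))
  refine (h2.congr_of_eventuallyEq (.of_forall hf)).congr_deriv ?_
  rw [← hD]
  push_cast
  ring

namespace Params.Modes

variable {M : P.Modes σ} (h : P.Stable) {N : Fin 3 → ℝ} {Ψ : State A S} (hΨ : ‖embed Ψ‖ = 1)
  (hN : ∀ j, P.quanta A S M.U M.V j Ψ = (N j : ℂ) • Ψ)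
include h hΨ hN

/-- The frequencies `Ω₊`, `Ω₋` do not depend on `ω_x`. -/
lemma hellmannFeynman_ωx : HellmannFeynman (fun t => routhian {P with ωx := t} A S)
    (fun t => energy {P with ωx := t} σ N) Ψ P.ωx := by
  have hm := h.m.ne'
  have hx := h.ωx.ne'
  refine ⟨P.hbar * N 0, hasDerivAt_expect (K := expect (routhian {P with ωx := 0} A S) Ψ)
    (a := 1 / 2 * P.m * (P.hbar / P.m * (N 0 / P.ωx))) (b := 0) (fun u => ?_) ?_, ?_⟩
  · rw [expect_routhian, expect_routhian]
    simp only [Fin.sum_univ_three, freq, Matrix.cons_val, expect_sumSq_zero h hΨ hN]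
    change _ + _ - (_ * expect (P.angMom A S) Ψ - _ * expect (P.circ A S) Ψ) =
      _ + _ - (_ * expect (P.angMom A S) Ψ - _ * expect (P.circ A S) Ψ) + _ + _
    push_cast
    ring
  · rw [add_zero]
    field_simp
  · have := (((hasDerivAt_id P.ωx).const_mul P.hbar).mul_const (N 0)).add_const
      (P.hbar * P.Ωp σ * N 1 + P.hbar * P.Ωm σ * N 2)
    refine (this.congr_of_eventuallyEq (.of_forall fun t => ?_)).congr_deriv (by ring)
    exact add_assoc _ _ _

variable (hσ : σ = 1 ∨ σ = -1) (hq : P.q σ ≠ 0)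
include hσ hq

lemma hellmannFeynman : HellmannFeynman (fun t => routhian {P with ωy := t} A S)
      (fun t => energy {P with ωy := t} σ N) Ψ P.ωy ∧
    HellmannFeynman (fun t => routhian {P with ωz := t} A S)
      (fun t => energy {P with ωz := t} σ N) Ψ P.ωz ∧
    HellmannFeynman (fun t => routhian {P with ω := t} A S)
      (fun t => energy {P with ω := t} σ N) Ψ P.ω ∧
    HellmannFeynman (fun t => routhian {P with lam := t} A S)
      (fun t => energy {P with lam := t} σ N) Ψ P.lam := by
  have hm := h.m.ne'
  obtain ⟨dy, dz, dω, dl⟩ := h.energy_deriv hσ hq N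
  obtain ⟨eL, eC⟩ := expect_generators h hΨ hN hσ hq
  have ey := expect_sumSq_one h hΨ hN hσ hq
  have ez := expect_sumSq_two h hΨ hN hσ hq
  refine ⟨⟨_, hasDerivAt_expect (K := expect (routhian {P with ωy := 0} A S) Ψ)
      (a := 1 / 2 * P.m * (P.hbar / P.m * P.meanY σ N)) (b := 0) (fun u => ?_) ?_, dy⟩,
    ⟨_, hasDerivAt_expect (K := expect (routhian {P with ωz := 0} A S) Ψ)
      (a := 1 / 2 * P.m * (P.hbar / P.m * P.meanZ σ N)) (b := 0) (fun u => ?_) ?_, dz⟩,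
    ⟨_, hasDerivAt_expect (K := expect (routhian {P with ω := 0} A S) Ψ)
      (a := 0) (b := -P.meanL σ N) (fun u => ?_) ?_, dω⟩,
    ⟨_, hasDerivAt_expect (K := expect (routhian {P with lam := 0} A S) Ψ)
      (a := 0) (b := P.meanC σ N) (fun u => ?_) ?_, dl⟩⟩
  -- the four expectations as functions of the parameter
  all_goals
    try
      rw [expect_routhian, expect_routhian]
      simp only [Fin.sum_univ_three, freq, Matrix.cons_val, ey, ez]
      change _ + _ - (_ * expect (P.angMom A S) Ψ - _ * expect (P.circ A S) Ψ) =
        _ + _ - (_ * expect (P.angMom A S) Ψ - _ * expect (P.circ A S) Ψ) + _ + _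
      rw [eL, eC]
      push_cast
      ring
  all_goals field_simp
  all_goals ring

end Params.Modes

end HellmannFeynman

/-- `I₀ ā² / (2ħ)` is the mean square coordinate in units of `ħ / m`. -/
lemma inertia_mul_axisSq {A : ℕ} {S : Type*} [Fintype S] {P : Params} (hA : 0 < A) {R : ℝ}
    (hR : 0 < R) (h : P.Stable) {Ψ : State A S} {k : Fin 3} {r : ℝ}
    (hr : expect (sumSq A S k) Ψ = ((P.hbar / P.m * r : ℝ) : ℂ)) :
    ((P.I₀ A R / (2 * P.hbar) : ℝ) : ℂ) * axisSq R Ψ k = (r : ℂ) := by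
  have hA' : (A : ℝ) ≠ 0 := by exact_mod_cast hA.ne'
  have hm := h.m.ne'
  have hh := h.hbar.ne'
  rw [axisSq, hr, ← Complex.ofReal_mul, ← Complex.ofReal_mul]
  refine congrArg _ ?_
  rw [Params.I₀]
  field_simp

/-! ### Null cranking -/

namespace Params

variable {P : Params} {σ : ℝ}

/-- Without cranking, `q` is half the difference of the squared oscillator frequencies if its sign
is chosen accordingly. -/
lemma q_of_uncranked (hy : 0 < P.ωy) (hz : 0 < P.ωz) (hσ : σ = 1 ∨ σ = -1)
    (hs : 0 ≤ σ * (P.ωy - P.ωz)) :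
    q {P with ω := 0, lam := 0} σ = 1 / 2 * (P.ωy ^ 2 - P.ωz ^ 2) := by
  have e : qSq {P with ω := 0, lam := 0} = (1 / 2 * (P.ωy ^ 2 - P.ωz ^ 2)) ^ 2 := by
    simp only [qSq]; ring
  rw [q, e, Real.sqrt_sq_eq_abs]
  have hyz := add_pos hy hz
  rcases hσ with rfl | rfl
  · rw [abs_of_nonneg (by nlinarith), one_mul]
  · rw [abs_of_nonpos (by nlinarith)]
    ring

lemma tendsto_null_cranking (hy : 0 < P.ωy) (hz : 0 < P.ωz) (hσ : σ = 1 ∨ σ = -1)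
    (hs : 0 ≤ σ * (P.ωy - P.ωz)) :
    Tendsto (fun v : ℝ × ℝ => Ωp {P with ω := v.1, lam := v.2} σ) (𝓝 0) (𝓝 P.ωy) ∧
    Tendsto (fun v : ℝ × ℝ => Ωm {P with ω := v.1, lam := v.2} σ) (𝓝 0) (𝓝 P.ωz) := by
  have hq := q_of_uncranked hy hz hσ hs
  have hm : meanSq {P with ω := 0, lam := 0} = 1 / 2 * (P.ωy ^ 2 + P.ωz ^ 2) := by
    simp only [meanSq]; ring
  constructor
  · have hc : Continuous fun v : ℝ × ℝ => Ωp {P with ω := v.1, lam := v.2} σ := by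
      simp only [Ωp, q, qSq, meanSq]; fun_prop
    have := hc.tendsto 0
    convert this using 2
    change _ = √(meanSq {P with ω := 0, lam := 0} + q {P with ω := 0, lam := 0} σ)
    rw [hq, hm, ← Real.sqrt_sq hy.le]
    congr 1
    rw [Real.sqrt_sq hy.le]
    ring
  · have hc : Continuous fun v : ℝ × ℝ => Ωm {P with ω := v.1, lam := v.2} σ := by
      simp only [Ωm, q, qSq, meanSq]; fun_prop
    have := hc.tendsto 0
    convert this using 2
    change _ = √(meanSq {P with ω := 0, lam := 0} - q {P with ω := 0, lam := 0} σ)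
    rw [hq, hm, ← Real.sqrt_sq hz.le]
    congr 1
    rw [Real.sqrt_sq hz.le]
    ring

end Params

end CrankedOscillator

end

theorem mainTheorem2 {S : Type*} [Fintype S] [Nonempty S] (A : ℕ) (hA : 0 < A)
    (R : ℝ) (hR : 0 < R) (P : CrankedOscillator.Params)
    (hhbar : 0 < P.hbar) (hm : 0 < P.m)
    (hωx : 0 < P.ωx) (hωy : 0 < P.ωy) (hωz : 0 < P.ωz) (hb : 0 < P.b) (hc : 0 < P.c)
    (hy : |P.ω - P.c / P.b * P.lam| < P.ωy) (hz : |P.ω - P.b / P.c * P.lam| < P.ωz)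
    (σ : ℝ) (hσ : σ = 1 ∨ σ = -1) :
    -- The angular momentum, the circulation and the Routhian are quadratic forms in the bosons.
    (P.angMom A S = P.bosonCirc A S 1 1 ∧
      P.circ A S = P.bosonCirc A S (P.c / P.b) (P.b / P.c) ∧
      P.routhian A S =
        ∑ α, ∑ k, ((P.hbar * P.freq k : ℝ) : ℂ) •
            (P.cre A S α k * P.ann A S α k + (1 / 2 : ℂ) • 1)
          - ((P.ω : ℂ) • P.bosonCirc A S 1 1
            - (P.lam : ℂ) • P.bosonCirc A S (P.c / P.b) (P.b / P.c))) ∧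
    -- The new frequencies are well defined and positive.
    (P.q σ ^ 2 = P.qSq ∧ 0 < P.Ωp σ ∧ 0 < P.Ωm σ ∧
      P.Ωp σ ^ 2 = P.meanSq + P.q σ ∧ P.Ωm σ ^ 2 = P.meanSq - P.q σ) ∧
    -- The eigenvalues, on the full Hilbert space and on the space of antisymmetric states.
    (∀ E : ℂ,
      (CrankedOscillator.HasL2Eigenvalue (P.routhian A S) (fun _ => True) E ↔
        ∃ n : Fin A → Fin 3 → ℕ, E = (P.energy σ (CrankedOscillator.totalQuanta n) : ℂ)) ∧
      (CrankedOscillator.HasRegularEigenvalue (P.routhian A S) (fun _ => True) E ↔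
        ∃ n : Fin A → Fin 3 → ℕ, E = (P.energy σ (CrankedOscillator.totalQuanta n) : ℂ)) ∧
      (CrankedOscillator.HasL2Eigenvalue (P.routhian A S)
          CrankedOscillator.IsAntisymmetric E ↔
        ∃ (n : Fin A → Fin 3 → ℕ) (s : Fin A → S), Function.Injective (fun α => (n α, s α)) ∧
          E = (P.energy σ (CrankedOscillator.totalQuanta n) : ℂ)) ∧
      (CrankedOscillator.HasRegularEigenvalue (P.routhian A S)
          CrankedOscillator.IsAntisymmetric E ↔
        ∃ (n : Fin A → Fin 3 → ℕ) (s : Fin A → S), Function.Injective (fun α => (n α, s α)) ∧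
          E = (P.energy σ (CrankedOscillator.totalQuanta n) : ℂ))) ∧
    -- The canonical transformation; it does not touch the `x` boson.
    (∃ U V : Matrix (Fin 3) (Fin 3) ℂ,
      U 0 = Pi.single 0 1 ∧ V 0 = 0 ∧ P.IsCanonical A S U V ∧
      -- It diagonalizes the Routhian.
      P.routhian A S =
        ((P.hbar * P.ωx : ℝ) : ℂ) • P.quanta A S U V 0
          + ((P.hbar * P.Ωp σ : ℝ) : ℂ) • P.quanta A S U V 1
          + ((P.hbar * P.Ωm σ : ℝ) : ℂ) • P.quanta A S U V 2 ∧
      -- The regular joint eigenstates of the numbers of new bosons are a complete system.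
      (∃ B : HilbertBasis ((Fin A → Fin 3 → ℕ) × (Fin A → S)) ℂ (CrankedOscillator.Hilb A S),
        ∀ (n : Fin A → Fin 3 → ℕ) (s : Fin A → S), ∃ Ψ : CrankedOscillator.State A S,
          B (n, s) = CrankedOscillator.embed Ψ ∧
          (∀ α j, P.number A S U V α j Ψ = (n α j : ℂ) • Ψ) ∧
          P.routhian A S Ψ = (P.energy σ (CrankedOscillator.totalQuanta n) : ℂ) • Ψ) ∧
      -- Normalized states with `N_x`, `N_y`, `N_z` quanta: energy and expectations.
      (∀ (N : Fin 3 → ℝ) (Ψ : CrankedOscillator.State A S),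
        ‖CrankedOscillator.embed Ψ‖ = 1 →
        (∀ j, P.quanta A S U V j Ψ = (N j : ℂ) • Ψ) →
        P.routhian A S Ψ = (P.energy σ N : ℂ) • Ψ ∧
        CrankedOscillator.HellmannFeynman
          (fun t => CrankedOscillator.Params.routhian {P with ωx := t} A S)
          (fun t => CrankedOscillator.Params.energy {P with ωx := t} σ N) Ψ P.ωx ∧
        ((P.I₀ A R / (2 * P.hbar) : ℝ) : ℂ) * CrankedOscillator.axisSq R Ψ 0
          = ((N 0 / P.ωx : ℝ) : ℂ) ∧
        (P.q σ ≠ 0 →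
          CrankedOscillator.HellmannFeynman
            (fun t => CrankedOscillator.Params.routhian {P with ωy := t} A S)
            (fun t => CrankedOscillator.Params.energy {P with ωy := t} σ N) Ψ P.ωy ∧
          CrankedOscillator.HellmannFeynman
            (fun t => CrankedOscillator.Params.routhian {P with ωz := t} A S)
            (fun t => CrankedOscillator.Params.energy {P with ωz := t} σ N) Ψ P.ωz ∧
          CrankedOscillator.HellmannFeynman
            (fun t => CrankedOscillator.Params.routhian {P with ω := t} A S)
            (fun t => CrankedOscillator.Params.energy {P with ω := t} σ N) Ψ P.ω ∧
          CrankedOscillator.HellmannFeynman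
            (fun t => CrankedOscillator.Params.routhian {P with lam := t} A S)
            (fun t => CrankedOscillator.Params.energy {P with lam := t} σ N) Ψ P.lam ∧
          ((P.I₀ A R / (2 * P.hbar) : ℝ) : ℂ) * CrankedOscillator.axisSq R Ψ 1
            = ((1 / 2 * P.ratioSum σ N + 1 / (2 * P.q σ) * P.ratioDiff σ N *
                (1 / 2 * (P.ωy ^ 2 - P.ωz ^ 2) + 2 * P.ω ^ 2
                  + (1 + P.b ^ 2 / P.c ^ 2) * P.lam ^ 2
                  - (P.c / P.b + 3 * (P.b / P.c)) * P.ω * P.lam) : ℝ) : ℂ) ∧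
          ((P.I₀ A R / (2 * P.hbar) : ℝ) : ℂ) * CrankedOscillator.axisSq R Ψ 2
            = ((1 / 2 * P.ratioSum σ N - 1 / (2 * P.q σ) * P.ratioDiff σ N *
                (1 / 2 * (P.ωy ^ 2 - P.ωz ^ 2) - 2 * P.ω ^ 2
                  - (1 + P.c ^ 2 / P.b ^ 2) * P.lam ^ 2
                  + (P.b / P.c + 3 * (P.c / P.b)) * P.ω * P.lam) : ℝ) : ℂ) ∧
          CrankedOscillator.expect (P.angMom A S) Ψ
            = ((-P.hbar * P.ratioSum σ N * (P.ω - 1 / 2 * (P.c / P.b + P.b / P.c) * P.lam)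
                - P.hbar / (2 * P.q σ) * P.ratioDiff σ N *
                  (2 * (P.ωy ^ 2 + P.ωz ^ 2) * P.ω
                    - 1 / 2 * ((P.b / P.c + 3 * (P.c / P.b)) * P.ωz ^ 2
                      + (P.c / P.b + 3 * (P.b / P.c)) * P.ωy ^ 2) * P.lam) : ℝ) : ℂ) ∧
          CrankedOscillator.expect (P.circ A S) Ψ
            = ((P.hbar * P.ratioSum σ N * (P.lam - 1 / 2 * (P.c / P.b + P.b / P.c) * P.ω)
                + P.hbar / (2 * P.q σ) * P.ratioDiff σ N *
                  ((P.b ^ 2 + P.c ^ 2) * (P.ωy ^ 2 / P.c ^ 2 + P.ωz ^ 2 / P.b ^ 2) * P.lam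
                    - 1 / 2 * ((P.c / P.b + 3 * (P.b / P.c)) * P.ωy ^ 2
                      + (P.b / P.c + 3 * (P.c / P.b)) * P.ωz ^ 2) * P.ω) : ℝ) : ℂ)))) ∧
    -- Null cranking: with the sign of `q` that agrees with that of `ω_y - ω_z`.
    (0 ≤ σ * (P.ωy - P.ωz) →
      Tendsto (fun v : ℝ × ℝ => CrankedOscillator.Params.Ωp {P with ω := v.1, lam := v.2} σ) (𝓝 0) (𝓝 P.ωy) ∧
      Tendsto (fun v : ℝ × ℝ => CrankedOscillator.Params.Ωm {P with ω := v.1, lam := v.2} σ) (𝓝 0) (𝓝 P.ωz)) := by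
  have h : P.Stable := ⟨hhbar, hm, hωx, hωy, hωz, hb, hc, hy, hz⟩
  obtain ⟨M⟩ := h.exists_modes hσ
  obtain ⟨g, hg⟩ := M.exists_isVacuum h A S
  refine ⟨⟨CrankedOscillator.Params.Stable.angMom_eq h, CrankedOscillator.Params.Stable.circ_eq h, h.routhian_eq_bosons⟩,
    ⟨h.q_sq hσ, h.Ωp_pos hσ, h.Ωm_pos hσ, h.Ωp_sq hσ, h.Ωm_sq hσ⟩,
    fun E => hg.spectrum h E, ?_, fun hs => CrankedOscillator.Params.tendsto_null_cranking hωy hωz hσ hs⟩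
  refine ⟨M.U, M.V, M.U_zero h, M.V_zero, M.isCanonical h, M.routhian_eq_quanta h,
    ⟨hg.basis, fun n s => ⟨M.fockState g n s, hg.basis_apply n s, fun α j => ?_,
      hg.routhian_fockState h n s⟩⟩, fun N Ψ hΨ hN => ?_⟩
  · rw [M.number_eq_cre_mul_ann h]
    exact hg.number_fockState n s α j
  · refine ⟨M.routhian_apply_of_quanta h hN, CrankedOscillator.Params.Modes.hellmannFeynman_ωx h hΨ hN,
      CrankedOscillator.inertia_mul_axisSq hA hR h (CrankedOscillator.Params.Modes.expect_sumSq_zero h hΨ hN), fun hq => ?_⟩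
    obtain ⟨e1, e2, e3, e4⟩ := CrankedOscillator.Params.Modes.hellmannFeynman h hΨ hN hσ hq
    obtain ⟨eL, eC⟩ := CrankedOscillator.Params.Modes.expect_generators h hΨ hN hσ hq
    exact ⟨e1, e2, e3, e4,
      CrankedOscillator.inertia_mul_axisSq hA hR h (CrankedOscillator.Params.Modes.expect_sumSq_one h hΨ hN hσ hq),
      CrankedOscillator.inertia_mul_axisSq hA hR h (CrankedOscillator.Params.Modes.expect_sumSq_two h hΨ hN hσ hq), eL, eC⟩
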